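/- Let $n$ be a non-negative integer and let $Y_n=Y(\mathfrak{gl}_n)$ be the Yangian over $\mathbb C$ in its RTT presentation: the unital associative $\mathbb C$-algebra on generators $T_{i,j}^{(r)}$ ($1\le i,j\le n$, $r\ge 1$), with $T_{i,j}^{(0)}:=\delta_{i,j}$, $T_{i,j}(u):=\sum_{r\ge 0}T_{i,j}^{(r)}u^{-r}$, $T(u):=\sum_{i,j} e_{i,j}\otimes T_{i,j}(u)$, subject to the relations given by $$R^{[1,2]}(u-v)\,T^{[1,3]}(u)\,T^{[2,3]}(v)=T^{[2,3]}(v)\,T^{[1,3]}(u)\,R^{[1,2]}(u-v),\qquad R(u)=u-\sum_{i,j=1}^n e_{i,j}\otimes e_{j,i},$$ where the superscripts indicate the tensor positions in $M_n\otimes M_n\otimes Y_n$. The matrix $T(u)$ over $Y_n[[u^{-1}]]$ has a unique Gauss factorization $T(u)=F(u)D(u)E(u)$ with $D(u)=\operatorname{diag}(D_1(u),\dots,D_n(u))$ diagonal, $E(u)$ upper unitriangular and $F(u)$ lower unitriangular, all with entries in $Y_n[[u^{-1}]]$. Write $D_i(u)=\sum_{r\ge0}D_i^{(r)}u^{-r}$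 and $\widetilde D_i(u)=\sum_{r\ge0}\widetilde D_i^{(r)}u^{-r}:=-D_i(u)^{-1}$ for $1\le i\le n$; for $1\le i<n$ let $E_i^{(r)}$ be the $u^{-r}$-coefficient of the $(i,i+1)$-entry of $E(u)$ and $F_i^{(r)}$ the $u^{-r}$-coefficient of the $(i+1,i)$-entry of $F(u)$. Then the algebra $Y_n$ is generated by the elements $\{D_i^{(r)},\widetilde D_i^{(r)}\}_{1\le i\le n,\,r\ge0}$ and $\{E_i^{(r)},F_i^{(r)}\}_{1\le i<n,\,r\ge1}$ subject only to the following relations, for all admissible $i,j,r,s,t$ (superscripts of $D$ and $\widetilde D$ being $\ge 0$, those of $E$ and $F$ being $\ge1$): \begin{align} D_i^{(0)}&=1,\\ \sum_{t=0}^r D_i^{(t)}\widetilde D_i^{(r-t)}&=-\delta_{r,0},\\ [D_i^{(r)},D_j^{(s)}]&=0,\\ [E_i^{(r)},F_j^{(s)}]&=\delta_{i,j}\sum_{t=0}^{r+s-1}\widetilde D_i^{(t)}D_{i+1}^{(r+s-1-t)},\\ [D_i^{(r)},E_j^{(s)}]&=(\delta_{i,j}-\delta_{i,j+1})\sum_{t=0}^{r-1}D_i^{(t)}E_j^{(r+s-1-t)},\\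 [D_i^{(r)},F_j^{(s)}]&=(\delta_{i,j+1}-\delta_{i,j})\sum_{t=0}^{r-1}F_j^{(r+s-1-t)}D_i^{(t)},\\ [E_i^{(r)},E_i^{(s)}]&=\sum_{t=1}^{s-1}E_i^{(t)}E_i^{(r+s-1-t)}-\sum_{t=1}^{r-1}E_i^{(t)}E_i^{(r+s-1-t)},\\ [F_i^{(r)},F_i^{(s)}]&=\sum_{t=1}^{r-1}F_i^{(r+s-1-t)}F_i^{(t)}-\sum_{t=1}^{s-1}F_i^{(r+s-1-t)}F_i^{(t)},\\ [E_i^{(r)},E_{i+1}^{(s+1)}]-[E_i^{(r+1)},E_{i+1}^{(s)}]&=-E_i^{(r)}E_{i+1}^{(s)},\\ [F_i^{(r+1)},F_{i+1}^{(s)}]-[F_i^{(r)},F_{i+1}^{(s+1)}]&=-F_{i+1}^{(s)}F_i^{(r)},\\ [E_i^{(r)},E_j^{(s)}]&=0\quad\text{if }|i-j|>1,\\ [F_i^{(r)},F_j^{(s)}]&=0\quad\text{if }|i-j|>1,\\ [E_i^{(r)},[E_i^{(s)},E_j^{(t)}]]+[E_i^{(s)},[E_i^{(r)},E_j^{(t)}]]&=0\quad\text{if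 }|i-j|=1,\\ [F_i^{(r)},[F_i^{(s)},F_j^{(t)}]]+[F_i^{(s)},[F_i^{(r)},F_j^{(t)}]]&=0\quad\text{if }|i-j|=1. \end{align} That is, the algebra defined by these generators and relations is isomorphic to $Y_n$ by an isomorphism that sends each generator to the element of $Y_n$ with the same name. -/

import Mathlib

open scoped Matrix Kronecker

noncomputable section

namespace YangianGL

/-! ### Yang's R-matrix and the RTT equation

Put `x = u⁻¹` and `y = v⁻¹`.  The ring of series in `x, y` over `A` is realised as
`A⟦y⟧⟦x⟧ = PowerSeries (PowerSeries A)`: the coefficient of `u⁻ʳ v⁻ˢ` of `f` is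
`coeff s (coeff r f)`.  All elements of `M_n ⊗ M_n ⊗ A⟦x, y⟧` are matrices indexed by
`Fin n × Fin n`. -/

section RTT

variable {A : Type*} [Ring A] {n : ℕ}

/-- The flip `∑ e_{i,j} ⊗ e_{j,i}` in `M_n ⊗ M_n`. -/
def flip (A : Type*) [Ring A] (n : ℕ) :
    Matrix (Fin n × Fin n) (Fin n × Fin n) (PowerSeries (PowerSeries A)) :=
  ∑ i : Fin n, ∑ j : Fin n, Matrix.single i j 1 ⊗ₖ Matrix.single j i 1

/-- The series `u⁻¹`. -/
def uInv (A : Type*) [Ring A] : PowerSeries (PowerSeries A) := PowerSeries.X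

/-- The series `v⁻¹`. -/
def vInv (A : Type*) [Ring A] : PowerSeries (PowerSeries A) := PowerSeries.C PowerSeries.X

/-- `u⁻¹ v⁻¹ R(u - v)`, where `R(u) = u - ∑ e_{i,j} ⊗ e_{j,i}` is Yang's R-matrix.  The central
unit `u⁻¹ v⁻¹` of the localization clears denominators, as
`u⁻¹ v⁻¹ (u - v) = v⁻¹ - u⁻¹`. -/
def rMatrix (A : Type*) [Ring A] (n : ℕ) :
    Matrix (Fin n × Fin n) (Fin n × Fin n) (PowerSeries (PowerSeries A)) :=
  (vInv A - uInv A) • (1 : Matrix (Fin n × Fin n) (Fin n × Fin n) (PowerSeries (PowerSeries A)))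
    - (uInv A * vInv A) • flip A n

/-- `T^{[1,3]}(u)`. -/
def tensorU (T : Matrix (Fin n) (Fin n) (PowerSeries A)) :
    Matrix (Fin n × Fin n) (Fin n × Fin n) (PowerSeries (PowerSeries A)) :=
  T.map (PowerSeries.map PowerSeries.C) ⊗ₖ 1

/-- `T^{[2,3]}(v)`. -/
def tensorV (T : Matrix (Fin n) (Fin n) (PowerSeries A)) :
    Matrix (Fin n × Fin n) (Fin n × Fin n) (PowerSeries (PowerSeries A)) :=
  1 ⊗ₖ T.map PowerSeries.C

/-- The left side `R^{[1,2]}(u-v) T^{[1,3]}(u) T^{[2,3]}(v)`, times `u⁻¹ v⁻¹`. -/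
def rttLeft (T : Matrix (Fin n) (Fin n) (PowerSeries A)) :
    Matrix (Fin n × Fin n) (Fin n × Fin n) (PowerSeries (PowerSeries A)) :=
  rMatrix A n * tensorU T * tensorV T

/-- The right side `T^{[2,3]}(v) T^{[1,3]}(u) R^{[1,2]}(u-v)`, times `u⁻¹ v⁻¹`. -/
def rttRight (T : Matrix (Fin n) (Fin n) (PowerSeries A)) :
    Matrix (Fin n × Fin n) (Fin n × Fin n) (PowerSeries (PowerSeries A)) :=
  tensorV T * tensorU T * rMatrix A n

end RTT

/-! ### The Yangian `Y_n` -/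

/-- The free algebra on the symbols `T_{i,j}^{(r)}`, `r ≥ 1`; the letter `(i, j, r)` stands for
`T_{i,j}^{(r+1)}`. -/
abbrev FreeT (n : ℕ) : Type := FreeAlgebra ℂ (Fin n × Fin n × ℕ)

/-- `T_{i,j}^{(r)}` for `r ≥ 0`, where `T_{i,j}^{(0)} = δ_{i,j}`. -/
def freeT {n : ℕ} (i j : Fin n) : ℕ → FreeT n
  | 0 => if i = j then 1 else 0
  | r + 1 => FreeAlgebra.ι ℂ (i, j, r)

/-- The matrix `T(u)` with entries `∑ T_{i,j}^{(r)} u⁻ʳ`, over the free algebra. -/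
def freeTMatrix (n : ℕ) : Matrix (Fin n) (Fin n) (PowerSeries (FreeT n)) :=
  Matrix.of fun i j => PowerSeries.mk (freeT i j)

/-- All the relations that are contained in the RTT equation: equality of the
`u⁻ʳ v⁻ˢ`-coefficients of the `(p, q)`-entries of its two sides. -/
inductive RTTRel (n : ℕ) : FreeT n → FreeT n → Prop
  | rtt (p q : Fin n × Fin n) (r s : ℕ) :
      RTTRel n
        (PowerSeries.coeff s (PowerSeries.coeff r (rttLeft (freeTMatrix n) p q)))
        (PowerSeries.coeff s (PowerSeries.coeff r (rttRight (freeTMatrix n) p q)))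

/-- The Yangian `Y_n = Y(gl_n)` over `ℂ`, in the RTT presentation. -/
abbrev Yangian (n : ℕ) : Type := RingQuot (RTTRel n)

/-- The element `T_{i,j}^{(r)}` of `Y_n`. -/
def genT {n : ℕ} (i j : Fin n) (r : ℕ) : Yangian n :=
  RingQuot.mkAlgHom ℂ (RTTRel n) (freeT i j r)

/-- The matrix `T(u)` over `Y_n⟦u⁻¹⟧`. -/
def tMatrix (n : ℕ) : Matrix (Fin n) (Fin n) (PowerSeries (Yangian n)) :=
  Matrix.of fun i j => PowerSeries.mk (genT i j)

/-! ### Gauss factorization -/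

/-- Candidates for the three factors of a Gauss factorization: two `n × n` matrices `F`, `E` and
the diagonal entries `D_1, …, D_n` of a diagonal matrix. -/
@[ext]
structure GaussFactors (n : ℕ) (B : Type*) where
  F : Matrix (Fin n) (Fin n) B
  D : Fin n → B
  E : Matrix (Fin n) (Fin n) B

/-- `T = F D E` with `F` lower unitriangular, `D` diagonal and `E` upper unitriangular. -/
structure GaussFactors.IsFactorizationOf {n : ℕ} {B : Type*} [Ring B]
    (G : GaussFactors n B) (T : Matrix (Fin n) (Fin n) B) : Prop where
  F_diag : ∀ i, G.F i i = 1
  F_upper : ∀ i j, i < j → G.F i j = 0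
  E_diag : ∀ i, G.E i i = 1
  E_lower : ∀ i j, j < i → G.E i j = 0
  eq_mul : T = G.F * Matrix.diagonal G.D * G.E

/-- The index `i`, for `1 ≤ i < n`, as an index in `1, …, n`. -/
def lo {n : ℕ} (i : Fin (n - 1)) : Fin n := ⟨i, by omega⟩

/-- The index `i + 1`, for `1 ≤ i < n`, as an index in `1, …, n`. -/
def hi {n : ℕ} (i : Fin (n - 1)) : Fin n := ⟨i + 1, by omega⟩

namespace GaussFactors

variable {n : ℕ} {A : Type*} [Ring A] (G : GaussFactors n (PowerSeries A))

/-- `D_i^{(r)}`, the coefficient of `u⁻ʳ` in `D_i(u)`. -/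
def coeffD (i : Fin n) (r : ℕ) : A := PowerSeries.coeff r (G.D i)

/-- `D̃_i^{(r)}`, the coefficient of `u⁻ʳ` in `D̃_i(u) = -D_i(u)⁻¹`. -/
def coeffDt (i : Fin n) (r : ℕ) : A := PowerSeries.coeff r (-Ring.inverse (G.D i))

/-- `E_i^{(r)}`, the coefficient of `u⁻ʳ` in `E_i(u) = E_{i,i+1}(u)`, the `(i, i+1)`-entry of
`E(u)`. -/
def coeffE (i : Fin (n - 1)) (r : ℕ) : A := PowerSeries.coeff r (G.E (lo i) (hi i))

/-- `F_i^{(r)}`, the coefficient of `u⁻ʳ` in `F_i(u) = F_{i,i+1}(u)`, the `(i+1, i)`-entry of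
`F(u)`. -/
def coeffF (i : Fin (n - 1)) (r : ℕ) : A := PowerSeries.coeff r (G.F (hi i) (lo i))

end GaussFactors

/-! ### The algebra with Drinfeld's generators and relations -/

/-- The generating symbols.  `D i r` and `Dt i r` stand for `D_i^{(r)}` and `D̃_i^{(r)}` with
`r ≥ 0`, whereas `E i r` and `F i r` stand for `E_i^{(r+1)}` and `F_i^{(r+1)}`. -/
inductive DrinfeldGen (n : ℕ) : Type
  | D (i : Fin n) (r : ℕ)
  | Dt (i : Fin n) (r : ℕ)
  | E (i : Fin (n - 1)) (r : ℕ)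
  | F (i : Fin (n - 1)) (r : ℕ)

/-- The free algebra on these symbols. -/
abbrev FreeDr (n : ℕ) : Type := FreeAlgebra ℂ (DrinfeldGen n)

/-- `D_i^{(r)}`, `r ≥ 0`. -/
def frD {n : ℕ} (i : Fin n) (r : ℕ) : FreeDr n := FreeAlgebra.ι ℂ (.D i r)

/-- `D̃_i^{(r)}`, `r ≥ 0`. -/
def frDt {n : ℕ} (i : Fin n) (r : ℕ) : FreeDr n := FreeAlgebra.ι ℂ (.Dt i r)

/-- `E_i^{(r)}`, used for `r ≥ 1` only (the value at `r = 0` is a dummy). -/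
def frE {n : ℕ} (i : Fin (n - 1)) : ℕ → FreeDr n
  | 0 => 0
  | r + 1 => FreeAlgebra.ι ℂ (.E i r)

/-- `F_i^{(r)}`, used for `r ≥ 1` only (the value at `r = 0` is a dummy). -/
def frF {n : ℕ} (i : Fin (n - 1)) : ℕ → FreeDr n
  | 0 => 0
  | r + 1 => FreeAlgebra.ι ℂ (.F i r)

/-- The Kronecker delta, as an integer. -/
def delta {α : Type*} [DecidableEq α] (a b : α) : ℤ := if a = b then 1 else 0

/-- Drinfeld's relations.  The bracket is the commutator `⁅a, b⁆ = a * b - b * a`. -/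
inductive DrinfeldRel (n : ℕ) : FreeDr n → FreeDr n → Prop
  | r0 (i : Fin n) : DrinfeldRel n (frD i 0) 1
  | r1 (i : Fin n) (r : ℕ) :
      DrinfeldRel n (∑ t ∈ Finset.Icc 0 r, frD i t * frDt i (r - t)) (-delta r 0 • 1)
  | r2 (i j : Fin n) (r s : ℕ) : DrinfeldRel n ⁅frD i r, frD j s⁆ 0
  | r3 (i j : Fin (n - 1)) (r s : ℕ) (hr : 1 ≤ r) (hs : 1 ≤ s) :
      DrinfeldRel n ⁅frE i r, frF j s⁆
        (delta i j • ∑ t ∈ Finset.Icc 0 (r + s - 1), frDt (lo i) t * frD (hi i) (r + s - 1 - t))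
  | r4 (i : Fin n) (j : Fin (n - 1)) (r s : ℕ) (hs : 1 ≤ s) :
      DrinfeldRel n ⁅frD i r, frE j s⁆
        ((delta i (lo j) - delta i (hi j)) •
          ∑ t ∈ Finset.range r, frD i t * frE j (r + s - 1 - t))
  | r5 (i : Fin n) (j : Fin (n - 1)) (r s : ℕ) (hs : 1 ≤ s) :
      DrinfeldRel n ⁅frD i r, frF j s⁆
        ((delta i (hi j) - delta i (lo j)) •
          ∑ t ∈ Finset.range r, frF j (r + s - 1 - t) * frD i t)
  | r6 (i : Fin (n - 1)) (r s : ℕ) (hr : 1 ≤ r) (hs : 1 ≤ s) :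
      DrinfeldRel n ⁅frE i r, frE i s⁆
        (∑ t ∈ Finset.Icc 1 (s - 1), frE i t * frE i (r + s - 1 - t)
          - ∑ t ∈ Finset.Icc 1 (r - 1), frE i t * frE i (r + s - 1 - t))
  | r7 (i : Fin (n - 1)) (r s : ℕ) (hr : 1 ≤ r) (hs : 1 ≤ s) :
      DrinfeldRel n ⁅frF i r, frF i s⁆
        (∑ t ∈ Finset.Icc 1 (r - 1), frF i (r + s - 1 - t) * frF i t
          - ∑ t ∈ Finset.Icc 1 (s - 1), frF i (r + s - 1 - t) * frF i t)
  | r8 (i j : Fin (n - 1)) (hij : (j : ℕ) = i + 1) (r s : ℕ) (hr : 1 ≤ r) (hs : 1 ≤ s) :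
      DrinfeldRel n (⁅frE i r, frE j (s + 1)⁆ - ⁅frE i (r + 1), frE j s⁆) (-(frE i r * frE j s))
  | r9 (i j : Fin (n - 1)) (hij : (j : ℕ) = i + 1) (r s : ℕ) (hr : 1 ≤ r) (hs : 1 ≤ s) :
      DrinfeldRel n (⁅frF i (r + 1), frF j s⁆ - ⁅frF i r, frF j (s + 1)⁆) (-(frF j s * frF i r))
  | r10 (i j : Fin (n - 1)) (hij : 1 < |(i : ℤ) - (j : ℤ)|) (r s : ℕ) (hr : 1 ≤ r) (hs : 1 ≤ s) :
      DrinfeldRel n ⁅frE i r, frE j s⁆ 0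
  | r11 (i j : Fin (n - 1)) (hij : 1 < |(i : ℤ) - (j : ℤ)|) (r s : ℕ) (hr : 1 ≤ r) (hs : 1 ≤ s) :
      DrinfeldRel n ⁅frF i r, frF j s⁆ 0
  | r12 (i j : Fin (n - 1)) (hij : |(i : ℤ) - (j : ℤ)| = 1) (r s t : ℕ)
      (hr : 1 ≤ r) (hs : 1 ≤ s) (ht : 1 ≤ t) :
      DrinfeldRel n (⁅frE i r, ⁅frE i s, frE j t⁆⁆ + ⁅frE i s, ⁅frE i r, frE j t⁆⁆) 0
  | r13 (i j : Fin (n - 1)) (hij : |(i : ℤ) - (j : ℤ)| = 1) (r s t : ℕ)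
      (hr : 1 ≤ r) (hs : 1 ≤ s) (ht : 1 ≤ t) :
      DrinfeldRel n (⁅frF i r, ⁅frF i s, frF j t⁆⁆ + ⁅frF i s, ⁅frF i r, frF j t⁆⁆) 0

/-- The associative unital algebra with Drinfeld's generators, subject only to Drinfeld's
relations. -/
abbrev DrinfeldYangian (n : ℕ) : Type := RingQuot (DrinfeldRel n)

/-- The quotient map from the free algebra. -/
def drMk (n : ℕ) : FreeDr n →ₐ[ℂ] DrinfeldYangian n := RingQuot.mkAlgHom ℂ (DrinfeldRel n)

end YangianGL

end

/-! Homomorphisms are built in both directions between the Drinfeld presentation and the RTT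
presentation, and both composites are checked to be the identity on small generating sets. The
inverse is explicit, so no PBW basis or dimension count is needed to see that there are no further
relations.

From Drinfeld to RTT (`exists_drinfeld_lift`), the Gauss factors of any solution of the RTT equation
must satisfy Drinfeld's relations. Three mechanisms suffice. First, the elements T_{ij}^{(1)} act on
T(u) as the matrix units of gl_n (`IsRTT.lie_one`), so E_i^{(1)} = T_{i,i+1}^{(1)} has explicit
commutators with F(u), D(u) and E(u) (`gauss_covariance`). Second, the RTT relations survive
inversion and restriction to a principal block, hence hold for the iterated Schur complements of
T(u) (`RTTPair.schur`); the corner D_i(u) and first row D_i(u)E_{ij}(u) of a Schur complement give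
the commutativity of the D's and the commutator of D_i with E_i (`RTTPair.commute_D`,
`D_E_relation`). Third, certain polynomials in D_a^{(1)}, D_a^{(2)}, D_a^{(3)} raise the degree of
E_j by one or two under the commutator (`shiftOne_lie`, `shiftTwo_lie`), so the remaining relations
propagate from lowest degree (`IsHalfSeed`). Transposition into the opposite algebra turns
statements about E into statements about F (`IsRTT.op`).

From RTT to Drinfeld (`exists_yangian_to_drinfeld`), a solution T(u) is constructed from D_1(u)
alone. The degree-one generators satisfy the Chevalley–Serre relations, so they yield matrix units
of gl_n (`IsChevalley.glRoot_lie`). Each D_1^{(r)} then generates under them a family on which gl_n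
acts as on matrix units (`actsAsUnit_adjFamily`), and this family is taken as T_{ij}^{(r)}. The
failure of the RTT relations is a gl_n-covariant tensor; it vanishes as soon as four of its
components do (`rttDefect_eq_zero`), and these are a computation with two indices
(`IsDrinfeld.rttDefect_drT`).

Finally, each side is generated by D_1^{(r)} = T_{11}^{(r)}, E_j^{(1)} = T_{j,j+1}^{(1)} and
F_j^{(1)} = T_{j+1,j}^{(1)} (`IsDrinfeld.mem`, `IsRTT.mem`), which the two maps exchange. -/

noncomputable section

namespace YangianGL

/-! ### Root vectors of `gl_n` from Chevalley generators -/

section Chevalley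

variable {L : Type*} [LieRing L]

/-- Elements of a Lie ring that satisfy the Chevalley–Serre relations of `gl_n`, numbered from
`0`; the elements `e i`, `f i` with `i + 1 ≥ n` are junk that satisfies the same relations. -/
structure IsChevalley (n : ℕ) (e f h : ℕ → L) : Prop where
  two : ∀ x : L, x + x = 0 → x = 0
  hh : ∀ i j, ⁅h i, h j⁆ = 0
  he : ∀ i j, ⁅h i, e j⁆ = (if i = j then e j else 0) - (if i = j + 1 then e j else 0)
  hf : ∀ i j, ⁅h i, f j⁆ = (if i = j + 1 then f j else 0) - (if i = j then f j else 0)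
  ef : ∀ i j, i ≠ j → ⁅e i, f j⁆ = 0
  ef_self : ∀ i, i + 1 < n → ⁅e i, f i⁆ = h i - h (i + 1)
  ee : ∀ i j, i + 1 < j → ⁅e i, e j⁆ = 0
  ff : ∀ i j, i + 1 < j → ⁅f i, f j⁆ = 0
  eee_succ : ∀ i, ⁅e i, ⁅e i, e (i + 1)⁆⁆ = 0
  eee_pred : ∀ i, ⁅e (i + 1), ⁅e (i + 1), e i⁆⁆ = 0
  fff_succ : ∀ i, ⁅f i, ⁅f i, f (i + 1)⁆⁆ = 0
  fff_pred : ∀ i, ⁅f (i + 1), ⁅f (i + 1), f i⁆⁆ = 0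

/-- The root vector `e_{i, i+1+d}`, an iterated commutator of `e i, …, e (i + d)`. -/
def posRoot (e : ℕ → L) (i : ℕ) : ℕ → L
  | 0 => e i
  | d + 1 => ⁅posRoot e i d, e (i + 1 + d)⁆

namespace IsChevalley

variable {n : ℕ} {e f h : ℕ → L} (H : IsChevalley n e f h)
include H

/-- The Chevalley involution. -/
theorem involution : IsChevalley n (fun i => -f i) (fun i => -e i) (fun i => -h i) where
  two := H.two
  hh i j := by simp [H.hh]
  he i j := by
    simp only [neg_lie, lie_neg, neg_neg, H.hf]; split_ifs <;> simp
  hf i j := by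
    simp only [neg_lie, lie_neg, neg_neg, H.he]; split_ifs <;> simp
  ef i j hij := by
    simp only [neg_lie, lie_neg, neg_neg]; rw [← lie_skew, H.ef j i hij.symm, neg_zero]
  ef_self i hi := by
    simp only [neg_lie, lie_neg, neg_neg]; rw [← lie_skew, H.ef_self i hi]; abel
  ee i j hij := by simp [H.ff i j hij]
  ff i j hij := by simp [H.ee i j hij]
  eee_succ i := by simp [H.fff_succ]
  eee_pred i := by simp [H.fff_pred]
  fff_succ i := by simp [H.eee_succ]
  fff_pred i := by simp [H.eee_pred]

theorem ee_of_far {i j : ℕ} (hij : i + 1 < j ∨ j + 1 < i) : ⁅e i, e j⁆ = 0 := by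
  rcases hij with h1 | h1
  · exact H.ee i j h1
  · rw [← lie_skew, H.ee j i h1, neg_zero]

theorem e_posRoot_outside (k i d : ℕ) (hk : k + 1 < i ∨ i + 1 + d < k) :
    ⁅e k, posRoot e i d⁆ = 0 := by
  induction d with
  | zero => exact H.ee_of_far (by omega)
  | succ d ih =>
    rw [posRoot, leibniz_lie, ih (by omega), H.ee_of_far (i := k) (by omega)]; simp

theorem e_posRoot_pred (k d : ℕ) : ⁅e k, posRoot e (k + 1) d⁆ = posRoot e k (d + 1) := by
  induction d with
  | zero => simp [posRoot]
  | succ d ih =>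
    rw [posRoot, leibniz_lie, ih, H.ee_of_far (i := k) (by omega), lie_zero, add_zero]
    conv_rhs => rw [posRoot]
    congr 2; omega

theorem e_posRoot_first (i d : ℕ) : ⁅e i, posRoot e i d⁆ = 0 := by
  induction d with
  | zero => simp [posRoot]
  | succ d ih =>
    rw [posRoot, leibniz_lie, ih, zero_lie, zero_add]
    rcases d with _ | d
    · simpa [posRoot] using H.eee_succ i
    · rw [H.ee_of_far (i := i) (by omega), lie_zero]

/-- For a long root the last generator b commutes with the initial part p, so ⁅⁅p, a⁆, b⁆ = ⁅p, ⁅a,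
b⁆⁆, and the Serre relation ⁅b, ⁅a, b⁆⁆ = 0 applies. -/
theorem e_posRoot_last (i d : ℕ) : ⁅e (i + d), posRoot e i d⁆ = 0 := by
  rcases d with _ | _ | d
  · simp [posRoot]
  · have := H.eee_pred i
    rw [← lie_skew (e (i + 1)) (e i), lie_neg, neg_eq_zero] at this
    simpa [posRoot] using this
  · have h1 := H.e_posRoot_outside (i + (d + 2)) i d (by omega)
    have h2 := H.eee_pred (i + 1 + d)
    rw [← lie_skew (e (i + 1 + d + 1)) (e (i + 1 + d)), lie_neg, neg_eq_zero] at h2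
    have e1 : i + 1 + d + 1 = i + (d + 2) := by omega
    have e2 : i + 1 + (d + 1) = i + (d + 2) := by omega
    have h1' : ⁅posRoot e i d, e (i + (d + 2))⁆ = 0 := by rw [← lie_skew, h1, neg_zero]
    rw [e1] at h2
    rw [posRoot, posRoot, e2]
    have h3 : ⁅⁅posRoot e i d, e (i + 1 + d)⁆, e (i + (d + 2))⁆ =
        ⁅posRoot e i d, ⁅e (i + 1 + d), e (i + (d + 2))⁆⁆ := by
      rw [leibniz_lie (posRoot e i d), h1', lie_zero, add_zero]
    change ⁅e (i + (d + 2)), ⁅⁅posRoot e i d, e (i + 1 + d)⁆, e (i + (d + 2))⁆⁆ = 0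
    rw [h3, leibniz_lie, h1, zero_lie, h2, lie_zero, add_zero]

/-- Let x = ⁅a, ⁅⁅p, a⁆, b⁆⁆. Since ⁅a, ⁅p, a⁆⁆ = 0, x equals ⁅⁅p, a⁆, ⁅a, b⁆⁆; applying ⁅p, ·⁆ to
the Serre relation ⁅a, ⁅a, b⁆⁆ = 0 shows that the same bracket is -x. This is where the absence of
2-torsion is needed. -/
theorem e_posRoot_penultimate (i d : ℕ) : ⁅e (i + 1 + d), posRoot e i (d + 2)⁆ = 0 := by
  set p := posRoot e i d with hp
  set a := e (i + 1 + d) with ha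
  set b := e (i + 1 + (d + 1)) with hb
  have hpb : ⁅b, p⁆ = 0 := H.e_posRoot_outside _ _ _ (by omega)
  have hpb' : ⁅p, b⁆ = 0 := by rw [← lie_skew, hpb, neg_zero]
  have hq : ⁅a, ⁅p, a⁆⁆ = 0 := by
    have := H.e_posRoot_last i (d + 1)
    rwa [posRoot, show i + (d + 1) = i + 1 + d by omega] at this
  have haab : ⁅a, ⁅a, b⁆⁆ = 0 := H.eee_succ (i + 1 + d)
  have key : ⁅p, ⁅a, b⁆⁆ = ⁅⁅p, a⁆, b⁆ := by rw [leibniz_lie p, hpb', lie_zero, add_zero]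
  have h1 : ⁅a, ⁅⁅p, a⁆, b⁆⁆ = ⁅⁅p, a⁆, ⁅a, b⁆⁆ := by rw [leibniz_lie, hq, zero_lie, zero_add]
  have h2 : ⁅⁅p, a⁆, ⁅a, b⁆⁆ = -⁅a, ⁅⁅p, a⁆, b⁆⁆ := by
    have := leibniz_lie p a ⁅a, b⁆
    rw [haab, lie_zero, key] at this
    exact eq_neg_of_add_eq_zero_left this.symm
  change ⁅a, ⁅⁅p, a⁆, b⁆⁆ = 0
  apply H.two
  nth_rewrite 1 [h1]
  rw [h2, neg_add_cancel]

theorem e_posRoot_inside (k i d : ℕ) (h1 : i ≤ k) (h2 : k ≤ i + d) : ⁅e k, posRoot e i d⁆ = 0 := by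
  induction d with
  | zero => obtain rfl : k = i := by omega
            exact H.e_posRoot_first _ _
  | succ d ih =>
    rcases eq_or_lt_of_le h1 with rfl | h1'
    · exact H.e_posRoot_first _ _
    rcases eq_or_lt_of_le h2 with rfl | h2'
    · exact H.e_posRoot_last _ _
    by_cases h3 : k = i + d
    · obtain ⟨m, rfl⟩ : ∃ m, d = m + 1 := ⟨d - 1, by omega⟩
      obtain rfl : k = i + 1 + m := by omega
      exact H.e_posRoot_penultimate i m
    · rw [posRoot, leibniz_lie, ih (by omega), H.ee_of_far (i := k) (by omega)]; simp

theorem h_posRoot (k i d : ℕ) : ⁅h k, posRoot e i d⁆ =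
    (if k = i then posRoot e i d else 0) - (if k = i + 1 + d then posRoot e i d else 0) := by
  induction d with
  | zero => simpa [posRoot] using H.he k i
  | succ d ih =>
    rw [posRoot, leibniz_lie, ih, H.he]
    split_ifs <;> first | omega | simp
    rw [← lie_skew, neg_add_cancel]

theorem fe (i j : ℕ) (hij : i ≠ j) : ⁅f i, e j⁆ = 0 := by
  rw [← lie_skew, H.ef j i hij.symm, neg_zero]

theorem fe_self (i : ℕ) (hi : i + 1 < n) : ⁅f i, e i⁆ = h (i + 1) - h i := by
  rw [← lie_skew, H.ef_self i hi]; abel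

/-- A lowering generator can only remove the first or the last simple root of a positive root of
height at least two. Together with the raising rules this gives, via the involution, the action on
negative roots. -/
theorem f_posRoot_succ (k i d : ℕ) (hk : k + 1 < n) :
    ⁅f k, posRoot e i (d + 1)⁆ =
      (if k = i then posRoot e (i + 1) d else 0) -
        (if k = i + 1 + d then posRoot e i d else 0) := by
  induction d with
  | zero =>
    simp only [posRoot, Nat.add_zero]
    rw [leibniz_lie]
    rcases eq_or_ne k i with rfl | h1
    · rw [H.fe_self k hk, H.fe k (k + 1) (by omega), sub_lie, H.he, H.he]; simp; omega
    · rw [H.fe k i h1]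
      rcases eq_or_ne k (i + 1) with rfl | h2
      · rw [H.fe_self _ hk, lie_sub, ← lie_skew (e i), ← lie_skew (e i), H.he, H.he]; simp; omega
      · rw [H.fe k _ h2]; simp [h1, h2]
  | succ d ih =>
    rw [posRoot, leibniz_lie, ih]
    rcases eq_or_ne k i with rfl | h1
    · rw [H.fe k _ (by omega), if_pos rfl, if_pos rfl, if_neg (by omega), if_neg (by omega)]
      simp [posRoot, show k + 1 + 1 + d = k + 1 + (d + 1) by omega]
    · rcases eq_or_ne k (i + 1 + d) with h2 | h2
      · rw [H.fe k _ (by omega), if_neg h1, if_pos h2, if_neg h1, if_neg (by omega), zero_sub,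
          neg_lie, ← lie_skew, H.e_posRoot_outside _ _ _ (by omega)]
        simp
      · rw [if_neg h1, if_neg h2, if_neg h1]
        rcases eq_or_ne k (i + 1 + (d + 1)) with rfl | h3
        · rw [H.fe_self _ hk, ← lie_skew (posRoot e i (d + 1)), sub_lie _ _ (posRoot e i (d + 1)),
            H.h_posRoot, H.h_posRoot]
          rw [if_neg (by omega), if_neg (by omega), if_neg (by omega), if_pos (by omega)]
          simp
        · rw [H.fe k _ h3]; simp [h3]

end IsChevalley

/-- The matrix units of `gl_n` as root vectors built from Chevalley generators. -/
def glRoot (e f h : ℕ → L) (i j : ℕ) : L :=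
  if i < j then posRoot e i (j - i - 1) else
    if i = j then h i else -posRoot (fun k => -f k) j (i - j - 1)

theorem glRoot_of_lt (e f h : ℕ → L) (i d : ℕ) :
    glRoot e f h i (i + 1 + d) = posRoot e i d := by
  rw [glRoot, if_pos (by omega), show i + 1 + d - i - 1 = d by omega]

theorem glRoot_self (e f h : ℕ → L) (i : ℕ) : glRoot e f h i i = h i := by simp [glRoot]

theorem glRoot_of_gt (e f h : ℕ → L) (j d : ℕ) :
    glRoot e f h (j + 1 + d) j = -posRoot (fun k => -f k) j d := by
  rw [glRoot, if_neg (by omega), if_neg (by omega), show j + 1 + d - j - 1 = d by omega]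

theorem glRoot_succ (e f h : ℕ → L) (i : ℕ) : glRoot e f h i (i + 1) = e i :=
  glRoot_of_lt e f h i 0

theorem glRoot_pred (e f h : ℕ → L) (i : ℕ) : glRoot e f h (i + 1) i = f i := by
  rw [show i + 1 = i + 1 + 0 by omega, glRoot_of_gt]; simp [posRoot]

/-- The Chevalley involution is minus the transpose; the signs in `glRoot` are chosen for this. It
makes the action of f a consequence of the action of e. -/
theorem glRoot_involution (e f h : ℕ → L) (i j : ℕ) :
    glRoot (fun k => -f k) (fun k => -e k) (fun k => -h k) i j = -glRoot e f h j i := by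
  rcases lt_trichotomy i j with hij | rfl | hij
  · obtain ⟨d, rfl⟩ : ∃ d, j = i + 1 + d := ⟨j - i - 1, by omega⟩
    rw [glRoot_of_lt, glRoot_of_gt, neg_neg]
  · rw [glRoot_self, glRoot_self]
  · obtain ⟨d, rfl⟩ : ∃ d, i = j + 1 + d := ⟨i - j - 1, by omega⟩
    rw [glRoot_of_lt, glRoot_of_gt]; simp

theorem IsChevalley.e_glRoot {n : ℕ} {e f h : ℕ → L} (H : IsChevalley n e f h) (k i j : ℕ)
    (hk : k + 1 < n) : ⁅e k, glRoot e f h i j⁆ =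
      (if k + 1 = i then glRoot e f h k j else 0) -
        (if j = k then glRoot e f h i (k + 1) else 0) := by
  rcases lt_trichotomy i j with hij | rfl | hij
  · obtain ⟨d, rfl⟩ : ∃ d, j = i + 1 + d := ⟨j - i - 1, by omega⟩
    rw [glRoot_of_lt]
    by_cases h1 : k + 1 = i
    · subst h1
      rw [H.e_posRoot_pred, if_pos rfl, if_neg (by omega), sub_zero,
        show k + 1 + 1 + d = k + 1 + (d + 1) by omega, glRoot_of_lt]
    rw [if_neg h1]
    by_cases h2 : i + 1 + d = k
    · subst h2
      rw [if_pos rfl, show i + 1 + d + 1 = i + 1 + (d + 1) by omega, glRoot_of_lt, posRoot,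
        ← lie_skew, zero_sub]
    rw [if_neg h2, sub_zero]
    by_cases h3 : i ≤ k ∧ k ≤ i + d
    · exact H.e_posRoot_inside k i d h3.1 h3.2
    · exact H.e_posRoot_outside k i d (by omega)
  · rw [glRoot_self, ← lie_skew, H.he]
    by_cases h1 : i = k
    · subst h1; simp [glRoot_succ]
    · by_cases h2 : i = k + 1
      · subst h2; simp [glRoot_succ]
      · simp [h1, h2, Ne.symm h2]
  · obtain ⟨d, rfl⟩ : ∃ d, i = j + 1 + d := ⟨i - j - 1, by omega⟩
    rw [glRoot_of_gt]
    rcases d with _ | d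
    · simp only [posRoot, neg_neg, add_zero]
      rcases eq_or_ne k j with rfl | h1
      · rw [H.ef_self k hk]; simp [glRoot_self]
      · rw [H.ef k j h1]; simp [h1, Ne.symm h1]
    · have := H.involution.f_posRoot_succ k j d hk
      rw [neg_lie] at this
      rw [lie_neg, this, show j + 1 + (d + 1) = j + 1 + 1 + d by omega]
      rcases eq_or_ne k j with rfl | h1
      · rw [if_pos rfl, if_neg (by omega), if_neg (by omega), if_pos rfl, glRoot_of_gt]; simp
      · rw [if_neg h1, if_neg h1.symm]
        by_cases h2 : k = j + 1 + d
        · subst h2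
          rw [if_pos rfl, if_pos (by omega), glRoot_of_gt]; simp
        · rw [if_neg h2, if_neg (by omega)]

/-- The element `x` acts on the family `M` like the matrix unit `e_{a,b}` acts on the matrix
units. -/
def ActsAsUnit {ι : Type*} [DecidableEq ι] (x : L) (a b : ι) (M : ι → ι → L) : Prop :=
  ∀ i j, ⁅x, M i j⁆ = (if b = i then M a j else 0) - (if j = a then M i b else 0)

/-- The Jacobi identity, with e_{ab} e_{bc} - e_{bc} e_{ab} = e_{ac}. The condition a ≠ c excludes
the additional term -e_{bb}. -/
theorem ActsAsUnit.lie {ι : Type*} [DecidableEq ι] {x y : L} {a b c : ι} {M : ι → ι → L}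
    (hx : ActsAsUnit x a b M) (hy : ActsAsUnit y b c M) (hac : a ≠ c) :
    ActsAsUnit ⁅x, y⁆ a c M := by
  intro i j
  have key : ⁅⁅x, y⁆, M i j⁆ = ⁅x, ⁅y, M i j⁆⁆ - ⁅y, ⁅x, M i j⁆⁆ := lie_lie x y (M i j)
  rw [key, hy i j, hx i j]
  have hite : ∀ (z m : L) (p : Prop) [Decidable p],
      ⁅z, if p then m else 0⁆ = if p then ⁅z, m⁆ else 0 := by
    intro z m p _; split_ifs <;> simp
  simp only [lie_sub, hite, hx _ _, hy _ _, if_neg hac.symm, if_true]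
  split_ifs <;> abel

/-- Any family on which the Chevalley generators act as matrix units is acted on by all root
vectors as by matrix units. -/
theorem actsAsUnit_glRoot {n : ℕ} {e f h : ℕ → L} {M : Fin n → Fin n → L}
    (he : ∀ k (hk : k + 1 < n), ActsAsUnit (e k) ⟨k, by omega⟩ ⟨k + 1, hk⟩ M)
    (hf : ∀ k (hk : k + 1 < n), ActsAsUnit (f k) ⟨k + 1, hk⟩ ⟨k, by omega⟩ M)
    (hh : ∀ k : Fin n, ActsAsUnit (h k) k k M) (a b : Fin n) :
    ActsAsUnit (glRoot e f h a b) a b M := by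
  have hpos : ∀ d a (hd : a + 1 + d < n),
      ActsAsUnit (posRoot e a d) ⟨a, by omega⟩ ⟨a + 1 + d, hd⟩ M := by
    intro d
    induction d with
    | zero => intro a ha; exact he a ha
    | succ d ih =>
      intro a hd
      exact (ih a (by omega)).lie (he (a + 1 + d) (by omega)) (by simp; omega)
  have hneg : ∀ d a (hd : a + 1 + d < n),
      ActsAsUnit (-posRoot (fun k => -f k) a d) ⟨a + 1 + d, hd⟩ ⟨a, by omega⟩ M := by
    intro d
    induction d with
    | zero => intro a ha; simpa [posRoot] using hf a ha
    | succ d ih =>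
      intro a hd
      have := (hf (a + 1 + d) (by omega)).lie (ih a (by omega)) (by simp; omega)
      rwa [lie_neg, lie_skew, ← neg_neg ⁅_, f _⁆, ← lie_neg] at this
  rcases lt_trichotomy a.1 b.1 with hij | hij | hij
  · obtain ⟨d, hd⟩ : ∃ d, b.1 = a + 1 + d := ⟨b - a - 1, by omega⟩
    rw [hd, glRoot_of_lt]
    convert hpos d a (by omega)
  · obtain rfl : a = b := Fin.ext hij
    rw [glRoot_self]; exact hh a
  · obtain ⟨d, hd⟩ : ∃ d, a.1 = b + 1 + d := ⟨a - b - 1, by omega⟩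
    rw [hd, glRoot_of_gt]
    convert hneg d b (by omega)

namespace IsChevalley

variable {n : ℕ} {e f h : ℕ → L} (H : IsChevalley n e f h)
include H

theorem f_glRoot (k i j : ℕ) (hk : k + 1 < n) : ⁅f k, glRoot e f h i j⁆ =
      (if k = i then glRoot e f h (k + 1) j else 0) -
        (if j = k + 1 then glRoot e f h i k else 0) := by
  have := H.involution.e_glRoot k j i hk
  simp only [glRoot_involution, neg_lie, lie_neg, neg_neg] at this
  rw [this]
  simp only [eq_comm (a := k), eq_comm (a := k + 1)]
  split_ifs <;> abel

theorem h_glRoot (k i j : ℕ) : ⁅h k, glRoot e f h i j⁆ =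
      (if k = i then glRoot e f h k j else 0) -
        (if j = k then glRoot e f h i k else 0) := by
  rcases lt_trichotomy i j with hij | rfl | hij
  · obtain ⟨d, rfl⟩ : ∃ d, j = i + 1 + d := ⟨j - i - 1, by omega⟩
    rw [glRoot_of_lt, H.h_posRoot]
    rcases eq_or_ne k i with rfl | h1
    · rw [glRoot_of_lt, if_neg (show ¬k = k + 1 + d by omega),
        if_neg (show ¬k + 1 + d = k by omega)]
    · rcases eq_or_ne k (i + 1 + d) with rfl | h2
      · rw [glRoot_of_lt, if_neg h1, if_neg h1]
      · simp [h1, h2, Ne.symm h2]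
  · rw [glRoot_self, H.hh]
    rcases eq_or_ne k i with rfl | h1
    · simp
    · simp [h1, h1.symm]
  · obtain ⟨d, rfl⟩ : ∃ d, i = j + 1 + d := ⟨i - j - 1, by omega⟩
    rw [glRoot_of_gt]
    have := H.involution.h_posRoot k j d
    rw [neg_lie, ← lie_neg] at this
    rw [this]
    rcases eq_or_ne k j with rfl | h1
    · rw [glRoot_of_gt, if_neg (show ¬k = k + 1 + d by omega)]; simp; omega
    · rcases eq_or_ne k (j + 1 + d) with rfl | h2
      · rw [glRoot_of_gt, if_neg h1, if_neg h1.symm]; simp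
      · simp [h1, h2, Ne.symm h1]

/-- The relations between the matrix units of `gl_n`. -/
theorem glRoot_lie (a b : Fin n) :
    ActsAsUnit (glRoot e f h a b) a b (fun i j : Fin n => glRoot e f h i j) := by
  apply actsAsUnit_glRoot
  · intro k hk i j; simpa [Fin.ext_iff] using H.e_glRoot k i j hk
  · intro k hk i j; simpa [Fin.ext_iff] using H.f_glRoot k i j hk
  · intro k i j; simpa [Fin.ext_iff] using H.h_glRoot k i j

end IsChevalley

end Chevalley

/-! ### The adjoint family generated by one element -/

section AdjointFamily

variable {L : Type*} [LieRing L] {ι : Type*} [DecidableEq ι]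

/-- The image of the matrix units under the `gl_n`-equivariant map that sends the matrix unit at
`(o, o)` to `D`. -/
def adjFamily (g : ι → ι → L) (o : ι) (D : L) (i j : ι) : L :=
  if i = o then (if j = o then D else ⁅D, g o j⁆)
  else if j = o then ⁅g i o, D⁆ else ⁅g i o, ⁅D, g o j⁆⁆ + if i = j then D else 0

variable {g : ι → ι → L} (hg : ∀ a b, ActsAsUnit (g a b) a b g) {o : ι} {D : L}
  (hD : ∀ a b, a ≠ o → b ≠ o → ⁅g a b, D⁆ = 0) (hD0 : ⁅g o o, D⁆ = 0)

section
variable (g o D)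
theorem adjFamily_oo : adjFamily g o D o o = D := by simp [adjFamily]
theorem adjFamily_o {j : ι} (hj : j ≠ o) : adjFamily g o D o j = ⁅D, g o j⁆ := by
  simp [adjFamily, hj]
theorem adjFamily_to {i : ι} (hi : i ≠ o) : adjFamily g o D i o = ⁅g i o, D⁆ := by
  simp [adjFamily, hi]
-- The correction by D is forced by ⁅e_{io}, e_{oj}⁆ = e_{ij} - δ_{ij} e_{oo}.
theorem adjFamily_of_ne {i j : ι} (hi : i ≠ o) (hj : j ≠ o) :
    adjFamily g o D i j = ⁅g i o, ⁅D, g o j⁆⁆ + if i = j then D else 0 := by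
  simp [adjFamily, hi, hj]
end

include hg hD in
-- The elements ⁅g o b, ⁅D, g o c⁆⁆ are symmetric in b and c and transform as a symmetric square
-- under the matrix units with indices other than o. Hence the vanishing of the (p, p) component
-- spreads to all of them, once division by 2 is possible.
theorem row_vanish (two : ∀ x : L, x + x = 0 → x = 0) {p : ι} (hp : p ≠ o)
    (h : ⁅g o p, ⁅D, g o p⁆⁆ = 0) {b c : ι} (hb : b ≠ o) (hc : c ≠ o) :
    ⁅g o b, ⁅D, g o c⁆⁆ = 0 := by
  have act : ∀ a b c d, a ≠ o → b ≠ o → c ≠ o → d ≠ o →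
      ⁅g a b, ⁅g o c, ⁅D, g o d⁆⁆⁆ = -(if c = a then ⁅g o b, ⁅D, g o d⁆⁆ else 0)
        - (if d = a then ⁅g o c, ⁅D, g o b⁆⁆ else 0) := by
    intro a b c d ha hb hc hd
    rw [leibniz_lie, leibniz_lie (g a b) D, hD a b ha hb, hg a b, hg a b, if_neg hb, zero_lie]
    split_ifs <;>
      simp only [zero_add, neg_lie, lie_neg, zero_lie, lie_zero, neg_zero, add_zero, sub_eq_add_neg]
  have sym : ∀ b c, b ≠ o → c ≠ o → ⁅g o b, ⁅D, g o c⁆⁆ = ⁅g o c, ⁅D, g o b⁆⁆ := by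
    intro b c hb hc
    have h1 : ⁅g o c, g o b⁆ = 0 := by rw [hg o c]; simp [hb, hc]
    rw [← lie_skew D (g o c), lie_neg, leibniz_lie, ← lie_skew (g o b) (g o c), h1, neg_zero,
      zero_lie, zero_add, ← lie_neg, lie_skew]
  have h1 : ∀ b, b ≠ o → ⁅g o p, ⁅D, g o b⁆⁆ = 0 := by
    intro b hb
    by_cases hbp : b = p
    · subst hbp; exact h
    -- Moving one of the two indices p to b produces the sum of the (b, p) and (p, b) components,
    -- which is twice one of them.
    have := act p b p p hp hb hp hp
    rw [h, lie_zero, if_pos rfl, if_pos rfl, sym b p hb hp] at this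
    apply two
    rw [← neg_eq_zero, neg_add, ← sub_eq_add_neg, ← this]
  by_cases hcp : c = p
  · subst hcp; rw [sym b c hb hc, h1 b hb]
  have := act p b p c hp hb hp hc
  rw [h1 c hc, lie_zero, if_pos rfl, if_neg hcp, sub_zero] at this
  exact neg_eq_zero.mp this.symm

include hg hD in
-- The row statement for the matrix units -g j i, the image of g under minus transposition.
theorem column_vanish (two : ∀ x : L, x + x = 0 → x = 0) {p : ι} (hp : p ≠ o)
    (h : ⁅g p o, ⁅g p o, D⁆⁆ = 0) {b c : ι} (hb : b ≠ o) (hc : c ≠ o) :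
    ⁅g b o, ⁅g c o, D⁆⁆ = 0 := by
  have hg' : ∀ a b, ActsAsUnit (-g b a) a b (fun i j => -g j i) := by
    intro a b i j
    simp only [neg_lie, lie_neg, neg_neg]
    rw [hg b a j i]
    simp only [eq_comm (a := a), eq_comm (a := i)]
    split_ifs <;> abel
  have := row_vanish (g := fun i j => -g j i) hg' (o := o) (D := D)
    (fun a b ha hb => by rw [neg_lie, hD b a hb ha, neg_zero]) two hp
    (by simp only [neg_lie, lie_neg, neg_neg]; rw [← lie_skew D, lie_neg, h, neg_zero]) hb hc
  simp only [neg_lie, lie_neg, neg_neg] at this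
  rwa [← lie_skew D, lie_neg, neg_eq_zero] at this

include hg hD hD0 in
-- As a vector of the gl_n-module of matrices, e_{oo} is characterized by being killed by the
-- centralizer subalgebra gl_1 × gl_{n-1} and by the products of two row operators or two column
-- operators in `hrow` and `hcol`. If D has these properties, then e_{oo} ↦ D extends equivariantly;
-- verification is by the position of a and b relative to o.
theorem actsAsUnit_adjFamily
    (hrow : ∀ b c, b ≠ o → c ≠ o → ⁅g o b, ⁅D, g o c⁆⁆ = 0)
    (hcol : ∀ b c, b ≠ o → c ≠ o → ⁅g b o, ⁅g c o, D⁆⁆ = 0) (a b : ι) :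
    ActsAsUnit (g a b) a b (adjFamily g o D) := by
  have hDl : ∀ a b, a ≠ o → b ≠ o → ⁅D, g a b⁆ = 0 := fun a b ha hb => by
    rw [← lie_skew, hD a b ha hb, neg_zero]
  have hD0l : ⁅D, g o o⁆ = 0 := by rw [← lie_skew, hD0, neg_zero]
  have hgg := fun a b i j => hg a b i j
  by_cases ha : a = o <;> by_cases hb : b = o
  · subst ha; obtain rfl := hb.symm
    intro i j
    by_cases hi : i = a <;> by_cases hj : j = a
    · subst hi hj; simp [adjFamily_oo, hD0]
    · subst hi
      rw [adjFamily_o _ _ _ hj, leibniz_lie, hD0, hgg]; simp [hj]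
    · subst hj
      rw [adjFamily_to _ _ _ hi, leibniz_lie, hD0, hgg]
      simp [Ne.symm hi]
    · rw [adjFamily_of_ne _ _ _ hi hj, lie_add, leibniz_lie, leibniz_lie (g a a) D, hD0, hgg, hgg]
      have : ⁅g a a, if i = j then D else 0⁆ = 0 := by split_ifs <;> simp [hD0]
      rw [this]
      simp only [if_true, if_neg hj, if_neg (Ne.symm hi), zero_sub, sub_zero, neg_lie, zero_lie,
        zero_add, add_zero, neg_add_cancel]
  · subst ha
    have hab : ∀ i, i ≠ a → ⁅g i a, ⁅D, g a b⁆⁆ = adjFamily g a D i b - if i = b then D else 0 := by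
      intro i hi; rw [adjFamily_of_ne _ _ _ hi hb]; simp
    have hrowact : ∀ i j, i ≠ a → j ≠ a → ⁅g i b, ⁅D, g a j⁆⁆ = - if j = i then ⁅D, g a b⁆ else 0 := by
      intro i j hi hj
      rw [leibniz_lie, hD i b hi hb, hgg]
      simp only [if_neg hb]
      split_ifs <;> simp
    have hz : ∀ j, j ≠ a → ⁅g a a, ⁅D, g a j⁆⁆ = ⁅D, g a j⁆ := by
      intro j hj; rw [leibniz_lie, hD0, hgg]; simp [hj]
    intro i j
    by_cases hi : i = a <;> by_cases hj : j = a
    · subst hi hj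
      rw [adjFamily_oo, adjFamily_o _ _ _ hb, ← lie_skew]; simp [hb]
    · subst hi
      rw [adjFamily_o _ _ _ hj, hrow b j hb hj]; simp [hj, hb]
    · subst hj
      rw [adjFamily_to _ _ _ hi, leibniz_lie, hgg, ← lie_skew (g j b) D, lie_neg, hab i hi, if_pos rfl,
        if_pos rfl, sub_lie, hD i b hi hb, adjFamily_oo]
      by_cases hbi : b = i
      · subst hbi; simp [hD0]
      · simp [hbi, Ne.symm hbi]
    · rw [adjFamily_of_ne _ _ _ hi hj, lie_add, leibniz_lie, hrow b j hb hj, lie_zero, add_zero, hgg,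
        if_pos rfl, sub_lie, hrowact i j hi hj, adjFamily_o _ _ _ hj, if_neg hj]
      by_cases hij : i = j
      · subst hij
        rw [if_pos rfl, if_pos rfl, ← lie_skew (g a b) D]
        split_ifs
        · rw [hz i hi]; simp
        · rw [zero_lie]; abel
      · rw [if_neg hij, if_neg (Ne.symm hij)]
        split_ifs
        · rw [hz j hj]; simp
        · simp
  · subst hb
    have hbrac : ∀ i j, i ≠ b → j ≠ b → ⁅g i b, ⁅D, g b j⁆⁆ = ⁅⁅g i b, D⁆, g b j⁆ := by
      intro i j hi hj
      rw [leibniz_lie, hgg, if_pos rfl, lie_sub, hDl i j hi hj]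
      split_ifs <;> simp [hD0l]
    intro i j
    by_cases hi : i = b <;> by_cases hj : j = b
    · subst hi hj
      rw [adjFamily_oo, adjFamily_to _ _ _ ha]; simp [Ne.symm ha]
    · subst hi
      rw [adjFamily_o _ _ _ hj, if_pos rfl, adjFamily_of_ne _ _ _ ha hj, adjFamily_oo]
      simp [eq_comm]
    · subst hj
      rw [adjFamily_to _ _ _ hi, hcol a i ha hi]; simp [Ne.symm hi, Ne.symm ha]
    · rw [adjFamily_of_ne _ _ _ hi hj, hbrac i j hi hj, lie_add, leibniz_lie, hcol a i ha hi, zero_lie,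
        zero_add, hgg a b b j, if_pos rfl, lie_sub, if_neg (Ne.symm hi), adjFamily_to _ _ _ hi]
      have h1 : ⁅⁅g i b, D⁆, g a j⁆ = - if i = j then ⁅g a b, D⁆ else 0 := by
        rw [← lie_skew, leibniz_lie, hD a j ha hj, hgg, if_neg (Ne.symm ha)]
        simp only [eq_comm (a := j)]
        split_ifs <;> simp
      have h2 : ⁅⁅g i b, D⁆, g b b⁆ = ⁅g i b, D⁆ := by
        rw [← lie_skew, leibniz_lie, hD0, hgg, if_neg (Ne.symm hi)]; simp
      have h3 : ⁅g a b, if i = j then D else 0⁆ = if i = j then ⁅g a b, D⁆ else 0 := by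
        split_ifs <;> simp
      rw [h1, h3]
      by_cases hja : j = a
      · rw [if_pos hja, if_pos hja, h2]; abel
      · rw [if_neg hja, if_neg hja, lie_zero]; abel
  · intro i j
    have hab := hD a b ha hb
    by_cases hi : i = o <;> by_cases hj : j = o
    · subst hi hj; simp [adjFamily_oo, hab, hb, Ne.symm ha]
    · subst hi
      rw [adjFamily_o _ _ _ hj, leibniz_lie, hab, hgg, adjFamily_o _ _ _ hb, if_neg hb]
      split_ifs <;> simp
    · subst hj
      rw [adjFamily_to _ _ _ hi, leibniz_lie, hab, hgg, adjFamily_to _ _ _ ha, if_neg (Ne.symm ha),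
        if_neg (Ne.symm ha)]
      split_ifs <;> simp
    · rw [adjFamily_of_ne _ _ _ hi hj, lie_add, leibniz_lie, leibniz_lie (g a b) D, hab, hgg, hgg,
        if_neg hb, if_neg (Ne.symm ha), adjFamily_of_ne _ _ _ ha hj, adjFamily_of_ne _ _ _ hi hb]
      have : ⁅g a b, if i = j then D else 0⁆ = 0 := by split_ifs <;> simp [hab]
      rw [this]
      by_cases hbi : b = i <;> by_cases hja : j = a
      · subst hbi hja
        simp only [if_true, sub_zero, zero_sub, zero_lie, zero_add, lie_neg, add_zero]
        abel
      · subst hbi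
        simp [hja, Ne.symm hja]
      · subst hja
        simp only [if_true, if_neg hbi, if_neg (Ne.symm hbi), sub_zero, zero_sub, zero_lie, zero_add,
          lie_neg, add_zero]
      · simp [hbi, hja]

end AdjointFamily

/-! ### The RTT relations in components, and their covariance -/

section Components

attribute [local instance] LieRing.ofAssociativeRing

variable {A : Type*} [Ring A] {ι : Type*} [DecidableEq ι]

/-- The defining relations of the Yangian, for coefficients `T i j r` of `u⁻ʳ`. -/
structure IsRTT (T : ι → ι → ℕ → A) : Prop where
  zero : ∀ i j, T i j 0 = if i = j then 1 else 0
  rel : ∀ i j k l r s, ⁅T i j (r + 1), T k l s⁆ - ⁅T i j r, T k l (s + 1)⁆ =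
    T k j r * T i l s - T k j s * T i l r

/-- The difference of the two sides of an RTT relation. -/
def rttDefect (T : ι → ι → ℕ → A) (r s : ℕ) (i j k l : ι) : A :=
  ⁅T i j (r + 1), T k l s⁆ - ⁅T i j r, T k l (s + 1)⁆ - (T k j r * T i l s - T k j s * T i l r)

/-- The RTT relations permute tensor slots without changing the index types, and ad x is a
derivation, so the defect transforms as a four-index tensor with i, k as row indices and j, l as
column indices. -/
theorem lie_rttDefect {T : ι → ι → ℕ → A} {x : A} {a b : ι}
    (hx : ∀ r, ActsAsUnit x a b (fun i j => T i j r)) (r s : ℕ) (i j k l : ι) :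
    ⁅x, rttDefect T r s i j k l⁆ =
      (if b = i then rttDefect T r s a j k l else 0) - (if j = a then rttDefect T r s i b k l else 0)
      + (if b = k then rttDefect T r s i j a l else 0)
      - (if l = a then rttDefect T r s i j k b else 0) := by
  have hx' : ∀ r i j, ⁅x, T i j r⁆ = (if b = i then T a j r else 0) - (if j = a then T i b r else 0) :=
    fun r i j => hx r i j
  have hmul : ∀ y z : A, ⁅x, y * z⁆ = ⁅x, y⁆ * z + y * ⁅x, z⁆ := by
    intro y z; simp only [Ring.lie_def]; noncomm_ring
  simp only [rttDefect, Ring.lie_def (T _ _ _) (T _ _ _), lie_sub, hmul, hx']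
  split_ifs <;> noncomm_ring

/-- By covariance under `gl_n`, all RTT relations follow from those between `T_{o,o}(u)` and the
entries at the indices `o` and `p`. -/
theorem rttDefect_eq_zero {T : ι → ι → ℕ → A} {g : ι → ι → A}
    (hg : ∀ a b r, ActsAsUnit (g a b) a b (fun i j => T i j r)) {o p : ι} (hp : p ≠ o) (r s : ℕ)
    (h1 : rttDefect T r s o o o o = 0) (h2 : rttDefect T r s o o o p = 0)
    (h3 : rttDefect T r s o o p o = 0) (h4 : rttDefect T r s o o p p = 0) (i j k l : ι) :
    rttDefect T r s i j k l = 0 := by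
  set X := rttDefect T r s with hX
  -- Every vanishing component gives, by acting with a matrix unit, a linear relation between
  -- components. Below, a and b are always chosen so that only one unknown component remains.
  have act : ∀ a b i j k l, X i j k l = 0 →
      (if b = i then X a j k l else 0) - (if j = a then X i b k l else 0)
      + (if b = k then X i j a l else 0) - (if l = a then X i j k b else 0) = 0 := by
    intro a b i j k l h
    rw [hX, ← lie_rttDefect (hg a b) r s i j k l, ← hX, h, lie_zero]
  have hp' := Ne.symm hp
  have a1 : ∀ c, X o o o c = 0 := by
    intro c
    by_cases hc : c = p
    · rw [hc, h2]
    by_cases hco : c = o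
    · rw [hco, h1]
    simpa [hp, hp', hco, Ne.symm hco] using act p c o o o p h2
  have a2 : ∀ b, b ≠ o → X o b o o = 0 := by
    intro b hb
    simpa [hb, a1] using act o b o o o o h1
  have a3 : ∀ b c, X o b o c = 0 := by
    intro b c
    by_cases hb : b = o
    · rw [hb, a1]
    by_cases hc : c = o
    · rw [hc, a2 b hb]
    simpa [hb, hc] using act o b o o o c (a1 c)
  have a4 : ∀ b, X o o p b = 0 := by
    intro b
    by_cases hb : b = p
    · rw [hb, h4]
    by_cases hbo : b = o
    · rw [hbo, h3]
    simpa [hp, hp', hb, hbo] using act p b o o p p h4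
  have a5 : ∀ b, X o b p o = 0 := by
    intro b
    by_cases hb : b = o
    · rw [hb, a4]
    have := act o b o o p o h3
    simpa [hb, a4, a1] using this
  have a6 : ∀ b c, X o b p c = 0 := by
    intro b c
    by_cases hb : b = o
    · rw [hb, a4]
    by_cases hc : c = o
    · rw [hc, a5 b]
    simpa [hb, hc, a1] using act o b o o p c (a4 c)
  have a7 : ∀ a j l, X o j a l = 0 := by
    intro a j l
    by_cases ha : a = p
    · rw [ha, a6]
    by_cases hao : a = o
    · rw [hao, a3]
    simpa [hp, a6] using act a p o j p l (a6 j l)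
  by_cases hi : i = o
  · rw [hi, a7]
  by_cases hk : k = o
  · subst hk
    simpa [a7] using act i k k j k l (a7 k j l)
  · have := act i o o j k l (a7 k j l)
    simpa [a7, Ne.symm hk] using this

end Components

/-! ### Series in two variables -/

section TwoVariables

variable {A : Type*} [Ring A]

/-- A series in `u⁻¹`, viewed in two variables. -/
def inU : PowerSeries A →+* PowerSeries (PowerSeries A) := PowerSeries.map PowerSeries.C

/-- A series in `v⁻¹`, viewed in two variables. -/
def inV : PowerSeries A →+* PowerSeries (PowerSeries A) := PowerSeries.C

/-- The coefficient of `u⁻ʳ v⁻ˢ`. -/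
def coeff₂ (r s : ℕ) (f : PowerSeries (PowerSeries A)) : A :=
  PowerSeries.coeff s (PowerSeries.coeff r f)

theorem ext₂ {f g : PowerSeries (PowerSeries A)} (h : ∀ r s, coeff₂ r s f = coeff₂ r s g) :
    f = g := by
  ext r s; exact h r s

@[simp] theorem coeff₂_sub (r s : ℕ) (f g : PowerSeries (PowerSeries A)) :
    coeff₂ r s (f - g) = coeff₂ r s f - coeff₂ r s g := by simp [coeff₂]

@[simp] theorem coeff₂_add (r s : ℕ) (f g : PowerSeries (PowerSeries A)) :
    coeff₂ r s (f + g) = coeff₂ r s f + coeff₂ r s g := by simp [coeff₂]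

@[simp] theorem coeff₂_zero (r s : ℕ) : coeff₂ r s (0 : PowerSeries (PowerSeries A)) = 0 := by
  simp [coeff₂]

@[simp] theorem coeff₂_inU_mul_inV (r s : ℕ) (f g : PowerSeries A) :
    coeff₂ r s (inU f * inV g) = PowerSeries.coeff r f * PowerSeries.coeff s g := by
  simp [coeff₂, inU, inV]

@[simp] theorem coeff₂_inV_mul_inU (r s : ℕ) (f g : PowerSeries A) :
    coeff₂ r s (inV g * inU f) = PowerSeries.coeff s g * PowerSeries.coeff r f := by
  simp [coeff₂, inU, inV]

theorem coeff₂_inU (r s : ℕ) (f : PowerSeries A) :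
    coeff₂ r s (inU f) = if s = 0 then PowerSeries.coeff r f else 0 := by
  simp [coeff₂, inU, PowerSeries.coeff_C]

theorem uInv_comm (f : PowerSeries (PowerSeries A)) : uInv A * f = f * uInv A :=
  PowerSeries.X_mul

theorem vInv_comm (f : PowerSeries (PowerSeries A)) : vInv A * f = f * vInv A := by
  ext r : 1; simp [vInv, PowerSeries.X_mul]

@[simp] theorem coeff₂_uInv_mul_zero (s : ℕ) (f : PowerSeries (PowerSeries A)) :
    coeff₂ 0 s (uInv A * f) = 0 := by simp [coeff₂, uInv]

@[simp] theorem coeff₂_uInv_mul_succ (r s : ℕ) (f : PowerSeries (PowerSeries A)) :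
    coeff₂ (r + 1) s (uInv A * f) = coeff₂ r s f := by
  simp [coeff₂, uInv, PowerSeries.coeff_succ_X_mul]

@[simp] theorem coeff₂_vInv_mul_zero (r : ℕ) (f : PowerSeries (PowerSeries A)) :
    coeff₂ r 0 (vInv A * f) = 0 := by simp [coeff₂, vInv]

@[simp] theorem coeff₂_vInv_mul_succ (r s : ℕ) (f : PowerSeries (PowerSeries A)) :
    coeff₂ r (s + 1) (vInv A * f) = coeff₂ r s f := by
  simp [coeff₂, vInv, PowerSeries.coeff_succ_X_mul]

/-- The identity `(u - v) P = Q`, multiplied by `u⁻¹ v⁻¹`, in terms of coefficients. -/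
theorem sub_mul_eq_iff (P Q : PowerSeries (PowerSeries A)) :
    (vInv A - uInv A) * P = uInv A * vInv A * Q ↔
      (∀ s, coeff₂ 0 s P = 0) ∧ (∀ r, coeff₂ r 0 P = 0) ∧
        ∀ r s, coeff₂ (r + 1) s P - coeff₂ r (s + 1) P = coeff₂ r s Q := by
  constructor
  · intro h
    have key : ∀ r s, coeff₂ r s ((vInv A - uInv A) * P) = coeff₂ r s (uInv A * vInv A * Q) := by
      intro r s; rw [h]
    simp only [sub_mul, mul_assoc, coeff₂_sub] at key
    refine ⟨fun s => ?_, fun r => ?_, fun r s => ?_⟩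
    · simpa using key 0 (s + 1)
    · simpa using key (r + 1) 0
    · simpa using key (r + 1) (s + 1)
  · rintro ⟨h1, h2, h3⟩
    refine ext₂ fun r s => ?_
    simp only [sub_mul, mul_assoc, coeff₂_sub]
    rcases r with _ | r <;> rcases s with _ | s <;> simp [h1, h2, h3]

/-- The equation gives P_{r+1,s} = P_{r,s+1} and P_{0,s} = 0, so induction on r removes every
coefficient: u - v may be cancelled. -/
theorem sub_mul_eq_zero {P : PowerSeries (PowerSeries A)} (h : (vInv A - uInv A) * P = 0) :
    P = 0 := by
  obtain ⟨h1, -, h3⟩ := (sub_mul_eq_iff P 0).1 (by rw [h, mul_zero])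
  refine ext₂ fun r => ?_
  induction r with
  | zero => simpa using h1
  | succ r ih =>
    intro s
    have := h3 r s
    rw [ih (s + 1)] at this
    simpa using this

theorem inU_inV_commute {f g : PowerSeries A}
    (h : ∀ r s, PowerSeries.coeff r f * PowerSeries.coeff s g =
      PowerSeries.coeff s g * PowerSeries.coeff r f) : inU f * inV g = inV g * inU f := by
  refine ext₂ fun r s => ?_
  simp [h]

end TwoVariables

/-! ### The RTT equation in components -/

section Entries

variable {A : Type*} [Ring A] {n : ℕ}

theorem flip_apply (i k j l : Fin n) :
    flip A n (i, k) (j, l) = if i = l ∧ k = j then 1 else 0 := by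
  simp only [flip, Matrix.sum_apply, Matrix.kroneckerMap_apply, Matrix.single_apply]
  rw [Finset.sum_eq_single i, Finset.sum_eq_single k]
  · by_cases h1 : i = l <;> by_cases h2 : k = j <;> simp [h1, h2]
  · intro b _ hb; simp [hb]
  · simp
  · intro b _ hb; simp [hb]
  · simp

theorem flip_mul_apply (M : Matrix (Fin n × Fin n) (Fin n × Fin n) (PowerSeries (PowerSeries A)))
    (i k : Fin n) (q : Fin n × Fin n) : (flip A n * M) (i, k) q = M (k, i) q := by
  rw [Matrix.mul_apply, Finset.sum_eq_single (k, i)]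
  · simp [flip_apply]
  · rintro ⟨a, b⟩ - hb
    rw [flip_apply, if_neg, zero_mul]
    rintro ⟨rfl, rfl⟩; exact hb rfl
  · simp

theorem mul_flip_apply (M : Matrix (Fin n × Fin n) (Fin n × Fin n) (PowerSeries (PowerSeries A)))
    (p : Fin n × Fin n) (j l : Fin n) : (M * flip A n) p (j, l) = M p (l, j) := by
  rw [Matrix.mul_apply, Finset.sum_eq_single (l, j)]
  · simp [flip_apply]
  · rintro ⟨a, b⟩ - hb
    rw [flip_apply, if_neg, mul_zero]
    rintro ⟨rfl, rfl⟩; exact hb rfl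
  · simp

theorem tensorU_mul_tensorV_apply (T : Matrix (Fin n) (Fin n) (PowerSeries A)) (i k j l : Fin n) :
    (tensorU T * tensorV T) (i, k) (j, l) = inU (T i j) * inV (T k l) := by
  rw [Matrix.mul_apply, Finset.sum_eq_single (j, k)]
  · simp [tensorU, tensorV, inU, inV]
  · rintro ⟨a, b⟩ - hb
    simp only [tensorU, tensorV, Matrix.kroneckerMap_apply, Matrix.one_apply]
    by_cases h1 : k = b
    · have h2 : a ≠ j := by rintro rfl; exact hb (by rw [h1])
      simp [h2]
    · simp [h1]
  · simp

theorem tensorV_mul_tensorU_apply (T : Matrix (Fin n) (Fin n) (PowerSeries A)) (i k j l : Fin n) :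
    (tensorV T * tensorU T) (i, k) (j, l) = inV (T k l) * inU (T i j) := by
  rw [Matrix.mul_apply, Finset.sum_eq_single (i, l)]
  · simp [tensorU, tensorV, inU, inV]
  · rintro ⟨a, b⟩ - hb
    simp only [tensorU, tensorV, Matrix.kroneckerMap_apply, Matrix.one_apply]
    by_cases h1 : b = l
    · have h2 : i ≠ a := by rintro rfl; exact hb (by rw [h1])
      simp [h2]
    · simp [h1]
  · simp

theorem rttLeft_apply (T : Matrix (Fin n) (Fin n) (PowerSeries A)) (i k j l : Fin n) :
    rttLeft T (i, k) (j, l) = (vInv A - uInv A) * (inU (T i j) * inV (T k l)) -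
      uInv A * vInv A * (inU (T k j) * inV (T i l)) := by
  rw [rttLeft, mul_assoc, rMatrix, sub_mul, Matrix.smul_mul, Matrix.smul_mul, one_mul,
    Matrix.sub_apply, Matrix.smul_apply, Matrix.smul_apply, flip_mul_apply,
    tensorU_mul_tensorV_apply, tensorU_mul_tensorV_apply, smul_eq_mul, smul_eq_mul]

theorem rttRight_apply (T : Matrix (Fin n) (Fin n) (PowerSeries A)) (i k j l : Fin n) :
    rttRight T (i, k) (j, l) = (vInv A - uInv A) * (inV (T k l) * inU (T i j)) -
      uInv A * vInv A * (inV (T k j) * inU (T i l)) := by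
  have h1 : ∀ (c : PowerSeries (PowerSeries A)) (hc : ∀ f, c * f = f * c)
      (M N : Matrix (Fin n × Fin n) (Fin n × Fin n) (PowerSeries (PowerSeries A))),
      M * (c • N) = c • (M * N) := by
    intro c hc M N
    refine Matrix.ext fun p q => ?_
    simp only [Matrix.mul_apply, Matrix.smul_apply, smul_eq_mul, Finset.mul_sum]
    refine Finset.sum_congr rfl fun x _ => ?_
    rw [← mul_assoc, ← hc, mul_assoc]
  rw [rttRight, rMatrix, mul_sub, h1, h1, mul_one,
    Matrix.sub_apply, Matrix.smul_apply, Matrix.smul_apply, mul_flip_apply,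
    tensorV_mul_tensorU_apply, tensorV_mul_tensorU_apply, smul_eq_mul, smul_eq_mul]
  · intro f; rw [mul_assoc, vInv_comm, ← mul_assoc, uInv_comm, mul_assoc, uInv_comm]
  · intro f; rw [sub_mul, mul_sub, uInv_comm, vInv_comm]

/-- The series with coefficients `T i j r`. -/
def seriesMatrix {ι : Type*} (T : ι → ι → ℕ → A) : Matrix ι ι (PowerSeries A) :=
  Matrix.of fun i j => PowerSeries.mk (T i j)

@[simp] theorem coeff_seriesMatrix {ι : Type*} (T : ι → ι → ℕ → A) (i j : ι) (r : ℕ) :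
    PowerSeries.coeff r (seriesMatrix T i j) = T i j r := by simp [seriesMatrix]

/-- The boundary coefficients, with r = 0 or s = 0, carry no condition because the degree-zero
coefficients are the scalars 0 and 1. -/
theorem isRTT_iff_series {ι : Type*} [DecidableEq ι] (T : ι → ι → ℕ → A)
    (h0 : ∀ i j, T i j 0 = if i = j then 1 else 0) :
    IsRTT T ↔ ∀ i j k l, (vInv A - uInv A) *
      (inU (seriesMatrix T i j) * inV (seriesMatrix T k l) -
        inV (seriesMatrix T k l) * inU (seriesMatrix T i j)) =
      uInv A * vInv A * (inU (seriesMatrix T k j) * inV (seriesMatrix T i l) -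
        inV (seriesMatrix T k j) * inU (seriesMatrix T i l)) := by
  simp only [sub_mul_eq_iff]
  constructor
  · intro h i j k l
    refine ⟨fun s => ?_, fun r => ?_, fun r s => ?_⟩
    · rw [coeff₂_sub, coeff₂_inU_mul_inV, coeff₂_inV_mul_inU]
      simp only [coeff_seriesMatrix, h0]; split_ifs <;> simp
    · rw [coeff₂_sub, coeff₂_inU_mul_inV, coeff₂_inV_mul_inU]
      simp only [coeff_seriesMatrix, h0]; split_ifs <;> simp
    · have := h.rel i j k l r s
      simpa [Ring.lie_def] using this
  · intro h
    refine ⟨h0, fun i j k l r s => ?_⟩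
    have := (h i j k l).2.2 r s
    simpa [Ring.lie_def] using this

theorem rttLeft_eq_rttRight_iff (T : Fin n → Fin n → ℕ → A)
    (h0 : ∀ i j, T i j 0 = if i = j then 1 else 0) :
    (∀ p q, rttLeft (seriesMatrix T) p q = rttRight (seriesMatrix T) p q) ↔ IsRTT T := by
  rw [isRTT_iff_series T h0]
  simp only [Prod.forall, rttLeft_apply, rttRight_apply, mul_sub]
  constructor
  · intro h i j k l
    have := h i k j l
    rw [sub_eq_iff_eq_add] at this
    rw [this]; abel
  · intro h i k j l
    have := h i j k l
    rw [sub_eq_iff_eq_add] at this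
    rw [this]; abel

theorem coeff₂_map {A' : Type*} [Ring A'] (f : A →+* A') (r s : ℕ)
    (x : PowerSeries (PowerSeries A)) :
    coeff₂ r s (PowerSeries.map (PowerSeries.map f) x) = f (coeff₂ r s x) := by simp [coeff₂]

theorem map_inU {A' : Type*} [Ring A'] (f : A →+* A') (x : PowerSeries A) :
    PowerSeries.map (PowerSeries.map f) (inU x) = inU (PowerSeries.map f x) := by
  ext r : 1; simp [inU]

theorem map_inV {A' : Type*} [Ring A'] (f : A →+* A') (x : PowerSeries A) :
    PowerSeries.map (PowerSeries.map f) (inV x) = inV (PowerSeries.map f x) := by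
  simp [inV]

theorem map_uInv {A' : Type*} [Ring A'] (f : A →+* A') :
    PowerSeries.map (PowerSeries.map f) (uInv A) = uInv A' := by simp [uInv]

theorem map_vInv {A' : Type*} [Ring A'] (f : A →+* A') :
    PowerSeries.map (PowerSeries.map f) (vInv A) = vInv A' := by simp [vInv]

theorem map_rttLeft {A' : Type*} [Ring A'] (f : A →+* A')
    (T : Matrix (Fin n) (Fin n) (PowerSeries A)) (p q : Fin n × Fin n) :
    PowerSeries.map (PowerSeries.map f) (rttLeft T p q) =
      rttLeft (T.map (PowerSeries.map f)) p q := by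
  obtain ⟨i, k⟩ := p
  obtain ⟨j, l⟩ := q
  simp only [rttLeft_apply, map_sub, map_mul, map_inU, map_inV, map_uInv, map_vInv,
    Matrix.map_apply]

theorem map_rttRight {A' : Type*} [Ring A'] (f : A →+* A')
    (T : Matrix (Fin n) (Fin n) (PowerSeries A)) (p q : Fin n × Fin n) :
    PowerSeries.map (PowerSeries.map f) (rttRight T p q) =
      rttRight (T.map (PowerSeries.map f)) p q := by
  obtain ⟨i, k⟩ := p
  obtain ⟨j, l⟩ := q
  simp only [rttRight_apply, map_sub, map_mul, map_inU, map_inV, map_uInv, map_vInv,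
    Matrix.map_apply]

/-- The generators of the Yangian satisfy the RTT relations. -/
theorem isRTT_genT (n : ℕ) : IsRTT (fun i j r => (genT i j r : Yangian n)) := by
  have h0 : ∀ i j, (genT i j 0 : Yangian n) = if i = j then 1 else 0 := by
    intro i j; simp only [genT, freeT]; split_ifs <;> simp
  rw [← rttLeft_eq_rttRight_iff _ h0]
  set f : FreeT n →+* Yangian n := (RingQuot.mkAlgHom ℂ (RTTRel n)).toRingHom with hf
  have hT : seriesMatrix (fun i j r => (genT i j r : Yangian n)) =
      (freeTMatrix n).map (PowerSeries.map f) := by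
    ext i j r
    rw [coeff_seriesMatrix, Matrix.map_apply, PowerSeries.coeff_map, freeTMatrix, Matrix.of_apply,
      PowerSeries.coeff_mk]
    rfl
  intro p q
  rw [hT, ← map_rttLeft, ← map_rttRight]
  refine ext₂ fun r s => ?_
  rw [coeff₂_map, coeff₂_map]
  exact RingQuot.mkAlgHom_rel ℂ (RTTRel.rtt p q r s)

/-- The universal property of the Yangian. -/
theorem exists_yangian_lift {A : Type*} [Ring A] [Algebra ℂ A] {n : ℕ} {T : Fin n → Fin n → ℕ → A}
    (hT : IsRTT T) : ∃ f : Yangian n →ₐ[ℂ] A, ∀ i j r, f (genT i j r) = T i j r := by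
  set F : FreeT n →ₐ[ℂ] A := FreeAlgebra.lift ℂ (fun x => T x.1 x.2.1 (x.2.2 + 1)) with hF
  have hFT : ∀ i j r, F (freeT i j r) = T i j r := by
    intro i j r
    rcases r with _ | r
    · rw [hT.zero, freeT]; split_ifs <;> simp
    · simp [hF, freeT]
  have hmat : (freeTMatrix n).map (PowerSeries.map F.toRingHom) = seriesMatrix T := by
    ext i j r
    simp [seriesMatrix, freeTMatrix, hFT]
  refine ⟨RingQuot.liftAlgHom ℂ ⟨F, ?_⟩, fun i j r => ?_⟩
  · rintro _ _ ⟨p, q, r, s⟩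
    have h1 := coeff₂_map F.toRingHom r s (rttLeft (freeTMatrix n) p q)
    have h2 := coeff₂_map F.toRingHom r s (rttRight (freeTMatrix n) p q)
    rw [map_rttLeft, hmat, (rttLeft_eq_rttRight_iff T hT.zero).2 hT] at h1
    rw [map_rttRight, hmat] at h2
    exact h1.symm.trans h2
  · rw [genT, RingQuot.liftAlgHom_mkAlgHom_apply, hFT]

end Entries

/-! ### Unitriangular matrices and Gauss factorizations -/

section Triangular

variable {n : ℕ} {B : Type*} [Ring B]

/-- Lower triangular matrices with unit diagonal. -/
structure IsLowerUni (M : Matrix (Fin n) (Fin n) B) : Prop where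
  diag : ∀ i, M i i = 1
  upper : ∀ i j, i < j → M i j = 0

/-- Upper triangular matrices with unit diagonal. -/
structure IsUpperUni (M : Matrix (Fin n) (Fin n) B) : Prop where
  diag : ∀ i, M i i = 1
  lower : ∀ i j, j < i → M i j = 0

theorem sum_eq_diag {f : Fin n → B} {i : Fin n} (h : ∀ m, m ≠ i → f m = 0) : ∑ m, f m = f i :=
  Finset.sum_eq_single i (fun m _ hm => h m hm) (by simp)

/-- With Z = 1 - M strictly lower triangular, hence nilpotent, the inverse is the finite geometric
series in Z. This works over any ring. -/
theorem IsLowerUni.exists_inverse {M : Matrix (Fin n) (Fin n) B} (hM : IsLowerUni M) :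
    ∃ N, IsLowerUni N ∧ M * N = 1 ∧ N * M = 1 := by
  set Z : Matrix (Fin n) (Fin n) B := 1 - M with hZ
  have hZ0 : ∀ i j, i ≤ j → Z i j = 0 := by
    intro i j hij
    rcases eq_or_lt_of_le hij with rfl | h
    · simp [hZ, hM.diag]
    · simp [hZ, hM.upper i j h, h.ne]
  -- The power Z^k is supported at the positions with i - j ≥ k.
  have hpow : ∀ k (i j : Fin n), (i : ℕ) < j + k → (Z ^ k) i j = 0 := by
    intro k
    induction k with
    | zero => intro i j h; rw [pow_zero, Matrix.one_apply_ne]; exact (Fin.lt_def.2 (by simpa using h)).ne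
    | succ k ih =>
      intro i j h
      rw [pow_succ, Matrix.mul_apply]
      refine Finset.sum_eq_zero fun m _ => ?_
      by_cases h1 : m ≤ j
      · rw [hZ0 m j h1, mul_zero]
      · rw [ih i m (by have := Fin.lt_def.1 (not_le.1 h1); omega), zero_mul]
  have hnil : Z ^ n = 0 := by
    ext i j; exact hpow n i j (by have := i.2; omega)
  have hM' : M = 1 - Z := by simp [hZ]
  refine ⟨∑ k ∈ Finset.range n, Z ^ k, ⟨fun i => ?_, fun i j hij => ?_⟩, ?_, ?_⟩
  · rw [Matrix.sum_apply, Finset.sum_eq_single 0]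
    · simp
    · intro k _ hk; exact hpow k i i (by omega)
    · intro h; simp at h; subst h; exact i.elim0
  · rw [Matrix.sum_apply]
    exact Finset.sum_eq_zero fun k _ => hpow k i j (by have := Fin.lt_def.1 hij; omega)
  · rw [hM', mul_neg_geom_sum, hnil, sub_zero]
  · rw [hM', geom_sum_mul_neg, hnil, sub_zero]

theorem IsUpperUni.exists_inverse {M : Matrix (Fin n) (Fin n) B} (hM : IsUpperUni M) :
    ∃ N, IsUpperUni N ∧ M * N = 1 ∧ N * M = 1 := by
  have hrev : IsLowerUni (M.submatrix Fin.rev Fin.rev) :=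
    ⟨fun i => hM.diag _, fun i j h => hM.lower _ _ (Fin.rev_lt_rev.2 h)⟩
  obtain ⟨N, hN, h1, h2⟩ := hrev.exists_inverse
  have hM2 : (M.submatrix Fin.rev Fin.rev).submatrix Fin.rev Fin.rev = M := by
    ext i j; simp
  have hbij : Function.Bijective (Fin.rev : Fin n → Fin n) := Fin.rev_bijective
  have hone : (1 : Matrix (Fin n) (Fin n) B).submatrix Fin.rev Fin.rev = 1 := by
    ext i j; simp [Matrix.one_apply]
  refine ⟨N.submatrix Fin.rev Fin.rev,
    ⟨fun i => hN.diag _, fun i j h => hN.upper _ _ (Fin.rev_lt_rev.2 h)⟩, ?_, ?_⟩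
  · nth_rewrite 1 [← hM2]
    rw [← Matrix.submatrix_mul _ _ _ _ _ hbij, h1, hone]
  · nth_rewrite 1 [← hM2]
    rw [← Matrix.submatrix_mul _ _ _ _ _ hbij, h2, hone]

theorem IsLowerUni.mul {M N : Matrix (Fin n) (Fin n) B} (hM : IsLowerUni M) (hN : IsLowerUni N) :
    IsLowerUni (M * N) where
  diag i := by
    rw [Matrix.mul_apply, sum_eq_diag (i := i), hM.diag, hN.diag, one_mul]
    intro m hm
    rcases lt_or_gt_of_ne hm with h | h
    · rw [hN.upper _ _ h, mul_zero]
    · rw [hM.upper _ _ h, zero_mul]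
  upper i j hij := by
    rw [Matrix.mul_apply]
    refine Finset.sum_eq_zero fun m _ => ?_
    rcases lt_or_ge i m with h | h
    · rw [hM.upper _ _ h, zero_mul]
    · rw [hN.upper _ _ (h.trans_lt hij), mul_zero]

theorem IsUpperUni.mul {M N : Matrix (Fin n) (Fin n) B} (hM : IsUpperUni M) (hN : IsUpperUni N) :
    IsUpperUni (M * N) where
  diag i := by
    rw [Matrix.mul_apply, sum_eq_diag (i := i), hM.diag, hN.diag, one_mul]
    intro m hm
    rcases lt_or_gt_of_ne hm with h | h
    · rw [hM.lower _ _ h, zero_mul]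
    · rw [hN.lower _ _ h, mul_zero]
  lower i j hij := by
    rw [Matrix.mul_apply]
    refine Finset.sum_eq_zero fun m _ => ?_
    rcases lt_or_ge m i with h | h
    · rw [hM.lower _ _ h, zero_mul]
    · rw [hN.lower _ _ (hij.trans_le h), mul_zero]

variable {G G₁ G₂ : GaussFactors n B} {T : Matrix (Fin n) (Fin n) B}

theorem GaussFactors.IsFactorizationOf.lowerUni (h : G.IsFactorizationOf T) : IsLowerUni G.F :=
  ⟨h.F_diag, h.F_upper⟩

theorem GaussFactors.IsFactorizationOf.upperUni (h : G.IsFactorizationOf T) : IsUpperUni G.E :=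
  ⟨h.E_diag, h.E_lower⟩

theorem gauss_apply (G : GaussFactors n B) (i j : Fin n) :
    (G.F * Matrix.diagonal G.D * G.E) i j = ∑ m, G.F i m * G.D m * G.E m j := by
  rw [Matrix.mul_apply]
  simp only [Matrix.mul_diagonal]

/-- In F₂⁻¹ F₁ D₁ = D₂ E₂ E₁⁻¹ the left side is lower and the right side upper triangular. Comparing
the diagonals gives D₁ = D₂, and the invertibility of the diagonal entries then makes both
unitriangular quotients trivial. -/
theorem gauss_unique (h₁ : G₁.IsFactorizationOf T) (h₂ : G₂.IsFactorizationOf T)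
    (hu : ∀ i, IsUnit (G₂.D i)) : G₁ = G₂ := by
  obtain ⟨F', hF', hFF', hF'F⟩ := h₂.lowerUni.exists_inverse
  obtain ⟨E', hE', hEE', hE'E⟩ := h₁.upperUni.exists_inverse
  have hL := hF'.mul h₁.lowerUni
  have hU := h₂.upperUni.mul hE'
  have key : F' * G₁.F * Matrix.diagonal G₁.D = Matrix.diagonal G₂.D * (G₂.E * E') := by
    have h := h₁.eq_mul.symm.trans h₂.eq_mul
    calc F' * G₁.F * Matrix.diagonal G₁.D
        = F' * (G₁.F * Matrix.diagonal G₁.D * G₁.E) * E' := by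
          rw [← mul_assoc, mul_assoc _ G₁.E, hEE', mul_one, mul_assoc]
      _ = F' * (G₂.F * Matrix.diagonal G₂.D * G₂.E) * E' := by rw [h]
      _ = Matrix.diagonal G₂.D * (G₂.E * E') := by
          rw [mul_assoc G₂.F, ← mul_assoc, hF'F, one_mul, mul_assoc]
  have ent : ∀ i j, (F' * G₁.F) i j * G₁.D j = G₂.D i * (G₂.E * E') i j := by
    intro i j
    have := congr_fun (congr_fun key i) j
    rwa [Matrix.mul_diagonal, Matrix.diagonal_mul] at this
  have hD : G₁.D = G₂.D := by
    ext i; simpa [hL.diag, hU.diag] using ent i i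
  have hU1 : G₂.E * E' = 1 := by
    ext i j
    rcases lt_trichotomy i j with h | rfl | h
    · have := ent i j
      rw [hL.upper i j h, zero_mul, eq_comm, (hu i).mul_right_eq_zero] at this
      rw [this, Matrix.one_apply_ne h.ne]
    · rw [hU.diag, Matrix.one_apply_eq]
    · rw [hU.lower i j h, Matrix.one_apply_ne h.ne']
  have hL1 : F' * G₁.F = 1 := by
    ext i j
    rcases lt_trichotomy i j with h | rfl | h
    · rw [hL.upper i j h, Matrix.one_apply_ne h.ne]
    · rw [hL.diag, Matrix.one_apply_eq]
    · have := ent i j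
      rw [hU.lower i j h, mul_zero, hD, (hu j).mul_left_eq_zero] at this
      rw [this, Matrix.one_apply_ne h.ne']
  refine GaussFactors.ext ?_ hD ?_
  · calc G₁.F = G₂.F * F' * G₁.F := by rw [hFF', one_mul]
      _ = G₂.F := by rw [mul_assoc, hL1, mul_one]
  · calc G₁.E = G₂.E * E' * G₁.E := by rw [hU1, one_mul]
      _ = G₂.E := by rw [mul_assoc, hE'E, mul_one]

end Triangular

/-! ### Gauss factorization of matrices of power series -/

section GaussExistence

variable {A : Type*} [Ring A]

theorem isUnit_of_constantCoeff_eq_one {f : PowerSeries A}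
    (h : PowerSeries.constantCoeff f = 1) : IsUnit f := by
  rw [PowerSeries.isUnit_iff_constantCoeff, h]; exact isUnit_one

/-- Block elimination: the corner has constant term 1 and so is invertible, and the Schur complement
again has the identity matrix as its constant term, which allows induction. -/
theorem exists_gauss : ∀ {n : ℕ} (T : Matrix (Fin n) (Fin n) (PowerSeries A)),
    (∀ i j, PowerSeries.constantCoeff (T i j) = if i = j then 1 else 0) →
    ∃ G : GaussFactors n (PowerSeries A), G.IsFactorizationOf T ∧
      (∀ i, PowerSeries.constantCoeff (G.D i) = 1)
  | 0, T, _ => ⟨⟨0, fun i => i.elim0, 0⟩,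
      ⟨fun i => i.elim0, fun i => i.elim0, fun i => i.elim0, fun i => i.elim0,
        Matrix.ext fun i => i.elim0⟩, fun i => i.elim0⟩
  | n + 1, T, hT => by
    have hu : IsUnit (T 0 0) := isUnit_of_constantCoeff_eq_one (by simp [hT])
    set a := T 0 0 with ha
    set b := Ring.inverse a with hb
    have hab : a * b = 1 := Ring.mul_inverse_cancel _ hu
    have hba : b * a = 1 := Ring.inverse_mul_cancel _ hu
    obtain ⟨G, hG, hG1⟩ := exists_gauss
      (Matrix.of fun i j : Fin n => T i.succ j.succ - T i.succ 0 * b * T 0 j.succ) (by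
        intro i j
        simp [hT, Fin.succ_ne_zero])
    refine ⟨⟨Matrix.of (Fin.cases (Fin.cases 1 fun _ => 0)
        fun i => Fin.cases (T i.succ 0 * b) fun j => G.F i j), Fin.cases a G.D,
        Matrix.of (Fin.cases (Fin.cases 1 fun j => b * T 0 j.succ)
        fun i => Fin.cases 0 fun j => G.E i j)⟩, ⟨?_, ?_, ?_, ?_, ?_⟩, ?_⟩
    · refine Fin.cases (by simp) fun i => ?_
      simpa using hG.F_diag i
    · refine Fin.cases (Fin.cases (by simp) (by simp)) fun i => Fin.cases (by simp) fun j h => ?_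
      simpa using hG.F_upper i j (by simpa using h)
    · refine Fin.cases (by simp) fun i => ?_
      simpa using hG.E_diag i
    · refine Fin.cases (Fin.cases (by simp) (by simp)) fun i => Fin.cases (by simp) fun j h => ?_
      simpa using hG.E_lower i j (by simpa using h)
    · refine Matrix.ext fun i j => ?_
      rw [gauss_apply, Fin.sum_univ_succ]
      revert i j
      refine Fin.cases (Fin.cases ?_ fun j => ?_) fun i => Fin.cases ?_ fun j => ?_
      · simp [ha]
      · simp [← mul_assoc, hab]
      · simp [mul_assoc, hba]
      · have h1 := congr_fun (congr_fun hG.eq_mul i) j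
        rw [gauss_apply, Matrix.of_apply, sub_eq_iff_eq_add] at h1
        simp only [Matrix.of_apply, Fin.cases_zero, Fin.cases_succ]
        rw [h1, add_comm, mul_assoc (T i.succ 0) b a, hba, mul_one, mul_assoc]
    · refine Fin.cases (by simp [ha, hT]) fun i => ?_
      simpa using hG1 i

theorem existsUnique_gauss {n : ℕ} (T : Matrix (Fin n) (Fin n) (PowerSeries A))
    (hT : ∀ i j, PowerSeries.constantCoeff (T i j) = if i = j then 1 else 0) :
    ∃! G : GaussFactors n (PowerSeries A), G.IsFactorizationOf T := by
  obtain ⟨G, hG, hG1⟩ := exists_gauss T hT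
  exact ⟨G, hG, fun G' hG' =>
    gauss_unique hG' hG fun i => isUnit_of_constantCoeff_eq_one (hG1 i)⟩

theorem GaussFactors.IsFactorizationOf.constantCoeff_D {n : ℕ}
    {T : Matrix (Fin n) (Fin n) (PowerSeries A)}
    (hT : ∀ i j, PowerSeries.constantCoeff (T i j) = if i = j then 1 else 0)
    {G : GaussFactors n (PowerSeries A)} (hG : G.IsFactorizationOf T) (i : Fin n) :
    PowerSeries.constantCoeff (G.D i) = 1 := by
  obtain ⟨G', hG', hG1⟩ := exists_gauss T hT
  rw [gauss_unique hG hG' fun i => isUnit_of_constantCoeff_eq_one (hG1 i), hG1]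

/-- Taking constant terms is a ring homomorphism, so the constant terms of the factors form a Gauss
factorization of the identity matrix; uniqueness determines them. -/
theorem GaussFactors.IsFactorizationOf.constantCoeff_eq_one {n : ℕ}
    {T : Matrix (Fin n) (Fin n) (PowerSeries A)}
    (hT : ∀ i j, PowerSeries.constantCoeff (T i j) = if i = j then 1 else 0)
    {G : GaussFactors n (PowerSeries A)} (hG : G.IsFactorizationOf T) :
    (∀ i j, PowerSeries.constantCoeff (G.F i j) = if i = j then 1 else 0) ∧
      ∀ i j, PowerSeries.constantCoeff (G.E i j) = if i = j then 1 else 0 := by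
  set G₀ : GaussFactors n A := ⟨G.F.map PowerSeries.constantCoeff,
    fun i => PowerSeries.constantCoeff (G.D i), G.E.map PowerSeries.constantCoeff⟩ with hG₀
  have h1 : G₀.IsFactorizationOf 1 := by
    refine ⟨fun i => by simp [hG₀, hG.F_diag], fun i j h => by simp [hG₀, hG.F_upper i j h],
      fun i => by simp [hG₀, hG.E_diag], fun i j h => by simp [hG₀, hG.E_lower i j h], ?_⟩
    refine Matrix.ext fun i j => ?_
    rw [gauss_apply, Matrix.one_apply, ← hT, hG.eq_mul, gauss_apply]
    simp [hG₀]
  have h2 : (⟨1, fun _ => 1, 1⟩ : GaussFactors n A).IsFactorizationOf 1 :=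
    ⟨fun i => by simp, fun i j h => by simp [h.ne], fun i => by simp, fun i j h => by simp [h.ne'],
      by simp⟩
  have h3 := gauss_unique h1 h2 fun i => isUnit_one
  constructor
  · intro i j
    have := congr_fun (congr_fun (congr_arg GaussFactors.F h3) i) j
    simpa [hG₀, Matrix.one_apply] using this
  · intro i j
    have := congr_fun (congr_fun (congr_arg GaussFactors.E h3) i) j
    simpa [hG₀, Matrix.one_apply] using this

theorem coeff_one_mul_eq (f g : PowerSeries A) : PowerSeries.coeff 1 (f * g) =
    PowerSeries.constantCoeff f * PowerSeries.coeff 1 g +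
      PowerSeries.coeff 1 f * PowerSeries.constantCoeff g := by
  rw [PowerSeries.coeff_mul, Finset.Nat.antidiagonal_succ]
  simp

/-- All three factors are congruent to 1 modulo u⁻¹, so their product is additive in first order.
This identifies the degree-one generators of the two presentations. -/
theorem GaussFactors.IsFactorizationOf.coeff_one {n : ℕ}
    {T : Matrix (Fin n) (Fin n) (PowerSeries A)}
    (hT : ∀ i j, PowerSeries.constantCoeff (T i j) = if i = j then 1 else 0)
    {G : GaussFactors n (PowerSeries A)} (hG : G.IsFactorizationOf T) (i j : Fin n) :
    PowerSeries.coeff 1 (T i j) = PowerSeries.coeff 1 (G.F i j) +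
      (if i = j then PowerSeries.coeff 1 (G.D i) else 0) + PowerSeries.coeff 1 (G.E i j) := by
  obtain ⟨hF, hE⟩ := hG.constantCoeff_eq_one hT
  have hD := hG.constantCoeff_D hT
  nth_rewrite 1 [hG.eq_mul]
  rw [gauss_apply, map_sum]
  simp only [coeff_one_mul_eq, map_mul, hF, hE, hD, mul_one, one_mul, ite_mul, mul_ite, zero_mul,
    mul_zero]
  simp only [Finset.sum_add_distrib, Finset.sum_ite_eq, Finset.sum_ite_eq', Finset.mem_univ, if_true]
  by_cases hij : i = j
  · subst hij; simp only [if_true]; abel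
  · simp only [if_neg hij]; abel

end GaussExistence

/-! ### RTT relations for inverse matrices and Schur complements -/

section InverseRTT

variable {B : Type*} [Ring B] {κ : Type*}

/-- The relation `α [t_{ij}, t'_{kl}] = β (t_{kj} t'_{il} - t'_{kj} t_{il})` between the entries of
two matrices, together with the one obtained by exchanging the two matrices and the sign of
`α`. -/
structure RTTPair (α β : B) (t t' : Matrix κ κ B) : Prop where
  rel : ∀ i j k l, α * (t i j * t' k l - t' k l * t i j) = β * (t k j * t' i l - t' k j * t i l)
  swap : ∀ i j k l, α * (t i j * t' k l - t' k l * t i j) = β * (t' i l * t k j - t i l * t' k j)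

theorem RTTPair.submatrix {α β : B} {t t' : Matrix κ κ B} (h : RTTPair α β t t') {κ' : Type*}
    (e : κ' → κ) : RTTPair α β (t.submatrix e e) (t'.submatrix e e) :=
  ⟨fun _ _ _ _ => h.rel _ _ _ _, fun _ _ _ _ => h.swap _ _ _ _⟩

variable [Fintype κ]

theorem mul_smul_of_central {c : B} (hc : ∀ x, c * x = x * c) (M N : Matrix κ κ B) :
    M * (c • N) = c • (M * N) := by
  refine Matrix.ext fun p q => ?_
  simp only [Matrix.mul_apply, Matrix.smul_apply, smul_eq_mul, Finset.mul_sum]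
  refine Finset.sum_congr rfl fun x _ => ?_
  rw [← mul_assoc, ← hc, mul_assoc]

variable [DecidableEq κ]

/-- Conjugating a commutator with a scalar by the inverse matrix. -/
theorem conj_commutator {α β : B} (hα : ∀ x, α * x = x * α) (hβ : ∀ x, β * x = x * β)
    {t s : Matrix κ κ B} (h1 : t * s = 1) (h2 : s * t = 1) (x : B) (p p' q q' : κ → B)
    (h : ∀ k l, α * (x * t k l - t k l * x) = β * (p k * q l - p' k * q' l)) (a b : κ) :
    α * (s a b * x - x * s a b) =
      β * ((s *ᵥ p) a * (q ᵥ* s) b - (s *ᵥ p') a * (q' ᵥ* s) b) := by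
  set X : Matrix κ κ B := Matrix.diagonal fun _ => x with hX
  have hm : α • (X * t - t * X) =
      β • (Matrix.vecMulVec p q - Matrix.vecMulVec p' q') := by
    refine Matrix.ext fun k l => ?_
    simpa [hX, Matrix.vecMulVec_apply] using h k l
  have h3 : s * (α • (X * t - t * X)) * s = α • (s * X - X * s) := by
    rw [mul_smul_of_central hα, Matrix.smul_mul, mul_sub, sub_mul]
    congr 2
    · rw [← mul_assoc, mul_assoc _ t s, h1, mul_one]
    · rw [← mul_assoc, h2, one_mul]
  have h4 : s * (β • (Matrix.vecMulVec p q - Matrix.vecMulVec p' q')) * s =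
      β • (Matrix.vecMulVec (s *ᵥ p) (q ᵥ* s) - Matrix.vecMulVec (s *ᵥ p') (q' ᵥ* s)) := by
    rw [mul_smul_of_central hβ, Matrix.smul_mul, mul_sub, sub_mul, Matrix.mul_vecMulVec,
      Matrix.mul_vecMulVec, Matrix.vecMulVec_mul, Matrix.vecMulVec_mul]
  rw [hm, h4] at h3
  have := congr_fun (congr_fun h3 a) b
  simpa [hX, Matrix.vecMulVec_apply] using this.symm

variable {α β : B} (hα : ∀ x, α * x = x * α) (hβ : ∀ x, β * x = x * β)
  {t t' s s' : Matrix κ κ B}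

include hα hβ in
-- The point is the locality: an entry of the inverse s' at (a, b) commutes up to α with the entry
-- of t at (i, j) unless i = b or a = j.
theorem mixed_relation (h : ∀ i j k l, α * (t i j * t' k l - t' k l * t i j) =
      β * (t k j * t' i l - t' k j * t i l))
    (h1 : t' * s' = 1) (h2 : s' * t' = 1) (i j a b : κ) :
    α * (s' a b * t i j - t i j * s' a b) =
      β * ((if i = b then (s' * t) a j else 0) - (if a = j then (t * s') i b else 0)) := by
  rw [conj_commutator hα hβ h1 h2 (t i j) (fun k => t k j) (fun k => t' k j) (fun l => t' i l)
    (fun l => t i l) (fun k l => h i j k l) a b]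
  have e1 : (s' *ᵥ fun k => t k j) a = (s' * t) a j := rfl
  have e2 : ((fun l => t' i l) ᵥ* s') b = (t' * s') i b := rfl
  have e3 : (s' *ᵥ fun k => t' k j) a = (s' * t') a j := rfl
  have e4 : ((fun l => t i l) ᵥ* s') b = (t * s') i b := rfl
  rw [e1, e2, e3, e4, h1, h2, Matrix.one_apply, Matrix.one_apply]
  simp

include hα hβ in
theorem inverse_relation (h : ∀ i j k l, α * (t i j * t' k l - t' k l * t i j) =
      β * (t k j * t' i l - t' k j * t i l))
    (h1 : t * s = 1) (h2 : s * t = 1) (h1' : t' * s' = 1) (h2' : s' * t' = 1) (i j k l : κ) :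
    α * (s i j * s' k l - s' k l * s i j) = β * (s i l * s' k j - s' i l * s k j) := by
  have h3 := mixed_relation hα hβ h h1' h2'
  rw [conj_commutator hα hβ h1 h2 (s' k l) (Pi.single l 1) (fun i => (t * s') i l)
    (fun j => (s' * t) k j) (Pi.single k 1) (fun a b => by
      rw [h3 a b k l]
      simp [Pi.single_apply, eq_comm (a := b)]) i j]
  have e1 : ((fun j => (s' * t) k j) ᵥ* s) j = (s' * t * s) k j := rfl
  have e2 : (s *ᵥ fun i => (t * s') i l) i = (s * (t * s')) i l := rfl
  rw [e1, e2, mul_assoc s' t s, h1, mul_one, ← mul_assoc, h2, one_mul]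
  simp

include hα hβ in
-- Inverting both matrices reverses the products and changes the sign of β. It turns the relation
-- `rel` into `swap` and conversely, which is why `RTTPair` records both.
theorem RTTPair.inverse (h : RTTPair α β t t')
    (h1 : t * s = 1) (h2 : s * t = 1) (h1' : t' * s' = 1) (h2' : s' * t' = 1) :
    RTTPair α (-β) s s' := by
  have hα' : ∀ x, -α * x = x * -α := fun x => by rw [neg_mul, hα, mul_neg]
  constructor
  · intro i j k l
    have := inverse_relation (t := t') (t' := t) hα' hβ (fun i j k l => by
      have := h.swap k l i j
      rw [neg_mul, ← mul_neg, neg_sub, this]) h1' h2' h1 h2 k l i j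
    rw [neg_mul, ← mul_neg, neg_sub] at this
    rw [this, neg_mul, ← mul_neg, neg_sub]
  · intro i j k l
    rw [inverse_relation hα hβ h.rel h1 h2 h1' h2', neg_mul, ← mul_neg, neg_sub]

end InverseRTT

/-! ### Schur complements and the commutativity of their corners -/

section Tail

variable {n : ℕ} {B : Type*} [Ring B]

/-- The lower right block with indices `≥ i`. -/
def tail (i : Fin n) (M : Matrix (Fin n) (Fin n) B) : Matrix {k // i ≤ k} {k // i ≤ k} B :=
  M.submatrix (↑) (↑)

theorem tail_one (i : Fin n) : tail i (1 : Matrix (Fin n) (Fin n) B) = 1 := by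
  ext a b; simp [tail, Matrix.one_apply, Subtype.ext_iff]

theorem sum_tail {i : Fin n} {f : Fin n → B} (h : ∀ m, m < i → f m = 0) :
    ∑ m, f m = ∑ m : {k // i ≤ k}, f m := by
  rw [← Finset.sum_subtype (Finset.univ.filter (i ≤ ·)) (by simp) f, eq_comm]
  refine Finset.sum_subset (Finset.subset_univ _) fun m _ hm => h m ?_
  simpa using hm

theorem tail_mul_of_left (i : Fin n) {U M : Matrix (Fin n) (Fin n) B}
    (h : ∀ k m, m < k → U k m = 0) : tail i (U * M) = tail i U * tail i M := by
  ext a b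
  exact sum_tail (f := fun m => U a m * M m b) fun m hm => by
    rw [h _ _ (hm.trans_le a.2), zero_mul]

theorem tail_mul_of_right (i : Fin n) {M L : Matrix (Fin n) (Fin n) B}
    (h : ∀ k m, k < m → L k m = 0) : tail i (M * L) = tail i M * tail i L := by
  ext a b
  exact sum_tail (f := fun m => M a m * L m b) fun m hm => by
    rw [h _ _ (hm.trans_le b.2), mul_zero]

variable {G : GaussFactors n B} {T : Matrix (Fin n) (Fin n) B}

/-- The iterated Schur complement of `T` on the indices `≥ i`. -/
def schur (G : GaussFactors n B) (i : Fin n) : Matrix {k // i ≤ k} {k // i ≤ k} B :=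
  tail i G.F * tail i (Matrix.diagonal G.D) * tail i G.E

/-- Since T⁻¹ = E⁻¹ D⁻¹ F⁻¹ with the upper factor on the left and the lower one on the right,
restriction to the indices ≥ i is compatible with the product. Thus the block of T⁻¹ is inverse to
the Schur complement. -/
theorem exists_inverse_schur (hG : G.IsFactorizationOf T) (hu : ∀ i, IsUnit (G.D i)) :
    ∃ S : Matrix (Fin n) (Fin n) B, T * S = 1 ∧ S * T = 1 ∧
      ∀ i, tail i S * schur G i = 1 ∧ schur G i * tail i S = 1 := by
  obtain ⟨F', hF', hFF', hF'F⟩ := hG.lowerUni.exists_inverse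
  obtain ⟨E', hE', hEE', hE'E⟩ := hG.upperUni.exists_inverse
  set D' : Matrix (Fin n) (Fin n) B := Matrix.diagonal fun i => Ring.inverse (G.D i) with hD'
  have hDD' : Matrix.diagonal G.D * D' = 1 := by
    rw [hD', Matrix.diagonal_mul_diagonal, ← Matrix.diagonal_one]
    congr 1; ext i; exact Ring.mul_inverse_cancel _ (hu i)
  have hD'D : D' * Matrix.diagonal G.D = 1 := by
    rw [hD', Matrix.diagonal_mul_diagonal, ← Matrix.diagonal_one]
    congr 1; ext i; exact Ring.inverse_mul_cancel _ (hu i)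
  have cancel : ∀ {κ : Type _} [Fintype κ] [DecidableEq κ] {f d e f' d' e' : Matrix κ κ B},
      f * f' = 1 → d * d' = 1 → e * e' = 1 → f * d * e * (e' * d' * f') = 1 := by
    intro κ _ _ f d e f' d' e' h1 h2 h3
    calc f * d * e * (e' * d' * f') = f * (d * (e * e') * d') * f' := by simp only [mul_assoc]
      _ = 1 := by rw [h3, mul_one, h2, mul_one, h1]
  have hdl : ∀ d : Fin n → B, ∀ k m, m < k → Matrix.diagonal d k m = 0 := fun d k m h =>
    Matrix.diagonal_apply_ne _ h.ne'
  refine ⟨E' * D' * F', ?_, ?_, fun i => ?_⟩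
  · rw [hG.eq_mul]; exact cancel hFF' hDD' hEE'
  · rw [hG.eq_mul]; exact cancel hE'E hD'D hF'F
  · have h1 : tail i (E' * D' * F') = tail i E' * tail i D' * tail i F' := by
      rw [tail_mul_of_right i hF'.upper, tail_mul_of_left i hE'.lower]
    rw [h1, schur]
    constructor
    · refine cancel ?_ ?_ ?_
      · rw [← tail_mul_of_left i hE'.lower, hE'E, tail_one]
      · rw [← tail_mul_of_left i (hdl _), hD'D, tail_one]
      · rw [← tail_mul_of_right i hG.F_upper, hF'F, tail_one]
    · refine cancel ?_ ?_ ?_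
      · rw [← tail_mul_of_right i hF'.upper, hFF', tail_one]
      · rw [← tail_mul_of_left i (hdl _), hDD', tail_one]
      · rw [← tail_mul_of_left i hG.E_lower, hEE', tail_one]

theorem schur_apply (G : GaussFactors n B) (i : Fin n) (a b : {k // i ≤ k}) :
    schur G i a b = ∑ m : {k // i ≤ k}, G.F a m * G.D m * G.E m b := by
  have h1 : tail i (Matrix.diagonal G.D) = Matrix.diagonal fun m : {k // i ≤ k} => G.D m := by
    ext a b : 2; simp [tail, Matrix.diagonal_apply, Subtype.ext_iff]
  rw [schur, h1, Matrix.mul_apply]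
  simp [Matrix.mul_diagonal, tail]

theorem schur_row (hG : G.IsFactorizationOf T) (i : Fin n) (b : {k // i ≤ k}) :
    schur G i ⟨i, le_rfl⟩ b = G.D i * G.E i b := by
  rw [schur_apply, Finset.sum_eq_single ⟨i, le_rfl⟩]
  · simp [hG.F_diag]
  · intro m _ hm
    rw [hG.F_upper i m (lt_of_le_of_ne m.2 fun h => hm (Subtype.ext h.symm)), zero_mul, zero_mul]
  · simp

theorem schur_diag (hG : G.IsFactorizationOf T) (i : Fin n) :
    schur G i ⟨i, le_rfl⟩ ⟨i, le_rfl⟩ = G.D i := by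
  rw [schur_row hG, hG.E_diag, mul_one]

theorem map_mul_eq_one {κ B B' : Type*} [Fintype κ] [DecidableEq κ] [Ring B] [Ring B']
    (f : B →+* B') {M N : Matrix κ κ B} (h : M * N = 1) : M.map f * N.map f = 1 := by
  rw [← Matrix.map_mul, h, Matrix.map_one _ (map_zero f) (map_one f)]

/-- Invert, restrict to the block, invert again: each inversion changes the sign of β, so the
original relation returns. -/
theorem RTTPair.schur {B' : Type*} [Ring B'] {f g : B →+* B'} {α β : B'}
    (h : RTTPair α β (T.map f) (T.map g)) (hα : ∀ x, α * x = x * α) (hβ : ∀ x, β * x = x * β)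
    (hG : G.IsFactorizationOf T) (hu : ∀ i, IsUnit (G.D i)) (i : Fin n) :
    RTTPair α β ((schur G i).map f) ((schur G i).map g) := by
  obtain ⟨S, h1, h2, h3⟩ := exists_inverse_schur hG hu
  have hneg : ∀ x, -β * x = x * -β := fun x => by rw [neg_mul, hβ, mul_neg]
  have hS : RTTPair α (-β) ((tail i S).map f) ((tail i S).map g) :=
    (h.inverse hα hβ (map_mul_eq_one f h1) (map_mul_eq_one f h2) (map_mul_eq_one g h1)
      (map_mul_eq_one g h2)).submatrix (fun k : {k // i ≤ k} => (k : Fin n))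
  have := hS.inverse (s := (YangianGL.schur G i).map f) (s' := (YangianGL.schur G i).map g) hα hneg
    (map_mul_eq_one f (h3 i).1) (map_mul_eq_one f (h3 i).2)
    (map_mul_eq_one g (h3 i).1) (map_mul_eq_one g (h3 i).2)
  rwa [neg_neg] at this

/-- In the Schur complement at i, the corner D_i has both indices i, whereas the entries of its
inverse with indices ≥ j avoid i. The mixed relation makes them commute after cancelling α; the
Schur complement at j is the inverse of that block and has D_j as its corner. -/
theorem RTTPair.commute_D {B' : Type*} [Ring B'] {f g : B →+* B'} {α β : B'}
    (h : RTTPair α β (T.map f) (T.map g)) (hα : ∀ x, α * x = x * α) (hβ : ∀ x, β * x = x * β)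
    (hG : G.IsFactorizationOf T) (hu : ∀ i, IsUnit (G.D i)) (hreg : ∀ x, α * x = 0 → x = 0)
    {i j : Fin n} (hij : i < j) : f (G.D i) * g (G.D j) = g (G.D j) * f (G.D i) := by
  obtain ⟨S, h1, h2, h3⟩ := exists_inverse_schur hG hu
  have hc : ∀ a b : {k // j ≤ k}, g (S a b) * f (G.D i) = f (G.D i) * g (S a b) := by
    intro a b
    have ha : i < a := hij.trans_le a.2
    have hb : i < b := hij.trans_le b.2
    have := mixed_relation hα hβ (h.schur hα hβ hG hu i).rel
      (map_mul_eq_one g (h3 i).2) (map_mul_eq_one g (h3 i).1) ⟨i, le_rfl⟩ ⟨i, le_rfl⟩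
      ⟨a, ha.le⟩ ⟨b, hb.le⟩
    rw [if_neg (fun h => hb.ne (congr_arg Subtype.val h)),
      if_neg (fun h => ha.ne' (congr_arg Subtype.val h)), sub_zero, mul_zero] at this
    simp only [Matrix.map_apply, schur_diag hG] at this
    exact sub_eq_zero.1 (hreg _ this)
  -- For α = 1 and β = 0 conjugation says: what commutes with all entries of an invertible matrix
  -- commutes with those of its inverse.
  have h4 := conj_commutator (α := 1) (β := 0) (by simp) (by simp)
    (t := (tail j S).map g) (s := (YangianGL.schur G j).map g) (map_mul_eq_one g (h3 j).1)
    (map_mul_eq_one g (h3 j).2) (f (G.D i)) 0 0 0 0 (fun k l => by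
      rw [zero_mul, one_mul, sub_eq_zero]
      exact (hc k l).symm) ⟨j, le_rfl⟩ ⟨j, le_rfl⟩
  rw [zero_mul, one_mul, sub_eq_zero, Matrix.map_apply, schur_diag hG] at h4
  exact h4.symm

end Tail

/-! ### Commutators of D with D and of D with E, in all degrees -/

section GaussRelations

variable {n : ℕ} {A : Type*} [Ring A] {T : Fin n → Fin n → ℕ → A}
  {G : GaussFactors n (PowerSeries A)}

theorem IsRTT.constantCoeff (hT : IsRTT T) (i j : Fin n) :
    PowerSeries.constantCoeff (seriesMatrix T i j) = if i = j then 1 else 0 := by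
  rw [← PowerSeries.coeff_zero_eq_constantCoeff_apply, coeff_seriesMatrix, hT.zero]

theorem central_sub (x : PowerSeries (PowerSeries A)) :
    (vInv A - uInv A) * x = x * (vInv A - uInv A) := by
  rw [sub_mul, mul_sub, uInv_comm, vInv_comm]

theorem central_mul (x : PowerSeries (PowerSeries A)) :
    uInv A * vInv A * x = x * (uInv A * vInv A) := by
  rw [mul_assoc, vInv_comm, ← mul_assoc, uInv_comm, mul_assoc, uInv_comm]

theorem IsRTT.rttPair (hT : IsRTT T) : RTTPair (vInv A - uInv A) (uInv A * vInv A)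
    ((seriesMatrix T).map inU) ((seriesMatrix T).map inV) := by
  constructor
  · exact (isRTT_iff_series T hT.zero).1 hT
  · intro i j k l
    obtain ⟨h1, h2, h3⟩ := (sub_mul_eq_iff _ _).1 ((isRTT_iff_series T hT.zero).1 hT i j k l)
    refine (sub_mul_eq_iff _ _).2 ⟨h1, h2, fun r s => ?_⟩
    -- The second form of the relation is the first with the two factors, and so u and v, exchanged.
    have := hT.rel k l i j s r
    simp only [Ring.lie_def] at this
    simp only [Matrix.map_apply, coeff₂_sub, coeff₂_inU_mul_inV, coeff₂_inV_mul_inU,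
      coeff_seriesMatrix]
    rw [← this]; abel

variable (hT : IsRTT T) (hG : G.IsFactorizationOf (seriesMatrix T))

include hT hG in
theorem GaussFactors.IsFactorizationOf.isUnit_D (i : Fin n) : IsUnit (G.D i) :=
  isUnit_of_constantCoeff_eq_one (hG.constantCoeff_D hT.constantCoeff i)

include hT hG in
theorem rttPair_schur (i : Fin n) : RTTPair (vInv A - uInv A) (uInv A * vInv A)
    ((schur G i).map inU) ((schur G i).map inV) :=
  hT.rttPair.schur central_sub central_mul hG (hG.isUnit_D hT) i

include hT hG in
-- For i < j this is locality in Schur complements, and i > j follows by exchanging u and v. For i =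
-- j, with P the commutator, the two forms of the relation give αP = βP and αP = -βP, hence 2αP = 0.
theorem inU_D_mul_inV_D (two : ∀ x : A, x + x = 0 → x = 0) (i j : Fin n) :
    inU (G.D i) * inV (G.D j) = inV (G.D j) * inU (G.D i) := by
  have main : ∀ i j, i < j → inU (G.D i) * inV (G.D j) = inV (G.D j) * inU (G.D i) :=
    fun i j hij => hT.rttPair.commute_D central_sub central_mul hG (hG.isUnit_D hT)
      (fun x hx => sub_mul_eq_zero hx) hij
  rcases lt_trichotomy i j with h | rfl | h
  · exact main i j h
  · have h1 := (rttPair_schur hT hG i).rel ⟨i, le_rfl⟩ ⟨i, le_rfl⟩ ⟨i, le_rfl⟩ ⟨i, le_rfl⟩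
    have h2 := (rttPair_schur hT hG i).swap ⟨i, le_rfl⟩ ⟨i, le_rfl⟩ ⟨i, le_rfl⟩ ⟨i, le_rfl⟩
    simp only [Matrix.map_apply, schur_diag hG] at h1 h2
    set P := inU (G.D i) * inV (G.D i) - inV (G.D i) * inU (G.D i) with hP
    have h3 : (vInv A - uInv A) * (P + P) = 0 := by
      rw [mul_add]
      nth_rewrite 1 [h1]
      rw [h2, ← mul_add, hP]; simp
    have h4 := sub_mul_eq_zero h3
    rw [← sub_eq_zero, ← hP]
    refine ext₂ fun r s => two _ ?_
    rw [← coeff₂_add, h4, coeff₂_zero]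
  · refine ext₂ fun r s => ?_
    have := congr_arg (coeff₂ s r) (main j i h)
    simp only [coeff₂_inU_mul_inV, coeff₂_inV_mul_inU] at this ⊢
    exact this.symm

include hT hG in
theorem coeff_D_comm (two : ∀ x : A, x + x = 0 → x = 0) (i j : Fin n) (r s : ℕ) :
    ⁅PowerSeries.coeff r (G.D i), PowerSeries.coeff s (G.D j)⁆ = 0 := by
  have := congr_arg (coeff₂ r s) (inU_D_mul_inV_D hT hG two i j)
  simp only [coeff₂_inU_mul_inV, coeff₂_inV_mul_inU] at this
  rw [Ring.lie_def, this, sub_self]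

include hT hG in
/-- The commutator of `D_i(u)` with the entries of the `i`-th row of `E(v)`. -/
theorem D_E_relation (two : ∀ x : A, x + x = 0 → x = 0) {i j : Fin n} (hij : i ≤ j) :
    (vInv A - uInv A) * (inU (G.D i) * inV (G.E i j) - inV (G.E i j) * inU (G.D i)) =
      uInv A * vInv A * (inU (G.D i) * inV (G.E i j) - inU (G.D i) * inU (G.E i j)) := by
  have h1 := (rttPair_schur hT hG i).rel ⟨i, le_rfl⟩ ⟨i, le_rfl⟩ ⟨i, le_rfl⟩ ⟨j, hij⟩
  have hc := inU_D_mul_inV_D hT hG two i i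
  have e1 := schur_row hG i ⟨j, hij⟩
  simp only [Matrix.map_apply, schur_diag hG, e1, map_mul] at h1
  set d := inU (G.D i)
  set d' := inV (G.D i)
  set e := inU (G.E i j)
  set e' := inV (G.E i j)
  -- The relation is known for the row entry D_i(v) E_{ij}(v); its factor D_i(v) commutes with
  -- D_i(u) and is a unit, so it can be cancelled.
  have hu : IsUnit d' := (hG.isUnit_D hT i).map inV
  apply hu.mul_left_cancel
  rw [← mul_assoc, ← central_sub, mul_assoc, ← mul_assoc d', ← central_mul, mul_assoc]
  convert h1 using 2
  · rw [mul_sub, ← mul_assoc, ← mul_assoc, ← mul_assoc, hc]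
  · rw [mul_sub, ← mul_assoc, ← mul_assoc, ← mul_assoc, hc]

include hT hG in
-- The series relation is a recursion that lowers r and raises s, adding one product at each step.
-- For s ≥ 1 the term in u alone does not contribute.
theorem coeff_D_E (two : ∀ x : A, x + x = 0 → x = 0) {i j : Fin n} (hij : i < j) (r s : ℕ)
    (hs : 1 ≤ s) : ⁅PowerSeries.coeff r (G.D i), PowerSeries.coeff s (G.E i j)⁆ =
      ∑ t ∈ Finset.range r, PowerSeries.coeff t (G.D i) *
        PowerSeries.coeff (r + s - 1 - t) (G.E i j) := by
  obtain ⟨h1, h2, h3⟩ := (sub_mul_eq_iff _ _).1 (D_E_relation hT hG two hij.le)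
  induction r generalizing s with
  | zero =>
    have := h1 s
    simpa [Ring.lie_def] using this
  | succ r ih =>
    have := h3 r s
    rw [← map_mul] at this
    simp only [coeff₂_sub, coeff₂_inU_mul_inV, coeff₂_inV_mul_inU, coeff₂_inU,
      if_neg (show s ≠ 0 by omega), sub_zero] at this
    have h4 := ih (s + 1) (by omega)
    rw [Ring.lie_def] at h4 ⊢
    rw [sub_eq_iff_eq_add] at this
    rw [this, h4, Finset.sum_range_succ, add_comm, show r + 1 + s - 1 - r = s by omega]
    simp only [show r + (s + 1) - 1 = r + 1 + s - 1 by omega]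

end GaussRelations

/-! ### Action of `gl_n` on the Gauss factors -/

section Covariance

variable {n : ℕ} {B : Type*} [Ring B]

theorem lower_mul {M N : Matrix (Fin n) (Fin n) B} (hM : ∀ i j, i < j → M i j = 0)
    (hN : ∀ i j, i < j → N i j = 0) (i j : Fin n) (hij : i < j) : (M * N) i j = 0 := by
  rw [Matrix.mul_apply]
  refine Finset.sum_eq_zero fun m _ => ?_
  rcases lt_or_ge i m with h | h
  · rw [hM _ _ h, zero_mul]
  · rw [hN _ _ (h.trans_lt hij), mul_zero]

variable {G : GaussFactors n B} {T : Matrix (Fin n) (Fin n) B}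

/-- The action of a simple root vector `c` of `gl_n` on the Gauss factors of a matrix on whose
entries it acts as on matrix units. -/
theorem gauss_covariance {c : B} {j j' : Fin n} (hj : (j' : ℕ) = j + 1)
    (hG : G.IsFactorizationOf T) (hu : ∀ i, IsUnit (G.D i))
    (hc : ∀ k l, c * T k l - T k l * c =
      (if j' = k then T j l else 0) - (if l = j then T k j' else 0)) :
    (∀ a, c * G.D a - G.D a * c =
      (if a = j' then G.D a * G.E j j' else 0) - (if a = j then G.D a * G.E j j' else 0)) ∧
    (∀ a b, c * G.E a b - G.E a b * c =
      ((if a = j then G.E j j' else 0) - (if a = j' then G.E j j' else 0)) * G.E a b +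
        (if a = j' then G.E j b else 0) - (if b = j then G.E a j' else 0)) ∧
    (∀ a b, c * G.F a b - G.F a b * c =
      (if a = j' then G.F j b else 0) -
        (if b = j then G.F a j' * G.D j' * Ring.inverse (G.D j) else 0)) := by
  have hjj : j < j' := Fin.lt_def.2 (by omega)
  obtain ⟨F', hF', hFF', hF'F⟩ := hG.lowerUni.exists_inverse
  -- The hypothesis on c says exactly that K = c - e_{j'j} commutes with T. Being lower triangular,
  -- K can be pushed through the factors one by one.
  set K : Matrix (Fin n) (Fin n) B := Matrix.diagonal (fun _ => c) - Matrix.single j' j 1 with hK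
  have hKapp : ∀ (M : Matrix (Fin n) (Fin n) B) a b,
      (K * M) a b = c * M a b - if a = j' then M j b else 0 := by
    intro M a b
    rw [hK, sub_mul, Matrix.sub_apply, Matrix.diagonal_mul]
    by_cases h : a = j'
    · subst h; simp
    · simp [h, Matrix.single_mul_apply_of_ne _ _ _ _ _ h]
  have happK : ∀ (M : Matrix (Fin n) (Fin n) B) a b,
      (M * K) a b = M a b * c - if b = j then M a j' else 0 := by
    intro M a b
    rw [hK, mul_sub, Matrix.sub_apply, Matrix.mul_diagonal]
    by_cases h : b = j
    · subst h; simp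
    · simp [h, Matrix.mul_single_apply_of_ne _ _ _ _ _ h]
  have hKT : K * T = T * K := by
    refine Matrix.ext fun a b => ?_
    rw [hKapp, happK]
    have := hc a b
    simp only [eq_comm (a := j')] at this
    rwa [sub_eq_sub_iff_sub_eq_sub]
  -- Here Q = F⁻¹KF and P = D⁻¹QD are lower triangular, while KT = TK gives P = EKE⁻¹. This double
  -- description determines P, hence Q.
  set Q := F' * K * G.F with hQ
  have hKlow : ∀ a b, a < b → K a b = 0 := by
    intro a b hab
    have : ¬(j' = a ∧ j = b) := by rintro ⟨rfl, rfl⟩; exact absurd hab (not_lt.2 hjj.le)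
    simp [hK, hab.ne, this]
  have hQlow : ∀ a b, a < b → Q a b = 0 :=
    lower_mul (lower_mul hF'.upper hKlow) hG.F_upper
  have hFQ : K * G.F = G.F * Q := by rw [hQ, ← mul_assoc, ← mul_assoc, hFF', one_mul]
  set P : Matrix (Fin n) (Fin n) B :=
    Matrix.of fun a b => Ring.inverse (G.D a) * Q a b * G.D b with hP
  have hPlow : ∀ a b, a < b → P a b = 0 := fun a b h => by simp [hP, hQlow a b h]
  have hDP : ∀ a b, G.D a * P a b = Q a b * G.D b := fun a b => by
    simp only [hP, Matrix.of_apply, ← mul_assoc, Ring.mul_inverse_cancel _ (hu a), one_mul]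
  have hEP : G.E * K = P * G.E := by
    have h1 : Matrix.diagonal G.D * P = Q * Matrix.diagonal G.D := by
      refine Matrix.ext fun a b => ?_
      rw [Matrix.diagonal_mul, Matrix.mul_diagonal, hDP]
    have h2 : Matrix.diagonal G.D * (G.E * K) = Matrix.diagonal G.D * (P * G.E) := by
      calc Matrix.diagonal G.D * (G.E * K)
          = F' * (G.F * Matrix.diagonal G.D * G.E * K) := by
            simp only [← mul_assoc, hF'F, one_mul]
        _ = F' * (K * (G.F * Matrix.diagonal G.D * G.E)) := by rw [← hG.eq_mul, hKT]
        _ = Q * Matrix.diagonal G.D * G.E := by simp only [hQ, mul_assoc]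
        _ = _ := by rw [← h1, mul_assoc]
    refine Matrix.ext fun a b => (hu a).mul_left_cancel ?_
    have := congr_fun (congr_fun h2 a) b
    rwa [Matrix.diagonal_mul, Matrix.diagonal_mul] at this
  have hent : ∀ a b, (P * G.E) a b = G.E a b * c - if b = j then G.E a j' else 0 := by
    intro a b; rw [← hEP, happK]
  -- Below the diagonal P agrees with K: the only entry of K there is on the first subdiagonal, and
  -- conjugation by an upper unitriangular matrix moves it only to the diagonal and above.
  have hPoff : ∀ b a, b < a → P a b = if a = j' ∧ b = j then -1 else 0 := by
    intro b
    induction b using WellFoundedLT.induction with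
    | _ b ih =>
      intro a hab
      have h1 : (P * G.E) a b = P a b := by
        rw [Matrix.mul_apply, sum_eq_diag (i := b), hG.E_diag, mul_one]
        intro m hm
        rcases lt_or_gt_of_ne hm with h | h
        · rw [ih m h a (h.trans hab), if_neg, zero_mul]
          rintro ⟨rfl, rfl⟩
          have h1 := Fin.lt_def.1 h
          have h2 := Fin.lt_def.1 hab
          omega
        · rw [hG.E_lower _ _ h, mul_zero]
      rw [← h1, hent, hG.E_lower _ _ hab, zero_mul, zero_sub]
      by_cases hb : b = j
      · subst hb
        by_cases ha : a = j'
        · subst ha; simp [hG.E_diag]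
        · have : j' < a := by
            have := Fin.lt_def.1 hab
            have h3 : (a : ℕ) ≠ j' := fun h => ha (Fin.ext h)
            exact Fin.lt_def.2 (by omega)
          simp [ha, hG.E_lower _ _ this]
      · simp [hb]
  have hPE : ∀ a b, (P * G.E) a b = P a a * G.E a b - if a = j' then G.E j b else 0 := by
    intro a b
    have hsplit : ∀ m, P a m * G.E m b = (if m = a then P a a * G.E a b else 0) +
        (if m = j then -(if a = j' then G.E j b else 0) else 0) := by
      intro m
      rcases lt_trichotomy m a with h | rfl | h
      · rw [hPoff m a h, if_neg h.ne, zero_add]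
        by_cases h1 : m = j
        · subst h1; by_cases h2 : a = j' <;> simp [h2]
        · simp [h1]
      · rw [if_pos rfl]
        by_cases h1 : m = j
        · have h2 : m ≠ j' := by rw [h1]; exact hjj.ne
          simp [h2]
        · simp [h1]
      · rw [hPlow _ _ h, zero_mul, if_neg h.ne', zero_add]
        by_cases h1 : m = j
        · have h2 : a ≠ j' := by
            rintro rfl; rw [h1] at h; exact absurd h (not_lt.2 hjj.le)
          simp [h2]
        · simp [h1]
    rw [Matrix.mul_apply, Finset.sum_congr rfl fun m _ => hsplit m, Finset.sum_add_distrib]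
    simp [sub_eq_add_neg]
  have hPdiag : ∀ a, P a a = c - ((if a = j then G.E j j' else 0) -
      (if a = j' then G.E j j' else 0)) := by
    intro a
    have h1 := (hPE a a).symm.trans (hent a a)
    rw [hG.E_diag, mul_one, one_mul, sub_eq_iff_eq_add] at h1
    rw [h1]
    by_cases ha : a = j
    · subst ha; simp [hjj.ne]
    · by_cases ha' : a = j'
      · subst ha'; simp [hjj.ne']
      · simp [ha, ha']
  have hQdiag : ∀ a, Q a a = c := by
    intro a
    have h1 : (G.F * Q) a a = Q a a := by
      rw [Matrix.mul_apply, sum_eq_diag (i := a), hG.F_diag, one_mul]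
      intro m hm
      rcases lt_or_gt_of_ne hm with h | h
      · rw [hQlow _ _ h, mul_zero]
      · rw [hG.F_upper _ _ h, zero_mul]
    rw [← h1, ← hFQ, hKapp, hG.F_diag, mul_one]
    by_cases ha : a = j'
    · subst ha; simp [hG.F_upper _ _ hjj]
    · simp [ha]
  have hQoff : ∀ a b, b < a →
      Q a b = if a = j' ∧ b = j then -(G.D j' * Ring.inverse (G.D j)) else 0 := by
    intro a b hab
    have h1 : Q a b = G.D a * P a b * Ring.inverse (G.D b) := by
      rw [hDP, mul_assoc, Ring.mul_inverse_cancel _ (hu b), mul_one]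
    rw [h1, hPoff b a hab]
    by_cases h : a = j' ∧ b = j
    · obtain ⟨rfl, rfl⟩ := h; simp
    · simp [h]
  refine ⟨fun a => ?_, fun a b => ?_, fun a b => ?_⟩
  · have h1 := hDP a a
    rw [hQdiag, hPdiag] at h1
    rw [← h1]
    by_cases ha : a = j
    · subst ha; simp [hjj.ne, mul_sub]
    · by_cases ha' : a = j'
      · subst ha'; simp [hjj.ne', mul_add]
      · simp [ha, ha']
  · have h1 := (hPE a b).symm.trans (hent a b)
    rw [eq_sub_iff_add_eq] at h1
    rw [← h1, hPdiag]
    noncomm_ring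
  · have hsplit : ∀ m, G.F a m * Q m b = (if m = b then G.F a b * c else 0) +
        (if m = j' then -(if b = j then G.F a j' * G.D j' * Ring.inverse (G.D j) else 0) else 0) := by
      intro m
      rcases lt_trichotomy b m with h | rfl | h
      · rw [hQoff m b h, if_neg h.ne', zero_add]
        by_cases h1 : m = j'
        · subst h1; by_cases h2 : b = j <;> simp [h2, mul_assoc]
        · simp [h1]
      · rw [if_pos rfl, hQdiag]
        by_cases h1 : b = j'
        · have h2 : b ≠ j := by rw [h1]; exact hjj.ne'
          simp [h2]
        · simp [h1]
      · rw [hQlow _ _ h, mul_zero, if_neg h.ne, zero_add]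
        by_cases h1 : m = j'
        · have h2 : b ≠ j := by
            rintro rfl; rw [h1] at h; exact absurd h (not_lt.2 hjj.le)
          simp [h2]
        · simp [h1]
    have h1 := (hKapp G.F a b).symm.trans (congr_fun (congr_fun hFQ a) b)
    rw [Matrix.mul_apply, Finset.sum_congr rfl fun m _ => hsplit m, Finset.sum_add_distrib] at h1
    simp only [Finset.sum_ite_eq', Finset.mem_univ, if_true] at h1
    rw [sub_eq_iff_eq_add] at h1
    rw [h1]; abel

end Covariance

/-! ### Drinfeld's relations from those of lowest degree -/

section Shift

attribute [local instance] LieRing.ofAssociativeRing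

variable {A : Type*} [Ring A]

theorem lie_mul_ring (x y z : A) : ⁅x, y * z⁆ = ⁅x, y⁆ * z + y * ⁅x, z⁆ := by
  simp only [Ring.lie_def]; noncomm_ring

theorem mul_lie_ring (x y z : A) : ⁅x * y, z⁆ = x * ⁅y, z⁆ + ⁅x, z⁆ * y := by
  simp only [Ring.lie_def]; noncomm_ring

theorem lie_finset_sum {ι : Type*} (x : A) (s : Finset ι) (f : ι → A) :
    ⁅x, ∑ i ∈ s, f i⁆ = ∑ i ∈ s, ⁅x, f i⁆ := by
  simp only [Ring.lie_def, Finset.mul_sum, Finset.sum_mul, Finset.sum_sub_distrib]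

variable [Algebra ℂ A]

theorem smul_lie_ring (c : ℂ) (x y : A) : ⁅c • x, y⁆ = c • ⁅x, y⁆ := by
  simp only [Ring.lie_def, smul_mul_assoc, mul_smul_comm, smul_sub]

theorem two_torsion_free (x : A) (h : x + x = 0) : x = 0 := by
  have h1 : (2 : ℂ) • x = 0 := by rw [two_smul, h]
  exact (smul_eq_zero.1 h1).resolve_left two_ne_zero

/-- An element whose commutator raises the degree of `E` by one, if `D` acts on `E` with
sign `ε`. -/
def shiftOne (ε : ℂ) (D : ℕ → A) : A :=
  (ε / 2) • ((2 : ℂ) • D 2 - D 1 * D 1 - ε • D 1)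

/-- An element whose commutator raises the degree of `E` by two. -/
def shiftTwo (ε : ℂ) (D : ℕ → A) : A :=
  (ε / 3) • ((3 : ℂ) • D 3 - (3 : ℂ) • (D 1 * D 2) + D 1 * D 1 * D 1 - (3 : ℂ) • shiftOne ε D - D 1)

theorem shiftOne_lie_eq_zero (ε : ℂ) {D : ℕ → A} {x : A} (h : ∀ r, ⁅D r, x⁆ = 0) :
    ⁅shiftOne ε D, x⁆ = 0 := by
  simp only [shiftOne, smul_lie_ring, sub_lie, mul_lie_ring, h]; simp

theorem shiftTwo_lie_eq_zero (ε : ℂ) {D : ℕ → A} {x : A} (h : ∀ r, ⁅D r, x⁆ = 0) :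
    ⁅shiftTwo ε D, x⁆ = 0 := by
  simp only [shiftTwo, smul_lie_ring, sub_lie, add_lie, mul_lie_ring, h, shiftOne_lie_eq_zero ε h]
  simp

variable {ε : ℂ} {D E : ℕ → A}

/-- The combination 2D_2 - D_1² is twice the u⁻²-coefficient of log D(u) for commuting D's. The
logarithm removes the products D·E from the commutator; the term -εD_1 removes the remaining
multiple of E_s. -/
theorem shiftOne_lie (hε : ε * ε = 1) (h1 : ∀ s, 1 ≤ s → ⁅D 1, E s⁆ = ε • E s)
    (h2 : ∀ s, 1 ≤ s → ⁅D 2, E s⁆ = ε • (E (s + 1) + D 1 * E s)) (s : ℕ) (hs : 1 ≤ s) :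
    ⁅shiftOne ε D, E s⁆ = E (s + 1) := by
  have e1 : E s * D 1 = D 1 * E s - ε • E s := by rw [← h1 s hs, Ring.lie_def]; abel
  have key : ⁅(2 : ℂ) • D 2 - D 1 * D 1 - ε • D 1, E s⁆ = (2 * ε) • E (s + 1) := by
    simp only [sub_lie, smul_lie_ring, mul_lie_ring, h1 s hs, h2 s hs, smul_mul_assoc,
      mul_smul_comm, e1, smul_sub, smul_add, smul_smul, hε]
    module
  rw [shiftOne, smul_lie_ring, key, smul_smul, show ε / 2 * (2 * ε) = ε * ε by ring, hε, one_smul]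

/-- The same with 3D_3 - 3D_1D_2 + D_1³, three times the u⁻³-coefficient of log D(u), corrected by
terms whose commutators are multiples of E_{s+1} and E_s. -/
theorem shiftTwo_lie (hε : ε * ε = 1) (h1 : ∀ s, 1 ≤ s → ⁅D 1, E s⁆ = ε • E s)
    (h2 : ∀ s, 1 ≤ s → ⁅D 2, E s⁆ = ε • (E (s + 1) + D 1 * E s))
    (h3 : ∀ s, 1 ≤ s → ⁅D 3, E s⁆ = ε • (E (s + 2) + D 1 * E (s + 1) + D 2 * E s))
    (s : ℕ) (hs : 1 ≤ s) :
    ⁅shiftTwo ε D, E s⁆ = E (s + 2) := by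
  have e1 : ∀ s, 1 ≤ s → E s * D 1 = D 1 * E s - ε • E s := fun s hs => by
    rw [← h1 s hs, Ring.lie_def]; abel
  have e2 : E s * D 2 = D 2 * E s - ε • (E (s + 1) + D 1 * E s) := by
    rw [← h2 s hs, Ring.lie_def]; abel
  have k1 : ⁅D 1 * D 2, E s⁆ =
      ε • (D 1 * E (s + 1) + D 1 * (D 1 * E s)) + ε • (D 2 * E s) - (E (s + 1) + D 1 * E s) := by
    rw [mul_lie_ring, h1 s hs, h2 s hs, smul_mul_assoc, e2, mul_smul_comm, mul_add, smul_sub,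
      smul_smul, hε, one_smul]
    abel
  have k2 : ⁅D 1 * D 1 * D 1, E s⁆ =
      (3 * ε) • (D 1 * (D 1 * E s)) - (3 : ℂ) • (D 1 * E s) + ε • E s := by
    have f1 : ⁅D 1 * D 1, E s⁆ = (2 * ε) • (D 1 * E s) - E s := by
      rw [mul_lie_ring, h1 s hs, smul_mul_assoc, e1 s hs, mul_smul_comm, smul_sub, smul_smul, hε]
      module
    rw [mul_lie_ring, f1, h1 s hs, sub_mul, smul_mul_assoc, mul_assoc, mul_assoc, e1 s hs, mul_sub,
      mul_smul_comm, mul_smul_comm, smul_sub, smul_smul, mul_assoc 2 ε ε, hε]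
    module
  have key : ⁅(3 : ℂ) • D 3 - (3 : ℂ) • (D 1 * D 2) + D 1 * D 1 * D 1 - (3 : ℂ) • shiftOne ε D - D 1,
      E s⁆ = (3 * ε) • E (s + 2) := by
    rw [sub_lie, sub_lie, add_lie, sub_lie, smul_lie_ring, smul_lie_ring, smul_lie_ring,
      shiftOne_lie hε h1 h2 s hs, k1, k2, h1 s hs, h3 s hs]
    module
  rw [shiftTwo, smul_lie_ring, key, smul_smul, show ε / 3 * (3 * ε) = ε * ε by ring, hε, one_smul]

end Shift

/-! ### Propagation of the relations from lowest degree -/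

section HalfSeed

attribute [local instance] LieRing.ofAssociativeRing

variable {A : Type*} [Ring A]

/-- The relations among the `D_i^{(r)}` and `E_j^{(s)}` of lowest degree, from which all the others
follow. -/
structure IsHalfSeed {n : ℕ} (D : Fin n → ℕ → A) (E : Fin (n - 1) → ℕ → A) : Prop where
  D_zero : ∀ i, D i 0 = 1
  D_D : ∀ i j r s, ⁅D i r, D j s⁆ = 0
  D_E_lo : ∀ j r s, 1 ≤ s →
    ⁅D (lo j) r, E j s⁆ = ∑ t ∈ Finset.range r, D (lo j) t * E j (r + s - 1 - t)
  D_E_one : ∀ i j r, ⁅D i r, E j 1⁆ =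
    (delta i (lo j) - delta i (hi j)) • ∑ t ∈ Finset.range r, D i t * E j (r + 1 - 1 - t)
  E_E_self : ∀ j s, 1 ≤ s → ⁅E j 1, E j s⁆ = ∑ t ∈ Finset.Icc 1 (s - 1), E j t * E j (s - t)
  E_E_far : ∀ i j : Fin (n - 1), 1 < |(i : ℤ) - (j : ℤ)| → ⁅E i 1, E j 1⁆ = 0
  E_E_next : ∀ i j : Fin (n - 1), (j : ℕ) = i + 1 →
    ⁅E i 1, E j 2⁆ - ⁅E i 2, E j 1⁆ = -(E i 1 * E j 1)
  serre : ∀ i j : Fin (n - 1), |(i : ℤ) - (j : ℤ)| = 1 → ⁅E i 1, ⁅E i 1, E j 1⁆⁆ = 0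

theorem sum_Icc_one {M : Type*} [AddCommMonoid M] (f : ℕ → M) (m : ℕ) :
    ∑ t ∈ Finset.Icc 1 m, f t = ∑ t ∈ Finset.range m, f (t + 1) := by
  rw [Finset.range_eq_Ico, Finset.sum_Ico_add' f 0 m 1]
  rfl

/-- If an operator of the form `⁅h, ·⁆` moves `f r` to `f (r + 1)`, then `f` vanishes when its
first term does. -/
theorem eq_zero_of_shift {f : ℕ → A} {h : A} (h1 : f 1 = 0)
    (hs : ∀ r, 1 ≤ r → ⁅h, f r⁆ = f (r + 1)) (r : ℕ) (hr : 1 ≤ r) : f r = 0 := by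
  induction r, hr using Nat.le_induction with
  | base => exact h1
  | succ r hr ih => rw [← hs r hr, ih, lie_zero]

theorem lo_ne_hi {n : ℕ} (j : Fin (n - 1)) : lo j ≠ hi j := by
  intro h; have := congrArg Fin.val h; simp [lo, hi] at this

/-- `D_a` acts on `E_i` with sign `ε`. -/
def IsShift (D E : ℕ → A) (ε : ℤ) : Prop :=
  (ε = 1 ∨ ε = -1) ∧ ∀ r s, 1 ≤ s →
    ⁅D r, E s⁆ = ε • ∑ t ∈ Finset.range r, D t * E (r + s - 1 - t)

theorem IsHalfSeed.isShift_lo {n : ℕ} {D : Fin n → ℕ → A} {E : Fin (n - 1) → ℕ → A}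
    (H : IsHalfSeed D E) (j : Fin (n - 1)) : IsShift (D (lo j)) (E j) 1 :=
  ⟨Or.inl rfl, fun r s hs => by rw [H.D_E_lo j r s hs, one_smul]⟩

variable [Algebra ℂ A]

theorem IsShift.exists_shift {D E : ℕ → A} {ε : ℤ} (h : IsShift D E ε) (h0 : D 0 = 1) :
    (∀ s, 1 ≤ s → ⁅shiftOne ε D, E s⁆ = E (s + 1)) ∧
    ∀ s, 1 ≤ s → ⁅shiftTwo ε D, E s⁆ = E (s + 2) := by
  obtain ⟨hε, h⟩ := h
  have hε2 : (ε : ℂ) * ε = 1 := by rcases hε with rfl | rfl <;> norm_num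
  have h1 : ∀ s, 1 ≤ s → ⁅D 1, E s⁆ = (ε : ℂ) • E s := fun s hs => by
    rw [h 1 s hs, Int.cast_smul_eq_zsmul]; simp [h0]
  have h2 : ∀ s, 1 ≤ s → ⁅D 2, E s⁆ = (ε : ℂ) • (E (s + 1) + D 1 * E s) := fun s hs => by
    rw [h 2 s hs, Int.cast_smul_eq_zsmul, Finset.sum_range_succ, Finset.sum_range_one, h0, one_mul,
      show 2 + s - 1 - 0 = s + 1 by omega, show 2 + s - 1 - 1 = s by omega]
  have h3 : ∀ s, 1 ≤ s → ⁅D 3, E s⁆ = (ε : ℂ) • (E (s + 2) + D 1 * E (s + 1) + D 2 * E s) :=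
    fun s hs => by
      rw [h 3 s hs, Int.cast_smul_eq_zsmul, Finset.sum_range_succ, Finset.sum_range_succ,
        Finset.sum_range_one, h0, one_mul, show 3 + s - 1 - 0 = s + 2 by omega,
        show 3 + s - 1 - 1 = s + 1 by omega, show 3 + s - 1 - 2 = s by omega]
  exact ⟨shiftOne_lie hε2 h1 h2, shiftTwo_lie hε2 h1 h2 h3⟩

namespace IsHalfSeed

variable {n : ℕ} {D : Fin n → ℕ → A} {E : Fin (n - 1) → ℕ → A} (H : IsHalfSeed D E)
include H

theorem shift_lo (j : Fin (n - 1)) (s : ℕ) (hs : 1 ≤ s) :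
    ⁅shiftOne ((1 : ℤ) : ℂ) (D (lo j)), E j s⁆ = E j (s + 1) :=
  ((H.isShift_lo j).exists_shift (H.D_zero _)).1 s hs

/-- The shift element built from D_{lo j} commutes with every D, so bracketing with it moves the
case s to the case s + 1. -/
theorem D_E (i : Fin n) (j : Fin (n - 1)) (r s : ℕ) (hs : 1 ≤ s) : ⁅D i r, E j s⁆ =
    (delta i (lo j) - delta i (hi j)) • ∑ t ∈ Finset.range r, D i t * E j (r + s - 1 - t) := by
  have hc : ∀ r, ⁅shiftOne ((1 : ℤ) : ℂ) (D (lo j)), D i r⁆ = 0 := fun r =>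
    shiftOne_lie_eq_zero _ fun t => H.D_D _ _ _ _
  induction s, hs using Nat.le_induction with
  | base => exact H.D_E_one i j r
  | succ s hs ih =>
    have := leibniz_lie (shiftOne ((1 : ℤ) : ℂ) (D (lo j))) (D i r) (E j s)
    rw [hc, zero_lie, zero_add, H.shift_lo j s hs, ih, lie_zsmul, lie_finset_sum] at this
    rw [← this]
    congr 1
    refine Finset.sum_congr rfl fun t ht => ?_
    have ht := Finset.mem_range.1 ht
    rw [lie_mul_ring, hc, zero_mul, zero_add, H.shift_lo j _ (by omega)]
    congr 2; omega

theorem isShift_hi (j : Fin (n - 1)) : IsShift (D (hi j)) (E j) (-1) :=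
  ⟨Or.inr rfl, fun r s hs => by rw [H.D_E _ j r s hs]; simp [delta, (lo_ne_hi j).symm]⟩

/-- For `i ≠ j` some `D_a` acts on `E_i` and has nothing to do with `E_j`. -/
theorem exists_isShift {i j : Fin (n - 1)} (hij : i ≠ j) :
    ∃ (a : Fin n) (ε : ℤ), a ≠ lo j ∧ a ≠ hi j ∧ IsShift (D a) (E i) ε := by
  have h0 : (i : ℕ) ≠ j := fun h => hij (Fin.ext h)
  by_cases h : (i : ℕ) = j + 1
  · refine ⟨hi i, -1, ?_, ?_, H.isShift_hi i⟩ <;> intro h' <;> have := congrArg Fin.val h' <;>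
      simp only [lo, hi] at this <;> omega
  · refine ⟨lo i, 1, ?_, ?_, H.isShift_lo i⟩ <;> intro h' <;> have := congrArg Fin.val h' <;>
      simp only [lo, hi] at this <;> omega

theorem D_E_eq_zero {a : Fin n} {j : Fin (n - 1)} (h1 : a ≠ lo j) (h2 : a ≠ hi j) (r s : ℕ)
    (hs : 1 ≤ s) : ⁅D a r, E j s⁆ = 0 := by
  rw [H.D_E _ _ _ _ hs]; simp [delta, h1, h2]

theorem exists_shift {i j : Fin (n - 1)} (hij : i ≠ j) : ∃ h k : A,
    (∀ s, 1 ≤ s → ⁅h, E i s⁆ = E i (s + 1)) ∧ (∀ s, 1 ≤ s → ⁅k, E i s⁆ = E i (s + 2)) ∧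
    (∀ s, 1 ≤ s → ⁅h, E j s⁆ = 0) ∧ ∀ s, 1 ≤ s → ⁅k, E j s⁆ = 0 := by
  obtain ⟨a, ε, h1, h2, h3⟩ := H.exists_isShift hij
  obtain ⟨h4, h5⟩ := h3.exists_shift (H.D_zero a)
  exact ⟨_, _, h4, h5, fun s hs => shiftOne_lie_eq_zero _ fun r => H.D_E_eq_zero h1 h2 r s hs,
    fun s hs => shiftTwo_lie_eq_zero _ fun r => H.D_E_eq_zero h1 h2 r s hs⟩

theorem E_E (j : Fin (n - 1)) (r s : ℕ) (hr : 1 ≤ r) (hs : 1 ≤ s) : ⁅E j r, E j s⁆ =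
    ∑ t ∈ Finset.Icc 1 (s - 1), E j t * E j (r + s - 1 - t)
      - ∑ t ∈ Finset.Icc 1 (r - 1), E j t * E j (r + s - 1 - t) := by
  set h := shiftOne ((1 : ℤ) : ℂ) (D (lo j))
  have hsh : ∀ s, 1 ≤ s → ⁅h, E j s⁆ = E j (s + 1) := H.shift_lo j
  -- Shifting the left factors gives the products with t from 2 to p + 1, shifting the right ones
  -- those from 1 to p; the added product supplies the missing t = 1. It cancels between the two
  -- sums of the relation.
  have key : ∀ m p : ℕ, p < m → ⁅h, ∑ t ∈ Finset.Icc 1 p, E j t * E j (m - t)⁆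
      + E j 1 * E j (m + 1 - 1) =
      ∑ t ∈ Finset.Icc 1 (p + 1), E j t * E j (m + 1 - t)
        + ∑ t ∈ Finset.Icc 1 p, E j t * E j (m + 1 - t) := by
    intro m p hp
    rw [lie_finset_sum, sum_Icc_one, sum_Icc_one, sum_Icc_one, Finset.sum_range_succ',
      add_right_comm, ← Finset.sum_add_distrib]
    congr 1
    refine Finset.sum_congr rfl fun t ht => ?_
    have ht := Finset.mem_range.1 ht
    rw [lie_mul_ring, hsh _ (by omega), hsh _ (by omega)]
    congr 3 <;> omega
  induction r, hr using Nat.le_induction generalizing s with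
  | base =>
    rw [H.E_E_self j s hs]; simp
  | succ r hr ih =>
    have hj := leibniz_lie h (E j r) (E j s)
    rw [hsh r hr, hsh s hs, ih s hs, ih (s + 1) (by omega), lie_sub] at hj
    have k1 := key (r + s - 1) (s - 1) (by omega)
    have k2 := key (r + s - 1) (r - 1) (by omega)
    simp only [show s - 1 + 1 = s by omega, show r - 1 + 1 = r by omega, Nat.add_sub_cancel,
      show r + s - 1 + 1 = r + s by omega, show r + 1 + s - 1 = r + s by omega,
      show r + (s + 1) - 1 = r + s by omega] at k1 k2 hj ⊢
    linear_combination (norm := abel) k1 - k2 - hj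

theorem E_E_far' (i j : Fin (n - 1)) (hij : 1 < |(i : ℤ) - (j : ℤ)|) (r s : ℕ) (hr : 1 ≤ r)
    (hs : 1 ≤ s) : ⁅E i r, E j s⁆ = 0 := by
  have hne : i ≠ j := by rintro rfl; simp at hij
  obtain ⟨h, -, h1, -, h2, -⟩ := H.exists_shift hne
  obtain ⟨k, -, k1, -, k2, -⟩ := H.exists_shift hne.symm
  refine eq_zero_of_shift (f := fun r => ⁅E i r, E j s⁆) (h := h) ?_ (fun r hr => ?_) r hr
  · refine eq_zero_of_shift (f := fun s => ⁅E i 1, E j s⁆) (h := k) (H.E_E_far i j hij)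
      (fun s hs => ?_) s hs
    rw [leibniz_lie, k1 s hs, k2 1 le_rfl, zero_lie, zero_add]
  · rw [leibniz_lie, h1 r hr, h2 s hs, lie_zero, add_zero]

theorem E_E_next' (i j : Fin (n - 1)) (hij : (j : ℕ) = i + 1) (r s : ℕ) (hr : 1 ≤ r)
    (hs : 1 ≤ s) : ⁅E i r, E j (s + 1)⁆ - ⁅E i (r + 1), E j s⁆ = -(E i r * E j s) := by
  have hne : i ≠ j := by rintro rfl; omega
  obtain ⟨h, -, h1, -, h2, -⟩ := H.exists_shift hne
  obtain ⟨k, -, k1, -, k2, -⟩ := H.exists_shift hne.symm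
  rw [← sub_eq_zero, sub_neg_eq_add]
  refine eq_zero_of_shift (f := fun r => ⁅E i r, E j (s + 1)⁆ - ⁅E i (r + 1), E j s⁆ + E i r * E j s)
    (h := h) ?_ (fun r hr => ?_) r hr
  · refine eq_zero_of_shift
      (f := fun s => ⁅E i 1, E j (s + 1)⁆ - ⁅E i (1 + 1), E j s⁆ + E i 1 * E j s) (h := k) ?_
      (fun s hs => ?_) s hs
    · rw [← sub_neg_eq_add, sub_eq_zero]; exact H.E_E_next i j hij
    · rw [lie_add, lie_sub, leibniz_lie, leibniz_lie k (E i (1 + 1)), lie_mul_ring, k1 s hs,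
        k1 (s + 1) (by omega), k2 1 le_rfl, k2 (1 + 1) (by omega)]
      simp only [zero_lie, zero_mul, zero_add]
  · rw [lie_add, lie_sub, leibniz_lie, leibniz_lie h (E i (r + 1)), lie_mul_ring, h1 r hr,
        h1 (r + 1) (by omega), h2 s hs, h2 (s + 1) (by omega)]
    simp only [lie_zero, mul_zero, add_zero]

/-- With t fixed, the Serre expression S(r, s) is symmetric, and vanishing of S(r, s) gives S(r+1,
s) + S(r, s+1) = 0 and S(r+2, s) + S(r, s+2) = 0 by the shifts of degree one and two. The first
alone leaves even r + s undecided; both together allow induction on r + s. -/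
theorem serre' (i j : Fin (n - 1)) (hij : |(i : ℤ) - (j : ℤ)| = 1) (r s t : ℕ)
    (hr : 1 ≤ r) (hs : 1 ≤ s) (ht : 1 ≤ t) :
    ⁅E i r, ⁅E i s, E j t⁆⁆ + ⁅E i s, ⁅E i r, E j t⁆⁆ = 0 := by
  have hne : i ≠ j := by rintro rfl; simp at hij
  obtain ⟨h, h', h1, h1', h2, h2'⟩ := H.exists_shift hne
  obtain ⟨k, -, k1, -, k2, -⟩ := H.exists_shift hne.symm
  set S : ℕ → ℕ → A := fun r s => ⁅E i r, ⁅E i s, E j t⁆⁆ + ⁅E i s, ⁅E i r, E j t⁆⁆ with hS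
  have S11 : S 1 1 = 0 := by
    refine eq_zero_of_shift (h := k)
      (f := fun t => ⁅E i 1, ⁅E i 1, E j t⁆⁆ + ⁅E i 1, ⁅E i 1, E j t⁆⁆) ?_ (fun t ht => ?_) t ht
    · simp only [H.serre i j hij, add_zero]
    · simp only [lie_add, leibniz_lie k, k2 1 le_rfl, k1 t ht, zero_lie, zero_add]
  have Ssymm : ∀ r s, S r s = S s r := fun r s => add_comm _ _
  have S1 : ∀ r s, 1 ≤ r → 1 ≤ s → ⁅h, S r s⁆ = S (r + 1) s + S r (s + 1) := fun r s hr hs => by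
    simp only [hS, lie_add, leibniz_lie h, h1 r hr, h1 s hs, h2 t ht, lie_zero, add_zero]
    abel
  have S2 : ∀ r s, 1 ≤ r → 1 ≤ s → ⁅h', S r s⁆ = S (r + 2) s + S r (s + 2) := fun r s hr hs => by
    simp only [hS, lie_add, leibniz_lie h', h1' r hr, h1' s hs, h2' t ht, lie_zero, add_zero]
    abel
  have main : ∀ N r s, 1 ≤ r → 1 ≤ s → r + s = N → S r s = 0 := by
    intro N
    induction N using Nat.strong_induction_on with
    | _ N ih =>
      -- Two shifts by one give S(r+2, s) = -S(r+1, s+1) = S(r, s+2), while one shift by two makes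
      -- the sum of the outer terms zero.
      have big : ∀ r s, 1 ≤ r → 1 ≤ s → r + 2 + s = N → S (r + 2) s = 0 := by
        intro r s hr hs hN
        have e1 := S2 r s hr hs
        have e2 := S1 (r + 1) s (by omega) hs
        have e3 := S1 r (s + 1) hr (by omega)
        rw [ih (r + s) (by omega) r s hr hs rfl, lie_zero] at e1
        rw [ih (r + 1 + s) (by omega) (r + 1) s (by omega) hs rfl, lie_zero] at e2
        rw [ih (r + (s + 1)) (by omega) r (s + 1) hr (by omega) rfl, lie_zero] at e3
        apply two_torsion_free
        have e4 : S (r + 2) s = S r (s + 2) :=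
          (eq_neg_of_add_eq_zero_left e2.symm).trans (eq_neg_of_add_eq_zero_right e3.symm).symm
        nth_rewrite 2 [e4]
        exact e1.symm
      intro r s hr hs hN
      by_cases h3 : 3 ≤ r
      · obtain ⟨r, rfl⟩ := Nat.exists_eq_add_of_le' h3
        exact big (r + 1) s (by omega) hs (by omega)
      by_cases h3' : 3 ≤ s
      · obtain ⟨s, rfl⟩ := Nat.exists_eq_add_of_le' h3'
        rw [Ssymm]
        exact big (s + 1) r (by omega) hr (by omega)
      have S12 : 3 ≤ N → S 2 1 = 0 := fun h3 => by
        have e := S1 1 1 le_rfl le_rfl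
        rw [S11, lie_zero, Ssymm 1] at e
        exact two_torsion_free _ e.symm
      have hr' : r = 1 ∨ r = 2 := by omega
      have hs' : s = 1 ∨ s = 2 := by omega
      rcases hr' with rfl | rfl <;> rcases hs' with rfl | rfl
      · exact S11
      · rw [Ssymm]; exact S12 (by omega)
      · exact S12 (by omega)
      · have e := S1 1 2 le_rfl (by omega)
        rw [ih 3 (by omega) 1 2 le_rfl (by omega) rfl, lie_zero, Ssymm 1,
          big 1 1 le_rfl le_rfl (by omega), add_zero] at e
        exact e.symm
  exact main _ r s hr hs rfl

end IsHalfSeed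

end HalfSeed

/-! ### Drinfeld's relations for the Gauss factors of a solution of the RTT equation -/

section GaussDrinfeld

attribute [local instance] LieRing.ofAssociativeRing

open PowerSeries

variable {A : Type*} [Ring A]

/-- The relation with r = 0, where T^{(0)} is the identity matrix: the degree-one coefficients
represent gl_n. -/
theorem IsRTT.lie_one {ι : Type*} [DecidableEq ι] {T : ι → ι → ℕ → A} (hT : IsRTT T) (a b : ι)
    (r : ℕ) : ActsAsUnit (T a b 1) a b (fun i j => T i j r) := by
  intro i j
  have h := hT.rel a b i j 0 r
  have h0 : ⁅T a b 0, T i j (r + 1)⁆ = 0 := by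
    rw [hT.zero]; split_ifs <;> simp [Ring.lie_def]
  rw [h0, sub_zero] at h
  rw [h, hT.zero, hT.zero]
  simp only [ite_mul, mul_ite, one_mul, zero_mul, mul_one, mul_zero, eq_comm]

theorem coeff_mul_of_constantCoeff_eq_zero {f g : PowerSeries A} (hg : constantCoeff g = 0)
    (r : ℕ) : coeff r (f * g) = ∑ t ∈ Finset.range r, coeff t f * coeff (r - t) g := by
  rw [coeff_mul, Finset.Nat.sum_antidiagonal_eq_sum_range_succ_mk, Finset.sum_range_succ]
  simp [hg]

theorem coeff_lie_C (c : A) (f : PowerSeries A) (r : ℕ) :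
    coeff r (C c * f - f * C c) = ⁅c, coeff r f⁆ := by
  rw [map_sub, coeff_C_mul, coeff_mul_C, Ring.lie_def]

variable {n : ℕ} {T : Fin n → Fin n → ℕ → A} {G : GaussFactors n (PowerSeries A)}
  (hT : IsRTT T) (hG : G.IsFactorizationOf (seriesMatrix T))

include hT hG

theorem gauss_covariance_coeff {j j' : Fin n} (hj : (j' : ℕ) = j + 1) :
    (∀ a r, ⁅T j j' 1, coeff r (G.D a)⁆ =
      coeff r ((if a = j' then G.D a * G.E j j' else 0) -
        (if a = j then G.D a * G.E j j' else 0))) ∧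
    (∀ a b r, ⁅T j j' 1, coeff r (G.E a b)⁆ =
      coeff r (((if a = j then G.E j j' else 0) - (if a = j' then G.E j j' else 0)) * G.E a b +
        (if a = j' then G.E j b else 0) - (if b = j then G.E a j' else 0))) ∧
    (∀ a b r, ⁅T j j' 1, coeff r (G.F a b)⁆ =
      coeff r ((if a = j' then G.F j b else 0) -
        (if b = j then G.F a j' * G.D j' * Ring.inverse (G.D j) else 0))) := by
  obtain ⟨h1, h2, h3⟩ := gauss_covariance (c := C (T j j' 1)) hj hG (hG.isUnit_D hT)
    (fun k l => by
      ext r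
      have := hT.lie_one j j' r k l
      rw [coeff_lie_C, coeff_seriesMatrix, this, map_sub]
      congr 1 <;> split_ifs <;> simp)
  refine ⟨fun a r => ?_, fun a b r => ?_, fun a b r => ?_⟩
  · rw [← h1, coeff_lie_C]
  · rw [← h2, coeff_lie_C]
  · rw [← h3, coeff_lie_C]

theorem T_lo_hi (j : Fin (n - 1)) : T (lo j) (hi j) 1 = G.coeffE j 1 := by
  have h := hG.coeff_one hT.constantCoeff (lo j) (hi j)
  rwa [coeff_seriesMatrix, if_neg (lo_ne_hi j), hG.F_upper _ _ (Fin.lt_def.2 (by simp [lo, hi])),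
    map_zero, zero_add, zero_add] at h

theorem T_hi_lo (j : Fin (n - 1)) : T (hi j) (lo j) 1 = G.coeffF j 1 := by
  have h := hG.coeff_one hT.constantCoeff (hi j) (lo j)
  rwa [coeff_seriesMatrix, if_neg (lo_ne_hi j).symm,
    hG.E_lower _ _ (Fin.lt_def.2 (by simp [lo, hi])), map_zero, add_zero, add_zero] at h

theorem constantCoeff_E {i j : Fin n} (hij : i ≠ j) : constantCoeff (G.E i j) = 0 := by
  rw [(hG.constantCoeff_eq_one hT.constantCoeff).2, if_neg hij]

theorem coeffE_one_lie (j : Fin (n - 1)) (a b : Fin n) (r : ℕ) :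
    ⁅G.coeffE j 1, coeff r (G.E a b)⁆ =
      coeff r (((if a = lo j then G.E (lo j) (hi j) else 0) -
          (if a = hi j then G.E (lo j) (hi j) else 0)) * G.E a b +
        (if a = hi j then G.E (lo j) b else 0) - (if b = lo j then G.E a (hi j) else 0)) := by
  rw [← T_lo_hi hT hG]
  exact (gauss_covariance_coeff hT hG (j := lo j) (j' := hi j) rfl).2.1 a b r

variable [Algebra ℂ A]

/-- Schur complements supply the D–D relations and those of D_{lo j} with E_j; everything involving
E_i^{(1)} is the covariance of the Gauss factors under a simple root vector. -/
theorem isHalfSeed_gauss : IsHalfSeed G.coeffD G.coeffE := by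
  have hj : ∀ j : Fin (n - 1), ((hi j : Fin n) : ℕ) = (lo j : Fin n) + 1 := fun j => rfl
  have hlt : ∀ j : Fin (n - 1), lo j < hi j := fun j => Fin.lt_def.2 (by simp [lo, hi])
  have hc := fun j => constantCoeff_E hT hG (lo_ne_hi j)
  have hlo : ∀ i j : Fin (n - 1), lo i = lo j ↔ (i : ℕ) = j := fun i j => by simp [Fin.ext_iff, lo]
  have hlohi : ∀ i j : Fin (n - 1), lo i = hi j ↔ (i : ℕ) = j + 1 := fun i j => by
    simp [Fin.ext_iff, lo, hi]
  have hhilo : ∀ i j : Fin (n - 1), hi i = lo j ↔ (j : ℕ) = i + 1 := fun i j => by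
    simp only [Fin.ext_iff, lo, hi]; exact eq_comm
  have hlie := coeffE_one_lie hT hG
  -- Both neighbours are expressed by the entry of E(u) two above the diagonal; in the relation of
  -- E_i and E_{i+1} it cancels and the quadratic term remains.
  have next : ∀ (i j : Fin (n - 1)) (r : ℕ), (j : ℕ) = i + 1 → ⁅G.coeffE i 1, G.coeffE j r⁆ =
      coeff r (G.E (lo i) (hi j)) - coeff r (G.E (lo i) (hi i) * G.E (lo j) (hi j)) :=
    fun i j r hij => by
      rw [show G.coeffE j r = coeff r (G.E (lo j) (hi j)) from rfl, hlie]
      simp only [hlo, hlohi, hhilo]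
      rw [if_neg (by omega), if_pos (by omega), if_pos (by omega), if_neg (by omega)]
      simp only [zero_sub, neg_mul, map_add, map_neg, sub_zero]; abel
  have prev : ∀ (i j : Fin (n - 1)) (r : ℕ), (i : ℕ) = j + 1 → ⁅G.coeffE i 1, G.coeffE j r⁆ =
      -coeff r (G.E (lo j) (hi i)) := fun i j r hij => by
    rw [show G.coeffE j r = coeff r (G.E (lo j) (hi j)) from rfl, hlie]
    simp only [hlo, hlohi, hhilo]
    rw [if_neg (by omega), if_neg (by omega), if_neg (by omega), if_pos (by omega)]
    simp
  have hcE : ∀ i j : Fin (n - 1), (i : ℕ) ≤ j → constantCoeff (G.E (lo i) (hi j)) = 0 :=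
    fun i j hij => constantCoeff_E hT hG (by rw [Ne, hlohi]; omega)
  refine ⟨fun i => ?_, fun i j r s => ?_, fun j r s hs => ?_, fun i j r => ?_, fun j s hs => ?_,
    fun i j hij => ?_, fun i j hij => ?_, fun i j hij => ?_⟩
  · rw [GaussFactors.coeffD, coeff_zero_eq_constantCoeff_apply, hG.constantCoeff_D hT.constantCoeff]
  · exact coeff_D_comm hT hG two_torsion_free i j r s
  · exact coeff_D_E hT hG two_torsion_free (hlt j) r s hs
  · rw [← lie_skew, ← T_lo_hi hT hG, GaussFactors.coeffD,
      (gauss_covariance_coeff hT hG (hj j)).1 i r]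
    have h1 := coeff_mul_of_constantCoeff_eq_zero (f := G.D i) (hc j) r
    simp only [delta]
    by_cases h2 : i = lo j
    · subst h2; simpa [lo_ne_hi, GaussFactors.coeffD, GaussFactors.coeffE] using h1
    · by_cases h3 : i = hi j
      · subst h3; simpa [(lo_ne_hi j).symm, GaussFactors.coeffD, GaussFactors.coeffE] using h1
      · simp [h2, h3]
  · rw [show G.coeffE j s = coeff s (G.E (lo j) (hi j)) from rfl, hlie]
    simp only [hlohi, hhilo]
    rw [if_pos trivial, if_neg (by omega), sub_zero, add_zero,
      sub_zero, coeff_mul_of_constantCoeff_eq_zero (hc j), sum_Icc_one]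
    obtain ⟨s, rfl⟩ := Nat.exists_eq_add_of_le' hs
    rw [Nat.add_sub_cancel, Finset.sum_range_succ', coeff_zero_eq_constantCoeff_apply, hc j, zero_mul, add_zero]
    rfl
  · rw [show G.coeffE j 1 = coeff 1 (G.E (lo j) (hi j)) from rfl, hlie]
    have h1 : (i : ℕ) ≠ j ∧ (i : ℕ) ≠ j + 1 ∧ (j : ℕ) ≠ i + 1 := by
      refine ⟨?_, ?_, ?_⟩ <;> intro h <;> simp [h] at hij
    simp only [hlo, hlohi, hhilo]
    rw [if_neg (by omega), if_neg (by omega), if_neg (by omega), if_neg (by omega)]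
    simp
  · rw [next i j 2 hij, ← lie_skew (G.coeffE i 2), prev j i 2 hij, neg_neg,
      coeff_mul_of_constantCoeff_eq_zero (hc j)]
    simp [Finset.sum_range_succ, hc, GaussFactors.coeffE]
  · have h1 : (j : ℕ) = i + 1 ∨ (i : ℕ) = j + 1 := by
      rcases abs_eq (by norm_num : (0 : ℤ) ≤ 1) |>.1 hij with h | h <;> omega
    rcases h1 with h | h
    · rw [next i j 1 h, coeff_one_mul_eq, hc, hc, zero_mul, mul_zero, add_zero, sub_zero, hlie]
      simp only [hlohi, hhilo]
      rw [if_pos trivial, if_neg (by omega), if_neg (by omega), if_neg (by omega), sub_zero, add_zero,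
        sub_zero, coeff_one_mul_eq, hc, hcE i j (by omega), zero_mul, mul_zero, add_zero]
    · rw [prev i j 1 h, lie_neg, hlie]
      simp only [hlo, hlohi, hhilo]
      rw [if_neg (by omega), if_neg (by omega), if_neg (by omega)]
      simp

end GaussDrinfeld

/-! ### The relations of F, by transposition -/

section Opposite

attribute [local instance] LieRing.ofAssociativeRing

open PowerSeries MulOpposite

variable {A : Type*} [Ring A]

theorem op_lie (x y : A) : ⁅op x, op y⁆ = -op ⁅x, y⁆ := by
  simp only [Ring.lie_def, op_sub, op_mul]; abel

/-- The transpose of a solution of the RTT equation solves it over the opposite algebra. -/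
theorem IsRTT.op {ι : Type*} [DecidableEq ι] {T : ι → ι → ℕ → A} (hT : IsRTT T) :
    IsRTT (fun i j r => op (T j i r)) where
  zero i j := by
    rw [hT.zero]
    by_cases h : i = j
    · simp [h]
    · simp [h, Ne.symm h]
  rel i j k l r s := by
    have h := congr_arg MulOpposite.op (hT.rel j i l k r s)
    simp only [op_sub, op_mul] at h
    simp only [op_lie]
    rw [← neg_inj, neg_sub (MulOpposite.op _ * _), ← h]
    abel

/-- The coefficientwise passage to the opposite algebra. -/
def opSeries (f : PowerSeries A) : PowerSeries Aᵐᵒᵖ := PowerSeries.mk fun r => op (coeff r f)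

@[simp] theorem coeff_opSeries (f : PowerSeries A) (r : ℕ) :
    coeff r (opSeries f) = op (coeff r f) := by simp [opSeries]

theorem opSeries_mul (f g : PowerSeries A) : opSeries (f * g) = opSeries g * opSeries f := by
  ext r
  rw [coeff_opSeries, coeff_mul, coeff_mul, ← Finset.Nat.sum_antidiagonal_swap, Finset.op_sum]
  simp

theorem opSeries_sum {ι : Type*} (s : Finset ι) (f : ι → PowerSeries A) :
    opSeries (∑ i ∈ s, f i) = ∑ i ∈ s, opSeries (f i) := by
  ext r; simp

theorem opSeries_one : opSeries (1 : PowerSeries A) = 1 := by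
  ext r; rw [coeff_opSeries, coeff_one, coeff_one]; split_ifs <;> simp

theorem opSeries_zero : opSeries (0 : PowerSeries A) = 0 := by ext r; simp

variable {n : ℕ}

/-- The Gauss factors of the transposed matrix over the opposite algebra. -/
def GaussFactors.op (G : GaussFactors n (PowerSeries A)) : GaussFactors n (PowerSeries Aᵐᵒᵖ) :=
  ⟨Matrix.of fun i j => opSeries (G.E j i), fun i => opSeries (G.D i),
    Matrix.of fun i j => opSeries (G.F j i)⟩

theorem GaussFactors.IsFactorizationOf.op {G : GaussFactors n (PowerSeries A)}
    {T : Fin n → Fin n → ℕ → A} (hG : G.IsFactorizationOf (seriesMatrix T)) :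
    G.op.IsFactorizationOf (seriesMatrix fun i j r => MulOpposite.op (T j i r)) := by
  refine ⟨fun i => ?_, fun i j h => ?_, fun i => ?_, fun i j h => ?_, Matrix.ext fun i j => ?_⟩
  · simp [GaussFactors.op, hG.E_diag, opSeries_one]
  · simp [GaussFactors.op, hG.E_lower j i h, opSeries_zero]
  · simp [GaussFactors.op, hG.F_diag, opSeries_one]
  · simp [GaussFactors.op, hG.F_upper j i h, opSeries_zero]
  · have h1 : seriesMatrix (fun i j r => MulOpposite.op (T j i r)) i j =
        opSeries (seriesMatrix T j i) := by
      ext r; rw [coeff_seriesMatrix, coeff_opSeries, coeff_seriesMatrix]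
    rw [h1, hG.eq_mul, gauss_apply, gauss_apply, opSeries_sum]
    simp [opSeries_mul, GaussFactors.op, mul_assoc]

theorem coeffD_op (G : GaussFactors n (PowerSeries A)) (i : Fin n) (r : ℕ) :
    G.op.coeffD i r = op (G.coeffD i r) := coeff_opSeries _ _

theorem coeffE_op (G : GaussFactors n (PowerSeries A)) (i : Fin (n - 1)) (r : ℕ) :
    G.op.coeffE i r = op (G.coeffF i r) := coeff_opSeries _ _

variable [Algebra ℂ A]

theorem shiftOne_op (ε : ℂ) (D : ℕ → A) :
    shiftOne ε (fun r => op (D r)) = op (shiftOne ε D) := by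
  simp [shiftOne, op_smul]

variable {T : Fin n → Fin n → ℕ → A} {G : GaussFactors n (PowerSeries A)}
  (hT : IsRTT T) (hG : G.IsFactorizationOf (seriesMatrix T))
include hT hG

/-- Transposing F D E over the opposite algebra again gives a Gauss factorization, with E and F
exchanged. Each relation for F below is the one for E, read backwards. -/
theorem isHalfSeed_gauss_op : IsHalfSeed (fun i r => op (G.coeffD i r))
    (fun i r => op (G.coeffF i r)) := by
  have := isHalfSeed_gauss hT.op hG.op
  rwa [show G.op.coeffD = fun i r => op (G.coeffD i r) from
    funext fun i => funext fun r => coeffD_op G i r,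
    show G.op.coeffE = fun i r => op (G.coeffF i r) from
    funext fun i => funext fun r => coeffE_op G i r] at this

theorem coeffD_lie_coeffF (i : Fin n) (j : Fin (n - 1)) (r s : ℕ) (hs : 1 ≤ s) :
    ⁅G.coeffD i r, G.coeffF j s⁆ = (delta i (hi j) - delta i (lo j)) •
      ∑ t ∈ Finset.range r, G.coeffF j (r + s - 1 - t) * G.coeffD i t := by
  apply op_injective
  rw [← neg_inj, ← op_lie, (isHalfSeed_gauss_op hT hG).D_E i j r s hs, op_smul, ← neg_smul,
    neg_sub]
  simp

theorem coeffF_lie_coeffF (i : Fin (n - 1)) (r s : ℕ) (hr : 1 ≤ r) (hs : 1 ≤ s) :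
    ⁅G.coeffF i r, G.coeffF i s⁆ =
      ∑ t ∈ Finset.Icc 1 (r - 1), G.coeffF i (r + s - 1 - t) * G.coeffF i t
        - ∑ t ∈ Finset.Icc 1 (s - 1), G.coeffF i (r + s - 1 - t) * G.coeffF i t := by
  apply op_injective
  rw [← neg_inj, ← op_lie, (isHalfSeed_gauss_op hT hG).E_E i r s hr hs]
  simp

theorem coeffF_lie_next (i j : Fin (n - 1)) (hij : (j : ℕ) = i + 1) (r s : ℕ) (hr : 1 ≤ r)
    (hs : 1 ≤ s) : ⁅G.coeffF i (r + 1), G.coeffF j s⁆ - ⁅G.coeffF i r, G.coeffF j (s + 1)⁆ =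
      -(G.coeffF j s * G.coeffF i r) := by
  apply op_injective
  have := (isHalfSeed_gauss_op hT hG).E_E_next' i j hij r s hr hs
  simp only [op_lie] at this
  rw [op_sub, op_neg, op_mul, ← this]
  abel

theorem coeffF_lie_far (i j : Fin (n - 1)) (hij : 1 < |(i : ℤ) - (j : ℤ)|) (r s : ℕ) (hr : 1 ≤ r)
    (hs : 1 ≤ s) : ⁅G.coeffF i r, G.coeffF j s⁆ = 0 := by
  apply op_injective
  rw [← neg_inj, ← op_lie, (isHalfSeed_gauss_op hT hG).E_E_far' i j hij r s hr hs, op_zero, neg_zero]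

theorem coeffF_serre (i j : Fin (n - 1)) (hij : |(i : ℤ) - (j : ℤ)| = 1) (r s t : ℕ)
    (hr : 1 ≤ r) (hs : 1 ≤ s) (ht : 1 ≤ t) :
    ⁅G.coeffF i r, ⁅G.coeffF i s, G.coeffF j t⁆⁆ +
      ⁅G.coeffF i s, ⁅G.coeffF i r, G.coeffF j t⁆⁆ = 0 := by
  apply op_injective
  have := (isHalfSeed_gauss_op hT hG).serre' i j hij r s t hr hs ht
  simpa only [op_lie, lie_neg, neg_neg, op_add, op_zero] using this

end Opposite

/-! ### The E–F relation and the homomorphism from Drinfeld's presentation -/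

section GaussHom

attribute [local instance] LieRing.ofAssociativeRing

open PowerSeries MulOpposite

variable {A : Type*} [Ring A]

/-- An element that commutes with the coefficients of an invertible series commutes with those of
its inverse. -/
theorem lie_coeff_inverse {x : A} {f : PowerSeries A} (hf : IsUnit f) (h : ∀ s, ⁅x, coeff s f⁆ = 0)
    (s : ℕ) : ⁅x, coeff s (Ring.inverse f)⁆ = 0 := by
  obtain ⟨u, rfl⟩ := hf
  have h1 : Commute (C x) (u : PowerSeries A) := by
    rw [commute_iff_eq, ← sub_eq_zero]
    ext r
    rw [coeff_lie_C, h, map_zero]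
  have h2 : Commute (C x) ((u⁻¹ : (PowerSeries A)ˣ) : PowerSeries A) := h1.units_inv_right
  rw [Ring.inverse_unit, ← coeff_lie_C, h2.eq, sub_self, map_zero]

variable {n : ℕ} {T : Fin n → Fin n → ℕ → A} {G : GaussFactors n (PowerSeries A)}
  (hT : IsRTT T) (hG : G.IsFactorizationOf (seriesMatrix T))
include hT hG

theorem coeffE_one_lie_coeffF_of_ne {i j : Fin (n - 1)} (hij : i ≠ j) (s : ℕ) :
    ⁅G.coeffE i 1, G.coeffF j s⁆ = 0 := by
  have h : (i : ℕ) ≠ j := fun h => hij (Fin.ext h)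
  rw [← T_lo_hi hT hG, GaussFactors.coeffF,
    (gauss_covariance_coeff hT hG (j := lo i) (j' := hi i) rfl).2.2, if_neg, if_neg]
  · simp
  · simpa [Fin.ext_iff, lo] using h.symm
  · simpa [Fin.ext_iff, hi] using h.symm

variable [Algebra ℂ A]

theorem lie_coeffDt (i j : Fin n) (r s : ℕ) : ⁅G.coeffD i r, G.coeffDt j s⁆ = 0 := by
  rw [GaussFactors.coeffDt, map_neg, lie_neg,
    lie_coeff_inverse (hG.isUnit_D hT j) fun s => (isHalfSeed_gauss hT hG).D_D i j r s, neg_zero]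

/-- Covariance gives ⁅E_i^{(1)}, F_i(u)⁆ = 1 - D_{i+1}(u) D_i(u)⁻¹. The 1 only affects degree zero,
and the factors commute. -/
theorem coeffE_one_lie_coeffF_self (i : Fin (n - 1)) (s : ℕ) (hs : 1 ≤ s) :
    ⁅G.coeffE i 1, G.coeffF i s⁆ =
      ∑ t ∈ Finset.Icc 0 s, G.coeffDt (lo i) t * G.coeffD (hi i) (s - t) := by
  have h := (gauss_covariance_coeff hT hG (j := lo i) (j' := hi i) rfl).2.2 (hi i) (lo i) s
  rw [T_lo_hi hT hG, if_pos rfl, if_pos rfl, hG.F_diag, hG.F_diag, one_mul, map_sub,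
    coeff_one, if_neg (by omega), zero_sub, coeff_mul, ← Finset.Nat.sum_antidiagonal_swap,
    Finset.Nat.sum_antidiagonal_eq_sum_range_succ_mk] at h
  rw [GaussFactors.coeffF, h, ← Finset.sum_neg_distrib, ← Nat.range_succ_eq_Icc_zero]
  refine Finset.sum_congr rfl fun t _ => ?_
  have hc := lie_coeffDt hT hG (hi i) (lo i) (s - t) t
  rw [Ring.lie_def, sub_eq_zero] at hc
  rw [← hc, GaussFactors.coeffDt, map_neg, mul_neg]
  rfl

/-- The shift h for E_i acts on F_i with the opposite sign and commutes with all D and D̃. Hence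
⁅E_i^{(r+1)}, F_i^{(s)}⁆ = ⁅E_i^{(r)}, F_i^{(s+1)}⁆, and r = 1 suffices. For i ≠ j the shift comes
from some D_a that commutes with F_j. -/
theorem coeffE_lie_coeffF (i j : Fin (n - 1)) (r s : ℕ) (hr : 1 ≤ r) (hs : 1 ≤ s) :
    ⁅G.coeffE i r, G.coeffF j s⁆ = delta i j •
      ∑ t ∈ Finset.Icc 0 (r + s - 1), G.coeffDt (lo i) t * G.coeffD (hi i) (r + s - 1 - t) := by
  have H := isHalfSeed_gauss hT hG
  have Hop := isHalfSeed_gauss_op hT hG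
  by_cases hij : i = j
  · subst hij
    simp only [delta, if_true, one_smul]
    set h := shiftOne ((1 : ℤ) : ℂ) (G.coeffD (lo i))
    have h1 := H.shift_lo i
    have h2 : ∀ s, 1 ≤ s → ⁅h, G.coeffF i s⁆ = -G.coeffF i (s + 1) := fun s hs => by
      have := Hop.shift_lo i s hs
      rw [shiftOne_op, op_lie] at this
      rw [← op_injective this, neg_neg, unop_op]
    have hD : ∀ j r, ⁅h, G.coeffD j r⁆ = 0 := fun j r =>
      shiftOne_lie_eq_zero _ fun t => H.D_D _ _ _ _
    have hDt : ∀ j r, ⁅h, G.coeffDt j r⁆ = 0 := fun j r =>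
      shiftOne_lie_eq_zero _ fun t => lie_coeffDt hT hG _ _ _ _
    induction r, hr using Nat.le_induction generalizing s with
    | base =>
      rw [coeffE_one_lie_coeffF_self hT hG i s hs, show 1 + s - 1 = s by omega]
    | succ r hr ih =>
      have e := leibniz_lie h (G.coeffE i r) (G.coeffF i s)
      rw [h1 r hr, h2 s hs, ih s hs, lie_finset_sum, Finset.sum_eq_zero, lie_neg,
        ih (s + 1) (by omega)] at e
      · rw [← sub_eq_add_neg] at e
        rw [sub_eq_zero.1 e.symm, show r + (s + 1) - 1 = r + 1 + s - 1 by omega]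
      · intro t _
        rw [lie_mul_ring, hD, hDt, zero_mul, mul_zero, add_zero]
  · rw [delta, if_neg hij, zero_smul]
    obtain ⟨a, ε, h1, h2, h3⟩ := H.exists_isShift hij
    refine eq_zero_of_shift (f := fun r => ⁅G.coeffE i r, G.coeffF j s⁆)
      (h := shiftOne ε (G.coeffD a)) (coeffE_one_lie_coeffF_of_ne hT hG hij s) (fun r hr => ?_) r hr
    rw [leibniz_lie, (h3.exists_shift (H.D_zero a)).1 r hr, shiftOne_lie_eq_zero _ fun r => ?_,
      lie_zero, add_zero]
    rw [coeffD_lie_coeffF hT hG _ _ _ _ hs]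
    simp [delta, h1, h2]

/-- The images of Drinfeld's generators. -/
def drinfeldImage {n : ℕ} {A : Type*} [Ring A] (G : GaussFactors n (PowerSeries A)) :
    DrinfeldGen n → A
  | .D i r => G.coeffD i r
  | .Dt i r => G.coeffDt i r
  | .E i r => G.coeffE i (r + 1)
  | .F i r => G.coeffF i (r + 1)

/-- The Gauss factors of a solution of the RTT equation satisfy Drinfeld's relations. -/
theorem exists_drinfeld_lift : ∃ φ : DrinfeldYangian n →ₐ[ℂ] A,
    (∀ i r, φ (drMk n (frD i r)) = G.coeffD i r) ∧ (∀ i r, φ (drMk n (frDt i r)) = G.coeffDt i r) ∧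
    (∀ i r, 1 ≤ r → φ (drMk n (frE i r)) = G.coeffE i r) ∧
    ∀ i r, 1 ≤ r → φ (drMk n (frF i r)) = G.coeffF i r := by
  have H := isHalfSeed_gauss hT hG
  set θ : FreeDr n →ₐ[ℂ] A := FreeAlgebra.lift ℂ (drinfeldImage G) with hθ
  have θD : ∀ i r, θ (frD i r) = G.coeffD i r := fun i r => FreeAlgebra.lift_ι_apply _ _
  have θDt : ∀ i r, θ (frDt i r) = G.coeffDt i r := fun i r => FreeAlgebra.lift_ι_apply _ _
  have θE : ∀ i r, 1 ≤ r → θ (frE i r) = G.coeffE i r := fun i r hr => by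
    obtain ⟨r, rfl⟩ := Nat.exists_eq_add_of_le' hr
    exact FreeAlgebra.lift_ι_apply _ _
  have θF : ∀ i r, 1 ≤ r → θ (frF i r) = G.coeffF i r := fun i r hr => by
    obtain ⟨r, rfl⟩ := Nat.exists_eq_add_of_le' hr
    exact FreeAlgebra.lift_ι_apply _ _
  have θlie : ∀ x y, θ ⁅x, y⁆ = ⁅θ x, θ y⁆ := fun x y => by
    simp only [Ring.lie_def, map_sub, map_mul]
  have hrel : ∀ ⦃x y⦄, DrinfeldRel n x y → θ x = θ y := by
    intro x y h
    induction h with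
    | r0 i => rw [θD, map_one, H.D_zero]
    | r1 i r =>
      rw [map_sum, map_zsmul, map_one]
      simp only [map_mul, θD, θDt]
      have h1 : G.D i * -Ring.inverse (G.D i) = -1 := by
        rw [mul_neg, Ring.mul_inverse_cancel _ (hG.isUnit_D hT i)]
      have h2 := congr_arg (coeff r) h1
      rw [coeff_mul, Finset.Nat.sum_antidiagonal_eq_sum_range_succ_mk,
        Nat.range_succ_eq_Icc_zero] at h2
      refine h2.trans ?_
      rw [map_neg, coeff_one, delta]
      split_ifs <;> simp
    | r2 i j r s => rw [θlie, θD, θD, map_zero, H.D_D]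
    | r3 i j r s hr hs =>
      rw [θlie, θE _ _ hr, θF _ _ hs, map_zsmul, map_sum, coeffE_lie_coeffF hT hG i j r s hr hs]
      simp only [map_mul, θD, θDt]
    | r4 i j r s hs =>
      rw [θlie, θD, θE _ _ hs, map_zsmul, map_sum, H.D_E i j r s hs]
      congr 1
      refine Finset.sum_congr rfl fun t ht => ?_
      have := Finset.mem_range.1 ht
      rw [map_mul, θD, θE _ _ (by omega)]
    | r5 i j r s hs =>
      rw [θlie, θD, θF _ _ hs, map_zsmul, map_sum, coeffD_lie_coeffF hT hG i j r s hs]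
      congr 1
      refine Finset.sum_congr rfl fun t ht => ?_
      have := Finset.mem_range.1 ht
      rw [map_mul, θD, θF _ _ (by omega)]
    | r6 i r s hr hs =>
      rw [θlie, θE _ _ hr, θE _ _ hs, map_sub, map_sum, map_sum, H.E_E i r s hr hs]
      congr 1 <;>
      · refine Finset.sum_congr rfl fun t ht => ?_
        have := Finset.mem_Icc.1 ht
        rw [map_mul, θE _ _ (by omega), θE _ _ (by omega)]
    | r7 i r s hr hs =>
      rw [θlie, θF _ _ hr, θF _ _ hs, map_sub, map_sum, map_sum, coeffF_lie_coeffF hT hG i r s hr hs]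
      congr 1 <;>
      · refine Finset.sum_congr rfl fun t ht => ?_
        have := Finset.mem_Icc.1 ht
        rw [map_mul, θF _ _ (by omega), θF _ _ (by omega)]
    | r8 i j hij r s hr hs =>
      rw [map_sub, θlie, θlie, map_neg, map_mul, θE _ _ hr, θE _ _ hs, θE _ (r + 1) (by omega),
        θE _ (s + 1) (by omega), H.E_E_next' i j hij r s hr hs]
    | r9 i j hij r s hr hs =>
      rw [map_sub, θlie, θlie, map_neg, map_mul, θF _ _ hr, θF _ _ hs, θF _ (r + 1) (by omega),
        θF _ (s + 1) (by omega), coeffF_lie_next hT hG i j hij r s hr hs]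
    | r10 i j hij r s hr hs =>
      rw [θlie, θE _ _ hr, θE _ _ hs, map_zero, H.E_E_far' i j hij r s hr hs]
    | r11 i j hij r s hr hs =>
      rw [θlie, θF _ _ hr, θF _ _ hs, map_zero, coeffF_lie_far hT hG i j hij r s hr hs]
    | r12 i j hij r s t hr hs ht =>
      rw [map_add, map_zero, θlie, θlie, θlie, θlie, θE _ _ hr, θE _ _ hs, θE _ _ ht,
        H.serre' i j hij r s t hr hs ht]
    | r13 i j hij r s t hr hs ht =>
      rw [map_add, map_zero, θlie, θlie, θlie, θlie, θF _ _ hr, θF _ _ hs, θF _ _ ht,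
        coeffF_serre hT hG i j hij r s t hr hs ht]
  refine ⟨RingQuot.liftAlgHom ℂ ⟨θ, hrel⟩, fun i r => ?_, fun i r => ?_, fun i r hr => ?_,
    fun i r hr => ?_⟩
  · rw [drMk, RingQuot.liftAlgHom_mkAlgHom_apply, θD]
  · rw [drMk, RingQuot.liftAlgHom_mkAlgHom_apply, θDt]
  · rw [drMk, RingQuot.liftAlgHom_mkAlgHom_apply, θE _ _ hr]
  · rw [drMk, RingQuot.liftAlgHom_mkAlgHom_apply, θF _ _ hr]

end GaussHom

/-! ### A solution of the RTT equation from Drinfeld's generators -/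

section DrinfeldRTT

attribute [local instance] LieRing.ofAssociativeRing

open PowerSeries

variable {A : Type*} [Ring A] {n : ℕ}

/-- Elements that satisfy Drinfeld's relations, up to those between the neighbours `E_i`, `E_{i+1}`
and `F_i`, `F_{i+1}`, with `E_j^{(0)} = F_j^{(0)} = 0`. -/
structure IsDrinfeld (D Dt : Fin n → ℕ → A) (E F : Fin (n - 1) → ℕ → A) : Prop where
  intro ::
  E_zero : ∀ j, E j 0 = 0
  F_zero : ∀ j, F j 0 = 0
  D_zero : ∀ i, D i 0 = 1
  D_Dt : ∀ i r, ∑ t ∈ Finset.Icc 0 r, D i t * Dt i (r - t) = -delta r 0 • 1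
  D_D : ∀ i j r s, ⁅D i r, D j s⁆ = 0
  E_F : ∀ i j r s, 1 ≤ r → 1 ≤ s → ⁅E i r, F j s⁆ =
    delta i j • ∑ t ∈ Finset.Icc 0 (r + s - 1), Dt (lo i) t * D (hi i) (r + s - 1 - t)
  D_E : ∀ i j r s, 1 ≤ s → ⁅D i r, E j s⁆ =
    (delta i (lo j) - delta i (hi j)) • ∑ t ∈ Finset.range r, D i t * E j (r + s - 1 - t)
  D_F : ∀ i j r s, 1 ≤ s → ⁅D i r, F j s⁆ =
    (delta i (hi j) - delta i (lo j)) • ∑ t ∈ Finset.range r, F j (r + s - 1 - t) * D i t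
  E_E : ∀ j r s, 1 ≤ r → 1 ≤ s → ⁅E j r, E j s⁆ =
    ∑ t ∈ Finset.Icc 1 (s - 1), E j t * E j (r + s - 1 - t)
      - ∑ t ∈ Finset.Icc 1 (r - 1), E j t * E j (r + s - 1 - t)
  F_F : ∀ j r s, 1 ≤ r → 1 ≤ s → ⁅F j r, F j s⁆ =
    ∑ t ∈ Finset.Icc 1 (r - 1), F j (r + s - 1 - t) * F j t
      - ∑ t ∈ Finset.Icc 1 (s - 1), F j (r + s - 1 - t) * F j t
  E_far : ∀ i j : Fin (n - 1), 1 < |(i : ℤ) - (j : ℤ)| → ⁅E i 1, E j 1⁆ = 0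
  F_far : ∀ i j : Fin (n - 1), 1 < |(i : ℤ) - (j : ℤ)| → ⁅F i 1, F j 1⁆ = 0
  E_serre : ∀ i j : Fin (n - 1), |(i : ℤ) - (j : ℤ)| = 1 →
    ⁅E i 1, ⁅E i 1, E j 1⁆⁆ + ⁅E i 1, ⁅E i 1, E j 1⁆⁆ = 0
  F_serre : ∀ i j : Fin (n - 1), |(i : ℤ) - (j : ℤ)| = 1 →
    ⁅F i 1, ⁅F i 1, F j 1⁆⁆ + ⁅F i 1, ⁅F i 1, F j 1⁆⁆ = 0

/-- A family indexed by an initial segment, extended by zero. -/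
def extendZero {m : ℕ} (a : Fin m → A) (k : ℕ) : A := if hk : k < m then a ⟨k, hk⟩ else 0

theorem extendZero_of_lt {m : ℕ} (a : Fin m → A) {k : ℕ} (hk : k < m) :
    extendZero a k = a ⟨k, hk⟩ := dif_pos hk

theorem extendZero_of_ge {m : ℕ} (a : Fin m → A) {k : ℕ} (hk : m ≤ k) :
    extendZero a k = 0 := dif_neg (by omega)

@[simp] theorem extendZero_val {m : ℕ} (a : Fin m → A) (k : Fin m) :
    extendZero a k = a k := extendZero_of_lt a k.2

theorem posRoot_lie_eq_zero {L : Type*} [LieRing L] {e : ℕ → L} {y : L} {i : ℕ}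
    (h : ∀ k, i ≤ k → ⁅e k, y⁆ = 0) (d : ℕ) : ⁅posRoot e i d, y⁆ = 0 := by
  induction d with
  | zero => exact h i le_rfl
  | succ d ih => rw [posRoot, lie_lie, ih, h _ (by omega), lie_zero, lie_zero, sub_zero]

namespace IsDrinfeld

variable {D Dt : Fin n → ℕ → A} {E F : Fin (n - 1) → ℕ → A} (H : IsDrinfeld D Dt E F)
include H

theorem Dt_zero (i : Fin n) : Dt i 0 = -1 := by
  have := H.D_Dt i 0
  simpa [H.D_zero, delta] using this

theorem Dt_one (i : Fin n) : Dt i 1 = D i 1 := by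
  have := H.D_Dt i 1
  rw [← Nat.range_succ_eq_Icc_zero, Finset.sum_range_succ, Finset.sum_range_one, H.D_zero] at this
  simp only [delta, H.Dt_zero, one_mul, Nat.sub_zero, Nat.sub_self, mul_neg, mul_one, one_ne_zero,
    if_false, neg_zero, zero_smul] at this
  rwa [← sub_eq_add_neg, sub_eq_zero] at this

theorem D_one_lie_E (i : Fin n) (j : Fin (n - 1)) (s : ℕ) (hs : 1 ≤ s) :
    ⁅D i 1, E j s⁆ = (delta i (lo j) - delta i (hi j)) • E j s := by
  rw [H.D_E i j 1 s hs]; simp [H.D_zero]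

theorem D_one_lie_F (i : Fin n) (j : Fin (n - 1)) (s : ℕ) (hs : 1 ≤ s) :
    ⁅D i 1, F j s⁆ = (delta i (hi j) - delta i (lo j)) • F j s := by
  rw [H.D_F i j 1 s hs]; simp [H.D_zero]

theorem E_one_lie_F_one (i : Fin (n - 1)) : ⁅E i 1, F i 1⁆ = D (lo i) 1 - D (hi i) 1 := by
  rw [H.E_F i i 1 1 le_rfl le_rfl, ← Nat.range_succ_eq_Icc_zero]
  simp [Finset.sum_range_succ, delta, H.Dt_zero, H.Dt_one, H.D_zero]
  abel

variable [Algebra ℂ A]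

/-- The relations of degree one are those of gl_n; the Serre relations appear doubled there, which
is harmless over ℂ. Extension by zero preserves all of them except ⁅e, f⁆ = h - h at the last index,
excluded by i + 1 < n. -/
theorem isChevalley : IsChevalley n (extendZero fun j => E j 1) (extendZero fun j => F j 1)
    (extendZero fun i => D i 1) := by
  have he : ∀ (i j : ℕ), ⁅extendZero (fun i => D i 1) i, extendZero (fun j => E j 1) j⁆ =
      (if i = j then extendZero (fun j => E j 1) j else 0) -
        (if i = j + 1 then extendZero (fun j => E j 1) j else 0) := by
    intro i j
    by_cases hj : j < n - 1
    · by_cases hi' : i < n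
      · rw [extendZero_of_lt _ hj, extendZero_of_lt _ hi', H.D_one_lie_E _ _ 1 le_rfl, sub_smul]
        simp only [delta, lo, hi, Fin.mk.injEq]
        congr 1 <;> split_ifs <;> simp
      · rw [extendZero_of_ge _ (by omega : n ≤ i), if_neg (by omega), if_neg (by omega)]; simp
    · rw [extendZero_of_ge (fun j => E j 1) (by omega : n - 1 ≤ j)]; simp
  have hf : ∀ (i j : ℕ), ⁅extendZero (fun i => D i 1) i, extendZero (fun j => F j 1) j⁆ =
      (if i = j + 1 then extendZero (fun j => F j 1) j else 0) -
        (if i = j then extendZero (fun j => F j 1) j else 0) := by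
    intro i j
    by_cases hj : j < n - 1
    · by_cases hi' : i < n
      · rw [extendZero_of_lt _ hj, extendZero_of_lt _ hi', H.D_one_lie_F _ _ 1 le_rfl, sub_smul]
        simp only [delta, lo, hi, Fin.mk.injEq]
        congr 1 <;> split_ifs <;> simp
      · rw [extendZero_of_ge _ (by omega : n ≤ i), if_neg (by omega), if_neg (by omega)]; simp
    · rw [extendZero_of_ge (fun j => F j 1) (by omega : n - 1 ≤ j)]; simp
  have far : ∀ (X : Fin (n - 1) → ℕ → A)
      (_ : ∀ i j : Fin (n - 1), 1 < |(i : ℤ) - (j : ℤ)| → ⁅X i 1, X j 1⁆ = 0) (i j : ℕ),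
      i + 1 < j → ⁅extendZero (fun j => X j 1) i, extendZero (fun j => X j 1) j⁆ = 0 := by
    intro X hX i j hij
    by_cases hj : j < n - 1
    · rw [extendZero_of_lt _ hj, extendZero_of_lt _ (by omega : i < n - 1)]
      exact hX _ _ (lt_abs.2 (Or.inr (by simp; omega)))
    · rw [extendZero_of_ge _ (by omega : n - 1 ≤ j), lie_zero]
  have serre : ∀ (X : Fin (n - 1) → ℕ → A)
      (_ : ∀ i j : Fin (n - 1), |(i : ℤ) - (j : ℤ)| = 1 →
        ⁅X i 1, ⁅X i 1, X j 1⁆⁆ + ⁅X i 1, ⁅X i 1, X j 1⁆⁆ = 0) (i j : ℕ), i = j + 1 ∨ j = i + 1 →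
      ⁅extendZero (fun j => X j 1) i,
        ⁅extendZero (fun j => X j 1) i, extendZero (fun j => X j 1) j⁆⁆ = 0 := by
    intro X hX i j hij
    by_cases hj : j < n - 1
    · by_cases hi' : i < n - 1
      · rw [extendZero_of_lt _ hj, extendZero_of_lt _ hi']
        refine two_torsion_free _ (hX _ _ ?_)
        rw [abs_eq one_pos.le]
        simp only
        omega
      · rw [extendZero_of_ge _ (by omega : n - 1 ≤ i), zero_lie]
    · rw [extendZero_of_ge _ (by omega : n - 1 ≤ j), lie_zero, lie_zero]
  refine ⟨two_torsion_free, fun i j => ?_, he, hf, fun i j hij => ?_, fun i hi' => ?_,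
    far E H.E_far, far F H.F_far, fun i => serre E H.E_serre _ _ (Or.inr rfl),
    fun i => serre E H.E_serre _ _ (Or.inl rfl),
    fun i => serre F H.F_serre _ _ (Or.inr rfl), fun i => serre F H.F_serre _ _ (Or.inl rfl)⟩
  · rw [extendZero, extendZero]; split_ifs <;> simp [H.D_D]
  · rw [extendZero, extendZero]
    split_ifs
    · rw [H.E_F _ _ 1 1 le_rfl le_rfl, delta, if_neg (by simpa using hij), zero_smul]
    all_goals simp
  · rw [extendZero_of_lt _ (by omega : i < n - 1), extendZero_of_lt _ (by omega : i < n - 1),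
      extendZero_of_lt _ hi', extendZero_of_lt _ (by omega : i < n), H.E_one_lie_F_one]
    rfl

end IsDrinfeld

/-- The matrix units of `gl_n` built from Drinfeld's generators of degree one. -/
def drUnit (D : Fin n → ℕ → A) (E F : Fin (n - 1) → ℕ → A) (i j : Fin n) : A :=
  glRoot (extendZero fun j => E j 1) (extendZero fun j => F j 1) (extendZero fun i => D i 1) i j

/-- The coefficients of the matrix `T(u)` built from Drinfeld's generators. -/
def drT (D : Fin n → ℕ → A) (E F : Fin (n - 1) → ℕ → A) (o i j : Fin n) (r : ℕ) : A :=
  adjFamily (drUnit D E F) o (D o r) i j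

theorem drUnit_lo_hi (D : Fin n → ℕ → A) (E F : Fin (n - 1) → ℕ → A) (j : Fin (n - 1)) :
    drUnit D E F (lo j) (hi j) = E j 1 := by
  simp [drUnit, lo, hi, glRoot_succ]

theorem drUnit_hi_lo (D : Fin n → ℕ → A) (E F : Fin (n - 1) → ℕ → A) (j : Fin (n - 1)) :
    drUnit D E F (hi j) (lo j) = F j 1 := by
  simp [drUnit, lo, hi, glRoot_pred]

theorem drUnit_self (D : Fin n → ℕ → A) (E F : Fin (n - 1) → ℕ → A) (i : Fin n) :
    drUnit D E F i i = D i 1 := by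
  simp [drUnit, glRoot_self]

end DrinfeldRTT

/-! ### The four basic RTT relations from Drinfeld's relations -/

section DrinfeldSeries

attribute [local instance] LieRing.ofAssociativeRing

open PowerSeries

variable {A : Type*} [Ring A] {n : ℕ}

theorem coeff_mul_of_constantCoeff_eq_zero_left {f g : PowerSeries A} (hf : constantCoeff f = 0)
    (r : ℕ) : coeff r (f * g) = ∑ t ∈ Finset.range r, coeff (r - t) f * coeff t g := by
  rw [coeff_mul, ← Finset.Nat.sum_antidiagonal_swap,
    Finset.Nat.sum_antidiagonal_eq_sum_range_succ_mk, Finset.sum_range_succ]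
  simp [hf]

theorem coeff_mul_self_of_constantCoeff_eq_zero {f : PowerSeries A} (hf : constantCoeff f = 0)
    (r : ℕ) : coeff r (f * f) = ∑ t ∈ Finset.Icc 1 (r - 1), coeff t f * coeff (r - t) f := by
  rw [coeff_mul_of_constantCoeff_eq_zero hf, sum_Icc_one]
  rcases r with _ | r
  · simp
  · rw [Finset.sum_range_succ', coeff_zero_eq_constantCoeff_apply, hf, zero_mul, add_zero,
      Nat.add_sub_cancel]

theorem commutator_mul (c x y : A) :
    c * (x * y) - x * y * c = (c * x - x * c) * y + x * (c * y - y * c) := by noncomm_ring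

/-- An RTT relation holds if it does as an identity of series in two variables. -/
theorem rttDefect_eq_zero_of_series {ι : Type*} [DecidableEq ι] {T : ι → ι → ℕ → A} {i j k l : ι}
    (h : (vInv A - uInv A) * (inU (seriesMatrix T i j) * inV (seriesMatrix T k l) -
        inV (seriesMatrix T k l) * inU (seriesMatrix T i j)) =
      uInv A * vInv A * (inU (seriesMatrix T k j) * inV (seriesMatrix T i l) -
        inV (seriesMatrix T k j) * inU (seriesMatrix T i l))) (r s : ℕ) :
    rttDefect T r s i j k l = 0 := by
  have h3 := ((sub_mul_eq_iff _ _).1 h).2.2 r s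
  simp only [coeff₂_sub, coeff₂_inU_mul_inV, coeff₂_inV_mul_inU, coeff_seriesMatrix] at h3
  rw [rttDefect, Ring.lie_def, Ring.lie_def, h3, sub_self]

namespace IsDrinfeld

variable {D Dt : Fin n → ℕ → A} {E F : Fin (n - 1) → ℕ → A} (H : IsDrinfeld D Dt E F)
  (j : Fin (n - 1))
include H

theorem constantCoeff_E : constantCoeff (mk (E j)) = 0 := by
  rw [← coeff_zero_eq_constantCoeff_apply, coeff_mk, H.E_zero]

theorem constantCoeff_F : constantCoeff (mk (F j)) = 0 := by
  rw [← coeff_zero_eq_constantCoeff_apply, coeff_mk, H.F_zero]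

theorem D_lie_E_one (r : ℕ) : ⁅D (lo j) r, E j 1⁆ = coeff r (mk (D (lo j)) * mk (E j)) := by
  rw [coeff_mul_of_constantCoeff_eq_zero (H.constantCoeff_E j), H.D_E _ _ _ _ le_rfl]
  simp [delta, lo_ne_hi]

theorem F_one_lie_D (r : ℕ) : ⁅F j 1, D (lo j) r⁆ = coeff r (mk (F j) * mk (D (lo j))) := by
  rw [coeff_mul_of_constantCoeff_eq_zero_left (H.constantCoeff_F j), ← lie_skew,
    H.D_F _ _ _ _ le_rfl]
  simp [delta, lo_ne_hi]

theorem commutator_E_D : C (E j 1) * mk (D (lo j)) - mk (D (lo j)) * C (E j 1) =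
    -(mk (D (lo j)) * mk (E j)) := by
  ext r
  rw [coeff_lie_C, coeff_mk, ← lie_skew, H.D_lie_E_one, map_neg]

theorem commutator_F_D : C (F j 1) * mk (D (lo j)) - mk (D (lo j)) * C (F j 1) =
    mk (F j) * mk (D (lo j)) := by
  ext r
  rw [coeff_lie_C, coeff_mk, H.F_one_lie_D]

theorem commutator_E_E : C (E j 1) * mk (E j) - mk (E j) * C (E j 1) = mk (E j) * mk (E j) := by
  ext r
  rw [coeff_lie_C, coeff_mk, coeff_mul_self_of_constantCoeff_eq_zero (H.constantCoeff_E j)]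
  rcases r with _ | r
  · simp [H.E_zero]
  · rw [H.E_E j 1 (r + 1) le_rfl (by omega)]
    simp [Nat.add_comm 1]

theorem commutator_F_F : C (F j 1) * mk (F j) - mk (F j) * C (F j 1) = -(mk (F j) * mk (F j)) := by
  ext r
  rw [coeff_lie_C, coeff_mk, map_neg, coeff_mul_of_constantCoeff_eq_zero_left (H.constantCoeff_F j)]
  rcases r with _ | r
  · simp [H.F_zero]
  · rw [H.F_F j 1 (r + 1) le_rfl (by omega), Finset.sum_range_succ', sum_Icc_one, sum_Icc_one]
    simp [Nat.add_comm 1, H.F_zero]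

theorem commutator_F_E : C (F j 1) * mk (E j) - mk (E j) * C (F j 1) =
    -(mk (Dt (lo j)) * mk (D (hi j))) - 1 := by
  ext r
  rw [coeff_lie_C, coeff_mk, map_sub, map_neg, coeff_mul,
    Finset.Nat.sum_antidiagonal_eq_sum_range_succ_mk, coeff_one, Nat.range_succ_eq_Icc_zero]
  rcases r with _ | r
  · simp [H.E_zero, H.Dt_zero, H.D_zero]
  · rw [← lie_skew, H.E_F j j (r + 1) 1 (by omega) le_rfl]
    simp [delta]

theorem D_mul_Dt (i : Fin n) : mk (D i) * mk (Dt i) = -1 := by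
  ext r
  rw [coeff_mul, Finset.Nat.sum_antidiagonal_eq_sum_range_succ_mk, Nat.range_succ_eq_Icc_zero,
    map_neg, coeff_one]
  simp only [coeff_mk]
  rw [H.D_Dt, delta]
  split_ifs <;> simp

/-- This produces the second diagonal entry F D E + D_{hi j} of T(u); the leftover -D_{lo j} is
cancelled by the diagonal correction in `adjFamily`. -/
theorem commutator_F_DE : C (F j 1) * (mk (D (lo j)) * mk (E j)) -
    mk (D (lo j)) * mk (E j) * C (F j 1) =
      mk (F j) * mk (D (lo j)) * mk (E j) + mk (D (hi j)) - mk (D (lo j)) := by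
  rw [commutator_mul, H.commutator_F_D, H.commutator_F_E, mul_sub, mul_neg, ← mul_assoc _ (mk (Dt _)),
    H.D_mul_Dt, mul_one, neg_mul, one_mul, neg_neg, ← add_sub_assoc]

/-- As a series the inner bracket is D(u)E(u), and the two contributions ∓D(u)E(u)² of the outer one
cancel. This is the hypothesis of `row_vanish`. -/
theorem E_lie_D_lie_E (r : ℕ) : ⁅E j 1, ⁅D (lo j) r, E j 1⁆⁆ = 0 := by
  rw [H.D_lie_E_one, ← coeff_lie_C, commutator_mul, H.commutator_E_D, H.commutator_E_E, neg_mul,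
    mul_assoc, neg_add_cancel, map_zero]

theorem F_lie_F_lie_D (r : ℕ) : ⁅F j 1, ⁅F j 1, D (lo j) r⁆⁆ = 0 := by
  rw [H.F_one_lie_D, ← coeff_lie_C, commutator_mul, H.commutator_F_D, H.commutator_F_F, neg_mul,
    mul_assoc, neg_add_cancel, map_zero]

theorem inU_D_comm (i k : Fin n) :
    inU (mk (D i)) * inV (mk (D k)) = inV (mk (D k)) * inU (mk (D i)) :=
  inU_inV_commute fun r s => by
    have := H.D_D i k r s
    rw [Ring.lie_def, sub_eq_zero] at this
    simpa using this

theorem D_E_series : (vInv A - uInv A) * (inU (mk (D (lo j))) * inV (mk (E j)) -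
    inV (mk (E j)) * inU (mk (D (lo j)))) = uInv A * vInv A *
      (inU (mk (D (lo j))) * inV (mk (E j)) - inU (mk (D (lo j))) * inU (mk (E j))) := by
  have h1 : ∀ r s, 1 ≤ s → ⁅D (lo j) r, E j s⁆ =
      ∑ t ∈ Finset.range r, D (lo j) t * E j (r + s - 1 - t) := fun r s hs => by
    rw [H.D_E _ _ _ _ hs]; simp [delta, lo_ne_hi]
  rw [sub_mul_eq_iff, ← map_mul]
  simp only [coeff₂_sub, coeff₂_inU_mul_inV, coeff₂_inV_mul_inU, coeff₂_inU, coeff_mk]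
  simp only [← Ring.lie_def]
  refine ⟨fun s => ?_, fun r => ?_, fun r s => ?_⟩
  · rw [H.D_zero, Ring.lie_def, one_mul, mul_one, sub_self]
  · rw [H.E_zero, lie_zero]
  · rcases s with _ | s
    · rw [H.E_zero, lie_zero, if_pos rfl, mul_zero, H.D_lie_E_one]
    · rw [h1 _ _ (by omega), h1 _ _ (by omega), if_neg (by omega), sub_zero, Finset.sum_range_succ,
        show r + 1 + (s + 1) - 1 - r = s + 1 by omega]
      simp only [show r + (s + 1 + 1) - 1 = r + 1 + (s + 1) - 1 by omega, add_sub_cancel_left]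

theorem D_F_series : (vInv A - uInv A) * (inU (mk (D (lo j))) * inV (mk (F j)) -
    inV (mk (F j)) * inU (mk (D (lo j)))) = uInv A * vInv A *
      (inU (mk (F j)) * inU (mk (D (lo j))) - inV (mk (F j)) * inU (mk (D (lo j)))) := by
  have h1 : ∀ r s, 1 ≤ s → ⁅D (lo j) r, F j s⁆ =
      -∑ t ∈ Finset.range r, F j (r + s - 1 - t) * D (lo j) t := fun r s hs => by
    rw [H.D_F _ _ _ _ hs]; simp [delta, lo_ne_hi]
  rw [sub_mul_eq_iff, ← map_mul]
  simp only [coeff₂_sub, coeff₂_inU_mul_inV, coeff₂_inV_mul_inU, coeff₂_inU, coeff_mk]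
  simp only [← Ring.lie_def]
  refine ⟨fun s => ?_, fun r => ?_, fun r s => ?_⟩
  · rw [H.D_zero, Ring.lie_def, one_mul, mul_one, sub_self]
  · rw [H.F_zero, lie_zero]
  · rcases s with _ | s
    · rw [H.F_zero, lie_zero, if_pos rfl, zero_mul, zero_sub, lie_skew, H.F_one_lie_D, sub_zero]
    · rw [h1 _ _ (by omega), h1 _ _ (by omega), if_neg (by omega), zero_sub, Finset.sum_range_succ,
        show r + 1 + (s + 1) - 1 - r = s + 1 by omega]
      simp only [show r + (s + 1 + 1) - 1 = r + 1 + (s + 1) - 1 by omega]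
      abel

/-- The entries of `T(u)` at the first two indices. -/
theorem series_drT :
    seriesMatrix (drT D E F (lo j)) (lo j) (lo j) = mk (D (lo j)) ∧
    seriesMatrix (drT D E F (lo j)) (lo j) (hi j) = mk (D (lo j)) * mk (E j) ∧
    seriesMatrix (drT D E F (lo j)) (hi j) (lo j) = mk (F j) * mk (D (lo j)) ∧
    seriesMatrix (drT D E F (lo j)) (hi j) (hi j) =
      mk (F j) * mk (D (lo j)) * mk (E j) + mk (D (hi j)) := by
  have hne := (lo_ne_hi j).symm
  refine ⟨?_, ?_, ?_, ?_⟩ <;> ext r <;> rw [coeff_seriesMatrix, drT]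
  · rw [adjFamily_oo, coeff_mk]
  · rw [adjFamily_o _ _ _ hne, drUnit_lo_hi, H.D_lie_E_one]
  · rw [adjFamily_to _ _ _ hne, drUnit_hi_lo, H.F_one_lie_D]
  · rw [adjFamily_of_ne _ _ _ hne hne, if_pos rfl, drUnit_lo_hi, drUnit_hi_lo, H.D_lie_E_one,
      ← coeff_lie_C, H.commutator_F_DE, map_sub, coeff_mk, sub_add_cancel]

/-- One factor is always D(u), so once the entries are written as D, DE, FD and FDE + D', only the
D–D, D–E and D–F series relations are needed. -/
theorem rttDefect_drT (r s : ℕ) :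
    rttDefect (drT D E F (lo j)) r s (lo j) (lo j) (lo j) (lo j) = 0 ∧
    rttDefect (drT D E F (lo j)) r s (lo j) (lo j) (lo j) (hi j) = 0 ∧
    rttDefect (drT D E F (lo j)) r s (lo j) (lo j) (hi j) (lo j) = 0 ∧
    rttDefect (drT D E F (lo j)) r s (lo j) (lo j) (hi j) (hi j) = 0 := by
  obtain ⟨t1, t2, t3, t4⟩ := H.series_drT j
  have hDE := H.D_E_series j
  have hDF := H.D_F_series j
  have hDD := H.inU_D_comm (lo j) (lo j)
  have hDD' := H.inU_D_comm (lo j) (hi j)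
  refine ⟨?_, ?_, ?_, ?_⟩ <;> apply rttDefect_eq_zero_of_series <;>
    simp only [t1, t2, t3, t4, map_mul, map_add] <;>
    set d := inU (mk (D (lo j))) <;> set d' := inV (mk (D (lo j))) <;> set e := inU (mk (E j)) <;>
    set e' := inV (mk (E j)) <;> set f := inU (mk (F j)) <;> set f' := inV (mk (F j)) <;>
    set g' := inV (mk (D (hi j)))
  · rw [hDD, sub_self, mul_zero, mul_zero]
  · have k1 : d * (d' * e') - d' * e' * d = d' * (d * e' - e' * d) := by
      rw [← mul_assoc, hDD]; noncomm_ring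
    have k2 : d * (d' * e') - d' * (d * e) = d' * (d * e' - d * e) := by
      rw [← mul_assoc, hDD]; noncomm_ring
    rw [k1, k2, ← mul_assoc, central_sub, mul_assoc, hDE, ← mul_assoc, ← central_mul, mul_assoc]
  · have k1 : d * (f' * d') - f' * d' * d = (d * f' - f' * d) * d' := by
      rw [mul_assoc f', ← hDD]; noncomm_ring
    have k2 : f * d * d' - f' * d' * d = (f * d - f' * d) * d' := by
      rw [mul_assoc f', ← hDD]; noncomm_ring
    rw [k1, k2, ← mul_assoc, hDF, mul_assoc]
  · have k1 : d * (f' * d' * e' + g') - (f' * d' * e' + g') * d =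
        (d * f' - f' * d) * (d' * e') + f' * d' * (d * e' - e' * d) := by
      rw [mul_add, add_mul, hDD', mul_sub, sub_mul, ← mul_assoc (f' * d'), mul_assoc f' d' d, ← hDD]
      noncomm_ring
    have k2 : f * d * (d' * e') - f' * d' * (d * e) =
        (f * d - f' * d) * (d' * e') + f' * d' * (d * e' - d * e) := by
      rw [mul_sub, sub_mul, ← mul_assoc (f' * d') d e', mul_assoc f' d' d, ← hDD]
      noncomm_ring
    have k3 : (vInv A - uInv A) * (f' * d' * (d * e' - e' * d)) =
        uInv A * vInv A * (f' * d' * (d * e' - d * e)) := by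
      rw [← mul_assoc, central_sub, mul_assoc, hDE, ← mul_assoc, ← central_mul, mul_assoc]
    rw [k1, k2, mul_add, mul_add, k3, ← mul_assoc, hDF, mul_assoc]

/-- Since o is the first index, a matrix unit avoiding o is D_a^{(1)} or an iterated bracket of
E_k^{(1)} or F_k^{(1)} with k beyond the first, all of which commute with D_o. -/
theorem drUnit_lie_D {o : Fin n} (ho : (o : ℕ) = 0) {a b : Fin n} (ha : a ≠ o) (hb : b ≠ o) (r : ℕ) :
    ⁅drUnit D E F a b, D o r⁆ = 0 := by
  have ha' : (a : ℕ) ≠ 0 := fun h => ha (Fin.ext (h.trans ho.symm))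
  have hb' : (b : ℕ) ≠ 0 := fun h => hb (Fin.ext (h.trans ho.symm))
  have hz : ∀ (k : ℕ) (hk : k < n - 1), 1 ≤ k → o ≠ lo ⟨k, hk⟩ ∧ o ≠ hi ⟨k, hk⟩ := fun k hk h => by
    simp only [Ne, Fin.ext_iff, lo, hi]; omega
  have he : ∀ k, 1 ≤ k → ⁅extendZero (fun j => E j 1) k, D o r⁆ = 0 := fun k hk => by
    rw [extendZero]
    split_ifs with h
    · rw [← lie_skew, H.D_E _ _ _ _ le_rfl]; simp [delta, hz k h hk]
    · rw [zero_lie]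
  have hf : ∀ k, 1 ≤ k → ⁅-extendZero (fun j => F j 1) k, D o r⁆ = 0 := fun k hk => by
    rw [extendZero]
    split_ifs with h
    · rw [neg_lie, ← lie_skew, H.D_F _ _ _ _ le_rfl]; simp [delta, hz k h hk]
    · simp
  rw [drUnit, glRoot]
  split_ifs
  · exact posRoot_lie_eq_zero (fun k hk => he k (by omega)) _
  · rw [extendZero_val, H.D_D]
  · rw [neg_lie, posRoot_lie_eq_zero (fun k hk => hf k (by omega)), neg_zero]

variable [Algebra ℂ A]

theorem drUnit_acts {o : Fin n} (ho : (o : ℕ) = 0) (a b : Fin n) (r : ℕ) :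
    ActsAsUnit (drUnit D E F a b) a b (fun i k => drT D E F o i k r) := by
  have hg : ∀ a b, ActsAsUnit (drUnit D E F a b) a b (drUnit D E F) := H.isChevalley.glRoot_lie
  have hD : ∀ a b, a ≠ o → b ≠ o → ⁅drUnit D E F a b, D o r⁆ = 0 := fun a b ha hb =>
    H.drUnit_lie_D ho ha hb r
  have hD0 : ⁅drUnit D E F o o, D o r⁆ = 0 := by rw [drUnit_self, H.D_D]
  by_cases hn : n = 1
  · subst hn
    have huniq : ∀ b : Fin 1, b = o := fun b => Subsingleton.elim _ _
    exact actsAsUnit_adjFamily hg hD hD0 (fun b c hb => absurd (huniq b) hb)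
      (fun b c hb => absurd (huniq b) hb) a b
  have hn1 : 0 < n - 1 := by have := o.2; omega
  have ho' : lo ⟨0, hn1⟩ = o := Fin.ext ho.symm
  subst ho'
  have hne := (lo_ne_hi ⟨0, hn1⟩).symm
  refine actsAsUnit_adjFamily hg hD hD0
    (fun b c hb hc => row_vanish hg hD two_torsion_free hne ?_ hb hc)
    (fun b c hb hc => column_vanish hg hD two_torsion_free hne ?_ hb hc) a b
  · rw [drUnit_lo_hi]; exact H.E_lie_D_lie_E _ r
  · rw [drUnit_hi_lo]; exact H.F_lie_F_lie_D _ r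

/-- Drinfeld's relations imply the RTT relations. -/
theorem isRTT_drT {o : Fin n} (ho : (o : ℕ) = 0) : IsRTT (drT D E F o) where
  zero i k := by
    rw [drT, H.D_zero, adjFamily]
    have h1 : ∀ x : A, ⁅x, (1 : A)⁆ = 0 := fun x => by simp [Ring.lie_def]
    have h2 : ∀ x : A, ⁅(1 : A), x⁆ = 0 := fun x => by simp [Ring.lie_def]
    simp only [h1, h2, lie_zero, zero_add]
    split_ifs <;> simp_all
  rel i k l m r s := by
    rw [← sub_eq_zero]
    change rttDefect (drT D E F o) r s i k l m = 0
    -- With a single index there is no p ≠ o for the covariance argument, and the relation is just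
    -- the commutativity of the D's.
    by_cases hn : n = 1
    · subst hn
      have huniq : ∀ b : Fin 1, b = o := fun b => Subsingleton.elim _ _
      rw [huniq i, huniq k, huniq l, huniq m, rttDefect]
      simp only [drT, adjFamily_oo, H.D_D]
      have := H.D_D o o r s
      rw [Ring.lie_def] at this
      rw [this]; simp
    have hn1 : 0 < n - 1 := by have := o.2; omega
    have ho' : lo ⟨0, hn1⟩ = o := Fin.ext ho.symm
    subst ho'
    obtain ⟨h1, h2, h3, h4⟩ := H.rttDefect_drT ⟨0, hn1⟩ r s
    exact rttDefect_eq_zero (fun a b r => H.drUnit_acts ho a b r) (lo_ne_hi ⟨0, hn1⟩).symm r s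
      h1 h2 h3 h4 i k l m

end IsDrinfeld

end DrinfeldSeries

/-! ### Generation, and the isomorphism -/

section Generation

attribute [local instance] LieRing.ofAssociativeRing

open PowerSeries

/-- The equivariant map with e_{oo} ↦ e_{oo} is the identity. Thus the constructed T^{(1)} consists
of the matrix units themselves, in particular E_j^{(1)} and F_j^{(1)} next to the diagonal. -/
theorem adjFamily_unit {L : Type*} [LieRing L] {ι : Type*} [DecidableEq ι] {g : ι → ι → L}
    (hg : ∀ a b, ActsAsUnit (g a b) a b g) (o i j : ι) : adjFamily g o (g o o) i j = g i j := by
  rw [adjFamily]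
  have h1 : ∀ j, j ≠ o → ⁅g o o, g o j⁆ = g o j := fun j hj => by rw [hg]; simp [hj]
  split_ifs with hi hj hj hij
  · rw [hi, hj]
  · rw [h1 j hj, hi]
  · rw [hg, hj]; simp [Ne.symm hi]
  · rw [h1 j hj, hg]; simp [hij]
  · rw [h1 j hj, hg]; simp [Ne.symm hij]

theorem IsDrinfeld.drT_one {A : Type*} [Ring A] [Algebra ℂ A] {n : ℕ} {D Dt : Fin n → ℕ → A}
    {E F : Fin (n - 1) → ℕ → A} (H : IsDrinfeld D Dt E F) (o i j : Fin n) :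
    drT D E F o i j 1 = drUnit D E F i j := by
  have hg : ∀ a b, ActsAsUnit (drUnit D E F a b) a b (drUnit D E F) := H.isChevalley.glRoot_lie
  rw [drT, ← drUnit_self D E F o, adjFamily_unit hg]

theorem lie_mem {A : Type*} [Ring A] [Algebra ℂ A] {S : Subalgebra ℂ A} {x y : A} (hx : x ∈ S)
    (hy : y ∈ S) : ⁅x, y⁆ ∈ S := by
  rw [Ring.lie_def]; exact S.sub_mem (S.mul_mem hx hy) (S.mul_mem hy hx)

/-- A subalgebra that contains `D_1^{(r)}`, `E_j^{(1)}` and `F_j^{(1)}` contains all of Drinfeld's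
generators. -/
theorem IsDrinfeld.mem {A : Type*} [Ring A] [Algebra ℂ A] {n : ℕ} {D Dt : Fin n → ℕ → A}
    {E F : Fin (n - 1) → ℕ → A} (H : IsDrinfeld D Dt E F) {S : Subalgebra ℂ A}
    (hD : ∀ o : Fin n, (o : ℕ) = 0 → ∀ r, D o r ∈ S) (hE : ∀ j, E j 1 ∈ S) (hF : ∀ j, F j 1 ∈ S) :
    (∀ i r, D i r ∈ S) ∧ (∀ i r, Dt i r ∈ S) ∧ (∀ j r, 1 ≤ r → E j r ∈ S) ∧
      ∀ j r, 1 ≤ r → F j r ∈ S := by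
  have stepE : ∀ j, (∀ r, D (lo j) r ∈ S) → ∀ s, 1 ≤ s → E j s ∈ S := by
    intro j hj s hs
    induction s, hs using Nat.le_induction with
    | base => exact hE j
    | succ s hs ih =>
      -- The case r = 2 reads ⁅D^{(2)}, E^{(s)}⁆ = E^{(s+1)} + D^{(1)}E^{(s)} and is solved for
      -- E^{(s+1)}.
      have h := H.D_E (lo j) j 2 s hs
      rw [Finset.sum_range_succ, Finset.sum_range_one, H.D_zero, one_mul, delta, delta, if_pos rfl,
        if_neg (lo_ne_hi j), sub_zero, one_smul, show 2 + s - 1 - 0 = s + 1 by omega,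
        show 2 + s - 1 - 1 = s by omega, ← sub_eq_iff_eq_add] at h
      rw [← h]
      exact S.sub_mem (lie_mem (hj 2) ih) (S.mul_mem (hj 1) ih)
  have stepF : ∀ j, (∀ r, D (lo j) r ∈ S) → ∀ s, 1 ≤ s → F j s ∈ S := by
    intro j hj s hs
    induction s, hs using Nat.le_induction with
    | base => exact hF j
    | succ s hs ih =>
      have h := H.D_F (lo j) j 2 s hs
      rw [Finset.sum_range_succ, Finset.sum_range_one, H.D_zero, mul_one, delta, delta, if_pos rfl,
        if_neg (lo_ne_hi j), zero_sub, neg_smul, one_smul, show 2 + s - 1 - 0 = s + 1 by omega,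
        show 2 + s - 1 - 1 = s by omega, ← neg_eq_iff_eq_neg, ← sub_eq_iff_eq_add] at h
      rw [← h]
      exact S.sub_mem (S.neg_mem (lie_mem (hj 2) ih)) (S.mul_mem ih (hj 1))
  have stepDt : ∀ i, (∀ r, D i r ∈ S) → ∀ r, Dt i r ∈ S := by
    intro i hi r
    induction r using Nat.strong_induction_on with
    | _ r ih =>
      have h := H.D_Dt i r
      rw [← Nat.range_succ_eq_Icc_zero, Finset.sum_range_succ', H.D_zero, one_mul, Nat.sub_zero,
        ← eq_sub_iff_add_eq'] at h
      rw [h]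
      refine S.sub_mem (S.zsmul_mem S.one_mem _) (S.sum_mem fun t ht => ?_)
      have := Finset.mem_range.1 ht
      exact S.mul_mem (hi _) (ih _ (by omega))
  have stepD : ∀ j, (∀ r, D (lo j) r ∈ S) → ∀ r, D (hi j) r ∈ S := by
    intro j hj r
    induction r using Nat.strong_induction_on with
    | _ r ih =>
      rcases r with _ | r
      · rw [H.D_zero]; exact S.one_mem
      -- As D̃^{(0)} = -1, the top term of this sum is -D_{hi j}^{(r+1)}; all others contain lower
      -- coefficients of D_{hi j}.
      have h := H.E_F j j (r + 1) 1 (by omega) le_rfl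
      rw [← Nat.range_succ_eq_Icc_zero, Finset.sum_range_succ', H.Dt_zero, delta, if_pos rfl,
        one_smul, neg_mul, one_mul, Nat.add_sub_cancel, Nat.sub_zero, ← sub_eq_add_neg,
        eq_sub_iff_add_eq', ← eq_sub_iff_add_eq] at h
      rw [h]
      refine S.sub_mem (S.sum_mem fun t ht => ?_) (lie_mem (stepE j hj _ (by omega)) (hF j))
      have := Finset.mem_range.1 ht
      exact S.mul_mem (stepDt _ hj _) (ih _ (by omega))
  have allD : ∀ (k : ℕ) (hk : k < n) (r : ℕ), D ⟨k, hk⟩ r ∈ S := by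
    intro k
    induction k with
    | zero => exact fun hk r => hD _ rfl r
    | succ k ih => exact fun hk r => stepD ⟨k, by omega⟩ (fun r => ih (by omega) r) r
  have allD' : ∀ i r, D i r ∈ S := fun i r => allD i i.2 r
  exact ⟨allD', fun i => stepDt i (allD' i), fun j => stepE j (allD' _), fun j => stepF j (allD' _)⟩

/-- A subalgebra that contains `T_{1,1}^{(r)}`, `T_{j,j+1}^{(1)}` and `T_{j+1,j}^{(1)}` contains all
the `T_{i,j}^{(r)}`. -/
theorem IsRTT.mem {A : Type*} [Ring A] [Algebra ℂ A] {n : ℕ} {T : Fin n → Fin n → ℕ → A}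
    (hT : IsRTT T) {S : Subalgebra ℂ A} (h0 : ∀ o : Fin n, (o : ℕ) = 0 → ∀ r, T o o r ∈ S)
    (hE : ∀ j, T (lo j) (hi j) 1 ∈ S) (hF : ∀ j, T (hi j) (lo j) 1 ∈ S) (i j : Fin n) (r : ℕ) :
    T i j r ∈ S := by
  have hrow : ∀ (k : ℕ) (hk : k < n), T ⟨0, by omega⟩ ⟨k, hk⟩ r ∈ S := by
    intro k
    induction k with
    | zero => exact fun hk => h0 _ rfl r
    | succ k ih =>
      intro hk
      -- Superdiagonal elements move along the first row; subdiagonal ones then move down the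
      -- columns.
      have h := hT.lie_one (lo ⟨k, by omega⟩) (hi ⟨k, by omega⟩) r ⟨0, by omega⟩ ⟨k, by omega⟩
      rw [if_neg (by simp [hi]), if_pos (by simp [lo]), zero_sub, ← neg_eq_iff_eq_neg] at h
      change _ = T ⟨0, _⟩ ⟨k + 1, hk⟩ r at h
      rw [← h]
      exact S.neg_mem (lie_mem (hE _) (ih (by omega)))
  have hall : ∀ (k : ℕ) (hk : k < n) (j : Fin n), T ⟨k, hk⟩ j r ∈ S := by
    intro k
    induction k with
    | zero => exact fun hk j => hrow j j.2
    | succ k ih =>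
      intro hk j
      have h := hT.lie_one (hi ⟨k, by omega⟩) (lo ⟨k, by omega⟩) r ⟨k, by omega⟩ j
      rw [if_pos (by simp [lo]), eq_sub_iff_add_eq] at h
      change _ = T ⟨k + 1, hk⟩ j r at h
      rw [← h]
      refine S.add_mem (lie_mem (hF _) (ih (by omega) j)) ?_
      split_ifs
      · exact ih (by omega) _
      · exact S.zero_mem
  exact hall i i.2 j

theorem yangian_subalgebra_eq_top {n : ℕ} {S : Subalgebra ℂ (Yangian n)}
    (h : ∀ i j r, (genT i j r : Yangian n) ∈ S) : S = ⊤ := by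
  rw [eq_top_iff]
  rintro x -
  obtain ⟨x, rfl⟩ := RingQuot.mkAlgHom_surjective ℂ (RTTRel n) x
  have : x ∈ S.comap (RingQuot.mkAlgHom ℂ (RTTRel n)) := by
    have htop : Algebra.adjoin ℂ (Set.range (FreeAlgebra.ι ℂ : _ → FreeT n)) ≤
        S.comap (RingQuot.mkAlgHom ℂ (RTTRel n)) := by
      refine Algebra.adjoin_le ?_
      rintro _ ⟨⟨i, j, r⟩, rfl⟩
      exact h i j (r + 1)
    rw [FreeAlgebra.adjoin_range_ι] at htop
    exact htop trivial
  exact this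

theorem drinfeld_subalgebra_eq_top {n : ℕ} {S : Subalgebra ℂ (DrinfeldYangian n)}
    (hD : ∀ i r, drMk n (frD i r) ∈ S) (hDt : ∀ i r, drMk n (frDt i r) ∈ S)
    (hE : ∀ j r, 1 ≤ r → drMk n (frE j r) ∈ S) (hF : ∀ j r, 1 ≤ r → drMk n (frF j r) ∈ S) :
    S = ⊤ := by
  rw [eq_top_iff]
  rintro x -
  obtain ⟨x, rfl⟩ := RingQuot.mkAlgHom_surjective ℂ (DrinfeldRel n) x
  have : x ∈ S.comap (drMk n) := by
    have htop : Algebra.adjoin ℂ (Set.range (FreeAlgebra.ι ℂ : _ → FreeDr n)) ≤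
        S.comap (drMk n) := by
      refine Algebra.adjoin_le ?_
      rintro _ ⟨x, rfl⟩
      cases x with
      | D i r => exact hD i r
      | Dt i r => exact hDt i r
      | E j r => exact hE j (r + 1) (by omega)
      | F j r => exact hF j (r + 1) (by omega)
    rw [FreeAlgebra.adjoin_range_ι] at htop
    exact htop trivial
  exact this

theorem isDrinfeld_drMk (n : ℕ) : IsDrinfeld (fun i r => drMk n (frD i r))
    (fun i r => drMk n (frDt i r)) (fun j r => drMk n (frE j r)) (fun j r => drMk n (frF j r)) := by
  have rel : ∀ {x y}, DrinfeldRel n x y → drMk n x = drMk n y := fun h =>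
    RingQuot.mkAlgHom_rel ℂ h
  have lie : ∀ x y, drMk n ⁅x, y⁆ = ⁅drMk n x, drMk n y⁆ := fun x y => by
    simp only [Ring.lie_def, map_sub, map_mul]
  refine ⟨fun j => map_zero _, fun j => map_zero _, fun i => ?_, fun i r => ?_, fun i j r s => ?_,
    fun i j r s hr hs => ?_, fun i j r s hs => ?_, fun i j r s hs => ?_, fun j r s hr hs => ?_,
    fun j r s hr hs => ?_, fun i j hij => ?_, fun i j hij => ?_, fun i j hij => ?_,
    fun i j hij => ?_⟩
  · simpa only [map_one] using rel (.r0 i)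
  · simpa only [map_sum, map_mul, map_zsmul, map_one] using rel (.r1 i r)
  · simpa only [lie, map_zero] using rel (.r2 i j r s)
  · simpa only [lie, map_sum, map_mul, map_zsmul] using rel (.r3 i j r s hr hs)
  · simpa only [lie, map_sum, map_mul, map_zsmul] using rel (.r4 i j r s hs)
  · simpa only [lie, map_sum, map_mul, map_zsmul] using rel (.r5 i j r s hs)
  · simpa only [lie, map_sum, map_mul, map_sub] using rel (.r6 j r s hr hs)
  · simpa only [lie, map_sum, map_mul, map_sub] using rel (.r7 j r s hr hs)
  · simpa only [lie, map_zero] using rel (.r10 i j hij 1 1 le_rfl le_rfl)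
  · simpa only [lie, map_zero] using rel (.r11 i j hij 1 1 le_rfl le_rfl)
  · simpa only [lie, map_zero, map_add] using rel (.r12 i j hij 1 1 1 le_rfl le_rfl le_rfl)
  · simpa only [lie, map_zero, map_add] using rel (.r13 i j hij 1 1 1 le_rfl le_rfl le_rfl)

/-- The homomorphism from the RTT presentation to Drinfeld's. -/
theorem exists_yangian_to_drinfeld (n : ℕ) : ∃ ψ : Yangian n →ₐ[ℂ] DrinfeldYangian n,
    (∀ o : Fin n, (o : ℕ) = 0 → ∀ r, ψ (genT o o r) = drMk n (frD o r)) ∧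
    (∀ j, ψ (genT (lo j) (hi j) 1) = drMk n (frE j 1)) ∧
    ∀ j, ψ (genT (hi j) (lo j) 1) = drMk n (frF j 1) := by
  have H := isDrinfeld_drMk n
  rcases Nat.eq_zero_or_pos n with rfl | hn
  · obtain ⟨ψ, -⟩ := exists_yangian_lift (n := 0) (A := DrinfeldYangian 0)
      (T := fun i => i.elim0) ⟨fun i => i.elim0, fun i => i.elim0⟩
    exact ⟨ψ, fun o => o.elim0, fun j => Fin.elim0 j, fun j => Fin.elim0 j⟩
  · obtain ⟨ψ, hψ⟩ := exists_yangian_lift (H.isRTT_drT (o := ⟨0, hn⟩) rfl)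
    refine ⟨ψ, fun o ho r => ?_, fun j => ?_, fun j => ?_⟩
    · rw [show o = ⟨0, hn⟩ from Fin.ext ho, hψ, drT, adjFamily_oo]
    · rw [hψ, H.drT_one, drUnit_lo_hi]
    · rw [hψ, H.drT_one, drUnit_hi_lo]

theorem T_zero_zero {A : Type*} [Ring A] {n : ℕ} {T : Fin n → Fin n → ℕ → A}
    {G : GaussFactors n (PowerSeries A)} (hG : G.IsFactorizationOf (seriesMatrix T)) {o : Fin n}
    (ho : (o : ℕ) = 0) (r : ℕ) : T o o r = G.coeffD o r := by
  have h : seriesMatrix T o o = G.D o := by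
    rw [hG.eq_mul, gauss_apply, sum_eq_diag (i := o), hG.F_diag, hG.E_diag, one_mul, mul_one]
    intro m hm
    have hm' : o < m := Fin.lt_def.2 (by
      have : (m : ℕ) ≠ o := fun h => hm (Fin.ext h)
      omega)
    rw [hG.F_upper o m hm', zero_mul, zero_mul]
  rw [GaussFactors.coeffD, ← h, coeff_seriesMatrix]

end Generation

end YangianGL

end

/-! ### The isomorphism theorem -/

open YangianGL

theorem theorem5p2 (n : ℕ) :
    (∃! G : YangianGL.GaussFactors n (PowerSeries (YangianGL.Yangian n)),
      G.IsFactorizationOf (YangianGL.tMatrix n)) ∧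
    ∀ G : YangianGL.GaussFactors n (PowerSeries (YangianGL.Yangian n)),
      G.IsFactorizationOf (YangianGL.tMatrix n) →
      (Algebra.adjoin ℂ
          ({x | ∃ (i : Fin n) (r : ℕ), x = G.coeffD i r ∨ x = G.coeffDt i r} ∪
            {x | ∃ (i : Fin (n - 1)) (r : ℕ), 1 ≤ r ∧ (x = G.coeffE i r ∨ x = G.coeffF i r)}) =
        ⊤) ∧
      ∃ φ : YangianGL.DrinfeldYangian n ≃ₐ[ℂ] YangianGL.Yangian n,
        (∀ (i : Fin n) (r : ℕ), φ (YangianGL.drMk n (YangianGL.frD i r)) = G.coeffD i r) ∧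
        (∀ (i : Fin n) (r : ℕ), φ (YangianGL.drMk n (YangianGL.frDt i r)) = G.coeffDt i r) ∧
        (∀ (i : Fin (n - 1)) (r : ℕ), 1 ≤ r →
          φ (YangianGL.drMk n (YangianGL.frE i r)) = G.coeffE i r) ∧
        (∀ (i : Fin (n - 1)) (r : ℕ), 1 ≤ r →
          φ (YangianGL.drMk n (YangianGL.frF i r)) = G.coeffF i r) := by
  have hT := isRTT_genT n
  have htM : tMatrix n = seriesMatrix (fun i j r => (genT i j r : Yangian n)) := rfl
  rw [htM]
  refine ⟨existsUnique_gauss _ hT.constantCoeff, fun G hG => ?_⟩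
  obtain ⟨φ, φD, φDt, φE, φF⟩ := exists_drinfeld_lift hT hG
  obtain ⟨ψ, ψD, ψE, ψF⟩ := exists_yangian_to_drinfeld n
  have tD : ∀ (o : Fin n), (o : ℕ) = 0 → ∀ r, genT o o r = G.coeffD o r := fun o ho r =>
    T_zero_zero hG ho r
  have tE : ∀ j, genT (lo j) (hi j) 1 = G.coeffE j 1 := fun j => T_lo_hi hT hG j
  have tF : ∀ j, genT (hi j) (lo j) 1 = G.coeffF j 1 := fun j => T_hi_lo hT hG j
  -- The fixed elements form a subalgebra, so D_1^{(r)}, E_j^{(1)} and F_j^{(1)} are the only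
  -- generators to check; the other composite is treated likewise.
  have hψφ : AlgHom.equalizer (ψ.comp φ) (AlgHom.id ℂ _) = ⊤ := by
    obtain ⟨h1, h2, h3, h4⟩ := (isDrinfeld_drMk n).mem
      (S := AlgHom.equalizer (ψ.comp φ) (AlgHom.id ℂ (DrinfeldYangian n)))
      (fun o ho r => by
        change ψ (φ _) = _
        rw [φD, ← tD o ho, ψD o ho]; rfl)
      (fun j => by
        change ψ (φ _) = _
        rw [φE _ _ le_rfl, ← tE, ψE]; rfl)
      (fun j => by
        change ψ (φ _) = _
        rw [φF _ _ le_rfl, ← tF, ψF]; rfl)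
    exact drinfeld_subalgebra_eq_top h1 h2 h3 h4
  have hφψ : AlgHom.equalizer (φ.comp ψ) (AlgHom.id ℂ _) = ⊤ := by
    refine yangian_subalgebra_eq_top (hT.mem (fun o ho r => ?_) (fun j => ?_) fun j => ?_)
    · change φ (ψ (genT o o r)) = genT o o r
      rw [ψD o ho, φD, tD o ho]
    · change φ (ψ (genT (lo j) (hi j) 1)) = genT (lo j) (hi j) 1
      rw [ψE, φE _ _ le_rfl, tE]
    · change φ (ψ (genT (hi j) (lo j) 1)) = genT (hi j) (lo j) 1
      rw [ψF, φF _ _ le_rfl, tF]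
  have e1 : ∀ y, φ (ψ y) = y := fun y =>
    (show y ∈ AlgHom.equalizer (φ.comp ψ) (AlgHom.id ℂ _) by rw [hφψ]; trivial)
  have e2 : ∀ x, ψ (φ x) = x := fun x =>
    (show x ∈ AlgHom.equalizer (ψ.comp φ) (AlgHom.id ℂ _) by rw [hψφ]; trivial)
  refine ⟨?_, AlgEquiv.ofAlgHom φ ψ (AlgHom.ext e1) (AlgHom.ext e2), φD, φDt, φE, φF⟩
  set S := Algebra.adjoin ℂ
    ({x | ∃ (i : Fin n) (r : ℕ), x = G.coeffD i r ∨ x = G.coeffDt i r} ∪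
      {x | ∃ (i : Fin (n - 1)) (r : ℕ), 1 ≤ r ∧ (x = G.coeffE i r ∨ x = G.coeffF i r)})
  -- The preimage under φ contains all of Drinfeld's generators, and φ is onto because φ ∘ ψ is the
  -- identity.
  have hS : S.comap φ = ⊤ := by
    refine drinfeld_subalgebra_eq_top (fun i r => ?_) (fun i r => ?_) (fun j r hr => ?_)
      fun j r hr => ?_
    · rw [Subalgebra.mem_comap, φD]
      exact Algebra.subset_adjoin (Or.inl ⟨i, r, Or.inl rfl⟩)
    · rw [Subalgebra.mem_comap, φDt]
      exact Algebra.subset_adjoin (Or.inl ⟨i, r, Or.inr rfl⟩)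
    · rw [Subalgebra.mem_comap, φE _ _ hr]
      exact Algebra.subset_adjoin (Or.inr ⟨j, r, hr, Or.inl rfl⟩)
    · rw [Subalgebra.mem_comap, φF _ _ hr]
      exact Algebra.subset_adjoin (Or.inr ⟨j, r, hr, Or.inr rfl⟩)
  rw [eq_top_iff]
  rintro y -
  have : ψ y ∈ S.comap φ := by rw [hS]; trivial
  rwa [Subalgebra.mem_comap, e1] at this
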